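/- Let $k$ be a field. A quasi-Hopf algebra over $k$ is an associative unital $k$-algebra $H$ with algebra maps $\Delta:H\to H\otimes H$ and $\varepsilon:H\to k$, an invertible element $\Phi=\sum X^1\otimes X^2\otimes X^3\in H\otimes H\otimes H$ with inverse $\Phi^{-1}=\sum x^1\otimes x^2\otimes x^3$, a unital algebra anti-endomorphism $S$ of $H$ (the antipode, not assumed bijective) and elements $\alpha,\beta\in H$, such that for all $h\in H$, writing $\Delta(h)=\sum h_1\otimes h_2$, $$(\mathrm{id}\otimes\Delta)(\Delta(h))=\Phi\,(\Delta\otimes\mathrm{id})(\Delta(h))\,\Phi^{-1},\quad (\mathrm{id}\otimes\varepsilon)(\Delta(h))=h\otimes 1,\quad (\varepsilon\otimes\mathrm{id})(\Delta(h))=1\otimes h,$$ $$(1\otimes\Phi)(\mathrm{id}\otimes\Delta\otimes\mathrm{id})(\Phi)(\Phi\otimes1)=(\mathrm{id}\otimes\mathrm{id}\otimes\Delta)(\Phi)(\Delta\otimes\mathrm{id}\otimes\mathrm{id})(\Phi),\quad(\mathrm{id}\otimes\varepsilon\otimes\mathrm{id})(\Phi)=1\otimes1\otimes1,$$ $$\sum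 S(h_1)\alpha h_2=\varepsilon(h)\alpha,\quad \sum h_1\beta S(h_2)=\varepsilon(h)\beta,\quad \sum X^1\beta S(X^2)\alpha X^3=1,\quad \sum S(x^1)\alpha x^2\beta S(x^3)=1 .$$ Put $A=(\Phi\otimes1)(\Delta\otimes\mathrm{id}\otimes\mathrm{id})(\Phi^{-1})=\sum A^1\otimes A^2\otimes A^3\otimes A^4$, $B=(\Delta\otimes\mathrm{id}\otimes\mathrm{id})(\Phi)(\Phi^{-1}\otimes1)=\sum B^1\otimes B^2\otimes B^3\otimes B^4$, $\gamma=\sum S(A^2)\alpha A^3\otimes S(A^1)\alpha A^4$, $\delta=\sum B^1\beta S(B^4)\otimes B^2\beta S(B^3)$, and, with $\Delta^{\mathrm{op}}(h)=\sum h_2\otimes h_1$, $$f=\sum f^1\otimes f^2=\sum(S\otimes S)(\Delta^{\mathrm{op}}(x^1))\,\gamma\,\Delta(x^2\beta S(x^3)),\qquad f^{-1}=\sum g^1\otimes g^2=\sum\Delta(S(x^1)\alpha x^2)\,\delta\,(S\otimes S)(\Delta^{\mathrm{op}}(x^3)).$$ (The second element is the inverse of the first.) A right quasi-Hopf $H$-bimodule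 is an $H$-bimodule $M$ with an $H$-bimodule map $\rho:M\to M\otimes H$ (where $M\otimes H$ is a bimodule via $\Delta$) such that $(\mathrm{id}\otimes\varepsilon)\circ\rho=\mathrm{id}$ and $\Phi\cdot(\rho\otimes\mathrm{id})(\rho(m))=(\mathrm{id}\otimes\Delta)(\rho(m))\cdot\Phi$ for all $m\in M$. Its space of alternative coinvariants is $$M^{\overline{\mathrm{co}H}}=\Big\{n\in M\;\Big|\;\rho(n)=\sum x^1\cdot n\cdot S(x^3_2X^3)f^1\otimes x^2X^1\beta S(x^3_1X^2)f^2\Big\}.$$ **Theorem.** Let $H$ be a finite-dimensional quasi-Hopf algebra over $k$. Then $S$ is bijective, so that we may put $p_R=\sum p^1\otimes p^2=\sum x^1\otimes x^2\beta S(x^3)$, $q_R=\sum q^1\otimes q^2=\sum X^1\otimes S^{-1}(\alpha X^3)X^2$, $$U=\sum g^1S(q^2)\otimes g^2S(q^1),\qquad V=\sum S^{-1}(f^2p^2)\otimes S^{-1}(f^1p^1).$$ Let $\{e_i\}$ be a basis of $H$ with dual basis $\{e^i\}$ of $H^*$. With the structure $$\langle h\cdot h^*\cdot h',x\rangle=\langle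 h^*,S^{-1}(h)\,x\,S(h')\rangle,\quad \rho(h^*)=\sum_i e^i*h^*\otimes e_i,\quad \langle h^**g^*,x\rangle=\sum h^*(V^1x_1U^1)\,g^*(V^2x_2U^2)$$ for $h,h',x\in H$ and $h^*,g^*\in H^*$, the dual space $H^*$ is a right quasi-Hopf $H$-bimodule, and its space of alternative coinvariants $\overline{\mathcal L}=(H^*)^{\overline{\mathrm{co}H}}$, the space of left alternative cointegrals on $H$, satisfies $$\dim_k\overline{\mathcal L}=1 .$$ -/

import Mathlib

open scoped TensorProduct

universe u v w

/-- A quasi-bialgebra structure on a `k`-algebra `H`: algebra maps `Δ` and `ε` and an invertible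
reassociator `Φ ∈ H ⊗ H ⊗ H`. Triple and quadruple tensor powers of `H` are bracketed to the
right. -/
structure QuasiBialgebra (k : Type u) (H : Type v) [Field k] [Ring H] [Algebra k H] where
  /-- the comultiplication -/
  Δ : H →ₐ[k] H ⊗[k] H
  /-- the counit -/
  ε : H →ₐ[k] k
  /-- the reassociator -/
  Φ : (H ⊗[k] (H ⊗[k] H))ˣ
  /-- `(id ⊗ Δ)(Δ h) = Φ (Δ ⊗ id)(Δ h) Φ⁻¹` -/
  quasi_coassoc : ∀ h : H,
    Δ.toLinearMap.lTensor H (Δ h) =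
      (Φ : H ⊗[k] (H ⊗[k] H)) *
        TensorProduct.assoc k H H H (Δ.toLinearMap.rTensor H (Δ h)) *
        ((Φ⁻¹ : (H ⊗[k] (H ⊗[k] H))ˣ) : H ⊗[k] (H ⊗[k] H))
  /-- `(id ⊗ ε)(Δ h) = h ⊗ 1` -/
  counit_right : ∀ h : H, ε.toLinearMap.lTensor H (Δ h) = h ⊗ₜ[k] (1 : k)
  /-- `(ε ⊗ id)(Δ h) = 1 ⊗ h` -/
  counit_left : ∀ h : H, ε.toLinearMap.rTensor H (Δ h) = (1 : k) ⊗ₜ[k] h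
  /-- `(1 ⊗ Φ)(id ⊗ Δ ⊗ id)(Φ)(Φ ⊗ 1) = (id ⊗ id ⊗ Δ)(Φ)(Δ ⊗ id ⊗ id)(Φ)` -/
  cocycle :
    ((1 : H) ⊗ₜ[k] (Φ : H ⊗[k] (H ⊗[k] H))) *
        ((TensorProduct.assoc k H H H).toLinearMap ∘ₗ Δ.toLinearMap.rTensor H).lTensor H
          (Φ : H ⊗[k] (H ⊗[k] H)) *
        (((TensorProduct.mk k H H).flip 1).lTensor H).lTensor H (Φ : H ⊗[k] (H ⊗[k] H)) =
      (Δ.toLinearMap.lTensor H).lTensor H (Φ : H ⊗[k] (H ⊗[k] H)) *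
        TensorProduct.assoc k H H (H ⊗[k] H)
          (Δ.toLinearMap.rTensor (H ⊗[k] H) (Φ : H ⊗[k] (H ⊗[k] H)))
  /-- `(id ⊗ ε ⊗ id)(Φ) = 1 ⊗ 1 ⊗ 1` -/
  counit_middle :
    (ε.toLinearMap.rTensor H).lTensor H (Φ : H ⊗[k] (H ⊗[k] H)) =
      (1 : H) ⊗ₜ[k] ((1 : k) ⊗ₜ[k] (1 : H))

/-- A quasi-Hopf algebra structure on a `k`-algebra `H`. The antipode `S` is a unital algebra
anti-endomorphism; it is not required to be bijective. -/
structure QuasiHopfAlgebra (k : Type u) (H : Type v) [Field k] [Ring H] [Algebra k H] extends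
    QuasiBialgebra k H where
  /-- the antipode -/
  S : H →ₗ[k] H
  α : H
  β : H
  S_one : S 1 = 1
  S_mul : ∀ a b : H, S (a * b) = S b * S a
  /-- `∑ S(h₁) α h₂ = ε(h) α` -/
  antipode_left : ∀ h : H,
    LinearMap.mul' k H (TensorProduct.map S (LinearMap.mulLeft k α) (Δ h)) = ε h • α
  /-- `∑ h₁ β S(h₂) = ε(h) β` -/
  antipode_right : ∀ h : H,
    LinearMap.mul' k H (TensorProduct.map (LinearMap.mulRight k β) S (Δ h)) = ε h • β
  /-- `∑ X¹ β S(X²) α X³ = 1`, where `Φ = ∑ X¹ ⊗ X² ⊗ X³` -/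
  antipode_reassoc :
    LinearMap.mul' k H (TensorProduct.map (LinearMap.mulRight k β)
      (LinearMap.mul' k H ∘ₗ TensorProduct.map S (LinearMap.mulLeft k α))
      (Φ : H ⊗[k] (H ⊗[k] H))) = 1
  /-- `∑ S(x¹) α x² β S(x³) = 1`, where `Φ⁻¹ = ∑ x¹ ⊗ x² ⊗ x³` -/
  antipode_reassoc_inv :
    LinearMap.mul' k H (TensorProduct.map (LinearMap.mulRight k α ∘ₗ S)
      (LinearMap.mul' k H ∘ₗ TensorProduct.map (LinearMap.mulRight k β) S)
      ((Φ⁻¹ : (H ⊗[k] (H ⊗[k] H))ˣ) : H ⊗[k] (H ⊗[k] H))) = 1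

noncomputable section

namespace QuasiHopfAlgebra

variable {k : Type u} {H : Type v} [Field k] [Ring H] [Algebra k H] (Q : QuasiHopfAlgebra k H)

/-- `Φ` as an element of `H ⊗ H ⊗ H`. -/
def phi : H ⊗[k] (H ⊗[k] H) := (Q.Φ : H ⊗[k] (H ⊗[k] H))

/-- `Φ⁻¹` as an element of `H ⊗ H ⊗ H`. -/
def phiInv : H ⊗[k] (H ⊗[k] H) := ((Q.Φ⁻¹ : (H ⊗[k] (H ⊗[k] H))ˣ) : H ⊗[k] (H ⊗[k] H))

/-- `x ⊗ y ↦ S(x) α y`. -/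
def evα : H ⊗[k] H →ₗ[k] H :=
  LinearMap.mul' k H ∘ₗ TensorProduct.map Q.S (LinearMap.mulLeft k Q.α)

theorem evα_tmul (x y : H) : Q.evα (x ⊗ₜ[k] y) = Q.S x * Q.α * y := by
  simp [evα, mul_assoc]

/-- `x ⊗ y ↦ x β S(y)`. -/
def evβ : H ⊗[k] H →ₗ[k] H :=
  LinearMap.mul' k H ∘ₗ TensorProduct.map (LinearMap.mulRight k Q.β) Q.S

theorem evβ_tmul (x y : H) : Q.evβ (x ⊗ₜ[k] y) = x * Q.β * Q.S y := by
  simp [evβ]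

/-- `(S ⊗ S) ∘ Δᵒᵖ`, that is `h ↦ ∑ S(h₂) ⊗ S(h₁)`. -/
def SSop : H →ₗ[k] H ⊗[k] H :=
  TensorProduct.map Q.S Q.S ∘ₗ (TensorProduct.comm k H H).toLinearMap ∘ₗ Q.Δ.toLinearMap

/-- `(Δ ⊗ id ⊗ id) : H ⊗ H ⊗ H → H ⊗ H ⊗ H ⊗ H`. -/
def Δ₁ : H ⊗[k] (H ⊗[k] H) →ₗ[k] H ⊗[k] (H ⊗[k] (H ⊗[k] H)) :=
  (TensorProduct.assoc k H H (H ⊗[k] H)).toLinearMap ∘ₗ Q.Δ.toLinearMap.rTensor (H ⊗[k] H)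

/-- `(id ⊗ id ⊗ Δ) : H ⊗ H ⊗ H → H ⊗ H ⊗ H ⊗ H`. -/
def Δ₃ : H ⊗[k] (H ⊗[k] H) →ₗ[k] H ⊗[k] (H ⊗[k] (H ⊗[k] H)) :=
  (Q.Δ.toLinearMap.lTensor H).lTensor H

variable (k H) in
/-- `a ⊗ b ⊗ c ↦ a ⊗ b ⊗ c ⊗ 1`. -/
def tensorOne : H ⊗[k] (H ⊗[k] H) →ₗ[k] H ⊗[k] (H ⊗[k] (H ⊗[k] H)) :=
  (((TensorProduct.mk k H H).flip 1).lTensor H).lTensor H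

/-- `A = (Φ ⊗ 1)(Δ ⊗ id ⊗ id)(Φ⁻¹)`. -/
def A : H ⊗[k] (H ⊗[k] (H ⊗[k] H)) := tensorOne k H Q.phi * Q.Δ₁ Q.phiInv

/-- `B = (Δ ⊗ id ⊗ id)(Φ)(Φ⁻¹ ⊗ 1)`. -/
def B : H ⊗[k] (H ⊗[k] (H ⊗[k] H)) := Q.Δ₁ Q.phi * tensorOne k H Q.phiInv

variable (k H) in
/-- `a ⊗ b ⊗ c ⊗ d ↦ (b ⊗ c) ⊗ (a ⊗ d)`. -/
def permA : H ⊗[k] (H ⊗[k] (H ⊗[k] H)) →ₗ[k] (H ⊗[k] H) ⊗[k] (H ⊗[k] H) :=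
  (TensorProduct.leftComm k H (H ⊗[k] H) H).toLinearMap ∘ₗ
    ((TensorProduct.assoc k H H H).symm.toLinearMap).lTensor H

theorem permA_tmul (a b c d : H) :
    permA k H (a ⊗ₜ[k] (b ⊗ₜ[k] (c ⊗ₜ[k] d))) = (b ⊗ₜ[k] c) ⊗ₜ[k] (a ⊗ₜ[k] d) := by
  simp [permA]

variable (k H) in
/-- `a ⊗ b ⊗ c ⊗ d ↦ (a ⊗ d) ⊗ (b ⊗ c)`. -/
def permB : H ⊗[k] (H ⊗[k] (H ⊗[k] H)) →ₗ[k] (H ⊗[k] H) ⊗[k] (H ⊗[k] H) :=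
  (TensorProduct.comm k (H ⊗[k] H) (H ⊗[k] H)).toLinearMap ∘ₗ permA k H

theorem permB_tmul (a b c d : H) :
    permB k H (a ⊗ₜ[k] (b ⊗ₜ[k] (c ⊗ₜ[k] d))) = (a ⊗ₜ[k] d) ⊗ₜ[k] (b ⊗ₜ[k] c) := by
  simp [permB, permA_tmul]

/-- `γ = ∑ S(A²) α A³ ⊗ S(A¹) α A⁴`. -/
def γ : H ⊗[k] H := TensorProduct.map Q.evα Q.evα (permA k H Q.A)

/-- `δ = ∑ B¹ β S(B⁴) ⊗ B² β S(B³)`. -/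
def δ : H ⊗[k] H := TensorProduct.map Q.evβ Q.evβ (permB k H Q.B)

/-- The gauge transformation `f = ∑ (S ⊗ S)(Δᵒᵖ(x¹)) γ Δ(x² β S(x³))`. -/
def f : H ⊗[k] H :=
  LinearMap.mul' k (H ⊗[k] H)
    (TensorProduct.map (LinearMap.mulRight k Q.γ ∘ₗ Q.SSop) (Q.Δ.toLinearMap ∘ₗ Q.evβ) Q.phiInv)

/-- Its inverse `f⁻¹ = ∑ Δ(S(x¹) α x²) δ (S ⊗ S)(Δᵒᵖ(x³))`. -/
def fInv : H ⊗[k] H :=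
  LinearMap.mul' k (H ⊗[k] H)
    (TensorProduct.map (LinearMap.mulRight k Q.δ ∘ₗ Q.Δ.toLinearMap ∘ₗ Q.evα) Q.SSop
      ((TensorProduct.assoc k H H H).symm Q.phiInv))

/-- `p_R = ∑ x¹ ⊗ x² β S(x³)`. -/
def pR : H ⊗[k] H := Q.evβ.lTensor H Q.phiInv

section BijectiveAntipode

variable (hS : Function.Bijective Q.S)

/-- The inverse of a bijective antipode. -/
def Sinv : H →ₗ[k] H := (LinearEquiv.ofBijective Q.S hS).symm.toLinearMap

theorem S_Sinv (h : H) : Q.S (Q.Sinv hS h) = h :=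
  (LinearEquiv.ofBijective Q.S hS).apply_symm_apply h

theorem Sinv_S (h : H) : Q.Sinv hS (Q.S h) = h :=
  (LinearEquiv.ofBijective Q.S hS).symm_apply_apply h

theorem Sinv_one : Q.Sinv hS 1 = 1 := by
  apply hS.1
  rw [S_Sinv, Q.S_one]

theorem Sinv_mul (a b : H) : Q.Sinv hS (a * b) = Q.Sinv hS b * Q.Sinv hS a := by
  apply hS.1
  rw [S_Sinv, Q.S_mul, S_Sinv, S_Sinv]

/-- `x ⊗ y ↦ S⁻¹(α y) x`. -/
def evq : H ⊗[k] H →ₗ[k] H :=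
  LinearMap.mul' k H ∘ₗ
    (Q.Sinv hS ∘ₗ LinearMap.mulLeft k Q.α).rTensor H ∘ₗ (TensorProduct.comm k H H).toLinearMap

theorem evq_tmul (x y : H) : Q.evq hS (x ⊗ₜ[k] y) = Q.Sinv hS (Q.α * y) * x := by
  simp [evq]

/-- `q_R = ∑ X¹ ⊗ S⁻¹(α X³) X²`. -/
def qR : H ⊗[k] H := (Q.evq hS).lTensor H Q.phi

/-- `U = ∑ g¹ S(q²) ⊗ g² S(q¹)`, where `f⁻¹ = ∑ g¹ ⊗ g²` and `q_R = ∑ q¹ ⊗ q²`. -/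
def U : H ⊗[k] H :=
  Q.fInv * TensorProduct.map Q.S Q.S (TensorProduct.comm k H H (Q.qR hS))

/-- `V = ∑ S⁻¹(f² p²) ⊗ S⁻¹(f¹ p¹)`, where `f = ∑ f¹ ⊗ f²` and `p_R = ∑ p¹ ⊗ p²`. -/
def V : H ⊗[k] H :=
  TensorProduct.map (Q.Sinv hS) (Q.Sinv hS) (TensorProduct.comm k H H (Q.f * Q.pR))

/-- `h ↦ V Δ(h) U`. -/
def Δbar : H →ₗ[k] H ⊗[k] H :=
  LinearMap.mulRight k (Q.U hS) ∘ₗ LinearMap.mulLeft k (Q.V hS) ∘ₗ Q.Δ.toLinearMap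

/-- The product `⟨h* ∗ g*, h⟩ = ∑ h*(V¹ h₁ U¹) g*(V² h₂ U²)` on the dual space `H*`. -/
def star : Module.Dual k H →ₗ[k] Module.Dual k H →ₗ[k] Module.Dual k H :=
  TensorProduct.curry (LinearMap.lcomp k k (Q.Δbar hS) ∘ₗ TensorProduct.dualDistrib k H H)

end BijectiveAntipode

end QuasiHopfAlgebra

/-- An `H`-bimodule `M` (over the ground field `k`) with a linear map `ρ : M → M ⊗ H`.
The left action of `a` is `lact a`; the right action of `b` is `ract (op b)`. -/
structure BimoduleWithCoaction (k : Type u) (H : Type v) (M : Type w) [Field k] [Ring H]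
    [Algebra k H] [AddCommGroup M] [Module k M] where
  lact : H →ₐ[k] Module.End k M
  ract : Hᵐᵒᵖ →ₐ[k] Module.End k M
  lact_ract : ∀ (a b : H) (m : M),
    lact a (ract (MulOpposite.op b) m) = ract (MulOpposite.op b) (lact a m)
  ρ : M →ₗ[k] M ⊗[k] H

namespace BimoduleWithCoaction

variable {k : Type u} {H : Type v} {M : Type w} [Field k] [Ring H] [Algebra k H]
  [AddCommGroup M] [Module k M] (C : BimoduleWithCoaction k H M)

section TensorActions

variable (R : Type v) [Ring R] [Algebra k R]

/-- The left action of `H ⊗ R` on `M ⊗ R`: `(a ⊗ s) · (m ⊗ r) = a · m ⊗ s r`. -/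
def leftBy : H ⊗[k] R →ₗ[k] M ⊗[k] R →ₗ[k] M ⊗[k] R :=
  TensorProduct.homTensorHomMap (.id k) M R M R ∘ₗ
    TensorProduct.map C.lact.toLinearMap (LinearMap.mul k R)

theorem leftBy_tmul (a : H) (s r : R) (m : M) :
    C.leftBy R (a ⊗ₜ[k] s) (m ⊗ₜ[k] r) = C.lact a m ⊗ₜ[k] (s * r) := by
  simp [leftBy]

/-- The right action of `H ⊗ R` on `M ⊗ R`: `(m ⊗ r) · (b ⊗ s) = m · b ⊗ r s`. -/
def rightBy : H ⊗[k] R →ₗ[k] M ⊗[k] R →ₗ[k] M ⊗[k] R :=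
  TensorProduct.homTensorHomMap (.id k) M R M R ∘ₗ
    TensorProduct.map (C.ract.toLinearMap ∘ₗ (MulOpposite.opLinearEquiv k).toLinearMap)
      (LinearMap.mul k R).flip

theorem rightBy_tmul (b : H) (s r : R) (m : M) :
    C.rightBy R (b ⊗ₜ[k] s) (m ⊗ₜ[k] r) = C.ract (MulOpposite.op b) m ⊗ₜ[k] (r * s) := by
  simp [rightBy]

end TensorActions

/-- The axioms of a right quasi-Hopf `H`-bimodule. -/
structure IsRightQuasiHopfBimodule (Q : QuasiBialgebra k H) : Prop where
  /-- `ρ(h · m) = Δ(h) · ρ(m)` -/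
  ρ_lact : ∀ (h : H) (m : M), C.ρ (C.lact h m) = C.leftBy H (Q.Δ h) (C.ρ m)
  /-- `ρ(m · h) = ρ(m) · Δ(h)` -/
  ρ_ract : ∀ (h : H) (m : M),
    C.ρ (C.ract (MulOpposite.op h) m) = C.rightBy H (Q.Δ h) (C.ρ m)
  /-- `(id ⊗ ε)(ρ(m)) = m` -/
  counit : ∀ m : M, Q.ε.toLinearMap.lTensor M (C.ρ m) = m ⊗ₜ[k] (1 : k)
  /-- `Φ · (ρ ⊗ id)(ρ(m)) = (id ⊗ Δ)(ρ(m)) · Φ` -/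
  quasi_coassoc : ∀ m : M,
    C.leftBy (H ⊗[k] H) (Q.Φ : H ⊗[k] (H ⊗[k] H))
        (TensorProduct.assoc k M H H (C.ρ.rTensor H (C.ρ m))) =
      C.rightBy (H ⊗[k] H) (Q.Φ : H ⊗[k] (H ⊗[k] H)) (Q.Δ.toLinearMap.lTensor M (C.ρ m))

/-- `a ⊗ (r ⊗ s) ↦ (n ↦ a · n · r ⊗ s)`. -/
def sandwich : H ⊗[k] (H ⊗[k] H) →ₗ[k] M →ₗ[k] M ⊗[k] H :=
  TensorProduct.lift (LinearMap.mk₂ k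
    (fun (a : H) (t : H ⊗[k] H) =>
      (C.lact a).rTensor H ∘ₗ C.rightBy H t ∘ₗ (TensorProduct.mk k M H).flip 1)
    (fun a b t => by
      rw [map_add, LinearMap.rTensor_add, LinearMap.add_comp])
    (fun c a t => by
      rw [map_smul, LinearMap.rTensor_smul, LinearMap.smul_comp])
    (fun a t t' => by
      rw [map_add, LinearMap.add_comp, LinearMap.comp_add])
    (fun c a t => by
      rw [map_smul, LinearMap.smul_comp, LinearMap.comp_smul]))

theorem sandwich_tmul (a r s : H) (n : M) :
    C.sandwich (a ⊗ₜ[k] (r ⊗ₜ[k] s)) n = C.lact a (C.ract (MulOpposite.op r) n) ⊗ₜ[k] s := by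
  simp [sandwich, rightBy_tmul]

/-- `b ⊗ c ⊗ d ↦ (S(d) ⊗ b β S(c)) f`. -/
def _root_.QuasiHopfAlgebra.altTail (Q : QuasiHopfAlgebra k H) :
    H ⊗[k] (H ⊗[k] H) →ₗ[k] H ⊗[k] H :=
  LinearMap.mulRight k Q.f ∘ₗ
    (TensorProduct.comm k H H).toLinearMap ∘ₗ
      TensorProduct.map Q.evβ Q.S ∘ₗ (TensorProduct.assoc k H H H).symm.toLinearMap

theorem _root_.QuasiHopfAlgebra.altTail_tmul (Q : QuasiHopfAlgebra k H) (b c d : H) :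
    Q.altTail (b ⊗ₜ[k] (c ⊗ₜ[k] d)) = (Q.S d ⊗ₜ[k] (b * Q.β * Q.S c)) * Q.f := by
  simp [QuasiHopfAlgebra.altTail, QuasiHopfAlgebra.evβ_tmul]

/-- `∑ x¹ ⊗ S(x³₂ X³) f¹ ⊗ x² X¹ β S(x³₁ X²) f²`. It is computed from
`(id ⊗ id ⊗ Δ)(Φ⁻¹)(1 ⊗ Φ) = ∑ x¹ ⊗ x² X¹ ⊗ x³₁ X² ⊗ x³₂ X³`. -/
def _root_.QuasiHopfAlgebra.altElement (Q : QuasiHopfAlgebra k H) : H ⊗[k] (H ⊗[k] H) :=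
  Q.altTail.lTensor H (Q.Δ₃ Q.phiInv * (1 : H) ⊗ₜ[k] Q.phi)

/-- The alternative coinvariants of `M`: the space of all `n ∈ M` with
`ρ(n) = ∑ x¹ · n · S(x³₂ X³) f¹ ⊗ x² X¹ β S(x³₁ X²) f²`. -/
def altCoinvariants (Q : QuasiHopfAlgebra k H) : Submodule k M :=
  LinearMap.eqLocus C.ρ (C.sandwich Q.altElement)

end BimoduleWithCoaction

namespace QuasiHopfAlgebra

variable {k : Type u} {H : Type v} [Field k] [Ring H] [Algebra k H] [FiniteDimensional k H]
  (Q : QuasiHopfAlgebra k H)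

/-- The dual space `H*` with the `H`-bimodule structure
`⟨h · h* · h', x⟩ = ⟨h*, S⁻¹(h) x S(h')⟩` and the coaction `ρ(h*) = ∑ eⁱ ∗ h* ⊗ eᵢ`, where
`(eᵢ)` is a basis of `H` and `(eⁱ)` the dual basis of `H*`. -/
def dualBimodule (hS : Function.Bijective Q.S) :
    BimoduleWithCoaction k H (Module.Dual k H) where
  lact := AlgHom.ofLinearMap
    (LinearMap.mk₂ k (fun (a : H) (l : Module.Dual k H) => l ∘ₗ LinearMap.mulLeft k (Q.Sinv hS a))
      (fun a b l => by ext x; simp [add_mul])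
      (fun c a l => by ext x; simp)
      (fun a l l' => by ext x; simp)
      (fun c a l => by ext x; simp))
    (by ext l x; simp [Q.Sinv_one hS])
    (fun a b => by ext l x; simp [Q.Sinv_mul hS])
  ract := AlgHom.ofLinearMap
    (LinearMap.mk₂ k
      (fun (b : Hᵐᵒᵖ) (l : Module.Dual k H) => l ∘ₗ LinearMap.mulRight k (Q.S b.unop))
      (fun a b l => by ext x; simp [mul_add])
      (fun c a l => by ext x; simp)
      (fun a l l' => by ext x; simp)
      (fun c a l => by ext x; simp))
    (by ext l x; simp [Q.S_one])
    (fun a b => by ext l x; simp [Q.S_mul, mul_assoc])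
  lact_ract a b l := by ext x; simp [mul_assoc]
  ρ := ∑ i, (TensorProduct.mk k (Module.Dual k H) H).flip (Module.finBasis k H i) ∘ₗ
    Q.star hS ((Module.finBasis k H).coord i)

theorem dualBimodule_lact_ract_apply (hS : Function.Bijective Q.S) (a b x : H)
    (l : Module.Dual k H) :
    (Q.dualBimodule hS).lact a ((Q.dualBimodule hS).ract (MulOpposite.op b) l) x =
      l (Q.Sinv hS a * x * Q.S b) := by
  simp [dualBimodule]

/-- The space of left alternative cointegrals on `H`: the alternative coinvariants of `H*`. -/
def leftAltCointegrals (hS : Function.Bijective Q.S) : Submodule k (Module.Dual k H) :=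
  (Q.dualBimodule hS).altCoinvariants Q

end QuasiHopfAlgebra

end

/-! The dimension comes from a structure theorem. Over a finite-dimensional `H`, every right
quasi-Hopf bimodule `M` is linearly isomorphic to its alternative coinvariants tensored with `H`.
For `M = H*` this gives `dim L * dim H = dim H`, and `H` is nonzero because it carries a counit. It
remains to show that `S` is bijective and that `H*` satisfies the bimodule axioms.

Every long computation uses one device. Algebra maps `H → B` with commuting images are treated as
objects ("strands") of a monoidal category: `cp` is the tensor product, `eps` the unit object, `ass`
the associator, and the axioms on `Φ` give the pentagon and the unit constraints. Take `B = End V`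
and `z E = φ (E v)`. The antipode axioms then say that `φ` (an evaluation, containing `α`) or `v` (a
coevaluation, containing `β`) is invariant under a pair of strands, so that pair may be replaced by
`eps` at the left, respectively right, end of `E`. An identity in `Φ, α, β` becomes a coherence
identity between bracketings in which contracted pairs are erased.

Bijectivity of `S` (`antipode_bijective`): if algebra maps `g₁, g₂` agree on the image of `S`, then
`∑ g₁(X¹ β S(X²)) g₂(α X³)` intertwines them, and it equals `1` by a zigzag. So `S` is cancellable,
and so is each power of `S²`. By Fitting's lemma a high power of `S²` yields an algebra retraction
of `H` onto its image; cancelling that power shows the retraction is the identity, so `S` is onto.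

The bimodule `H*` (`dualBimodule_isRightQuasiHopfBimodule`): the gauge element satisfies `f Δ(S h) =
(S ⊗ S)(Δᵒᵖ h) f`, `f Δ(α) = γ`, `Δ(β) f⁻¹ = δ` and a twisted cocycle identity (`f_cocycle`).
Together with the behaviour of `p_R` and `q_R` under `Δ` these yield the identities for `U` and `V`
that express linearity, counitality and quasi-coassociativity of the coaction.

The structure theorem (`structureEquiv`): `E(m) = m₀ · β S(m₁)` takes values in the alternative
coinvariants and acts on them as `ε(β)`. The maps `m ↦ E(m₀) ⊗ m₁` and `n ⊗ h ↦ X¹ · n · S(X²) α X³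
h` are mutually inverse. -/

/-- Two algebra homomorphisms into `B` with commuting images. -/
class CommHom {k : Type*} {X Y B : Type*} [Field k] [Semiring X] [Algebra k X] [Semiring Y] [Algebra k Y]
    [Semiring B] [Algebra k B] (a : X →ₐ[k] B) (b : Y →ₐ[k] B) : Prop where
  comm : ∀ x y, Commute (a x) (b y)

noncomputable section

/-! ### Commuting algebra maps, and equality as seen through a linear map -/

section PairHom

variable {k : Type*} {X Y Z W B N : Type*} [Field k] [Semiring X] [Algebra k X] [Semiring Y] [Algebra k Y]
  [Semiring Z] [Algebra k Z] [Semiring W] [Algebra k W] [Semiring B] [Algebra k B] [AddCommMonoid N] [Module k N]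

/-- `x ⊗ y ↦ a x * b y` for algebra homomorphisms with commuting images. -/
def pairHom (a : X →ₐ[k] B) (b : Y →ₐ[k] B) [CommHom a b] : X ⊗[k] Y →ₐ[k] B :=
  Algebra.TensorProduct.lift a b CommHom.comm

@[simp] theorem pairHom_tmul (a : X →ₐ[k] B) (b : Y →ₐ[k] B) [CommHom a b] (x : X) (y : Y) :
    pairHom a b (x ⊗ₜ[k] y) = a x * b y := by
  simp [pairHom]

theorem CommHom.symm (a : X →ₐ[k] B) (b : Y →ₐ[k] B) [CommHom a b] : CommHom b a :=
  ⟨fun x y => (CommHom.comm y x).symm⟩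

instance CommHom.pair_left (a : X →ₐ[k] B) (b : Y →ₐ[k] B) (c : Z →ₐ[k] B) [CommHom a b]
    [CommHom a c] [CommHom b c] : CommHom (pairHom a b) c where
  comm t z := by
    induction t with
    | zero => simp
    | tmul x y => simpa using (CommHom.comm x z).mul_left (CommHom.comm y z)
    | add s t hs ht => simpa using hs.add_left ht

instance CommHom.pair_right (a : X →ₐ[k] B) (b : Y →ₐ[k] B) (c : Z →ₐ[k] B) [CommHom a b]
    [CommHom a c] [CommHom b c] : CommHom a (pairHom b c) where
  comm x t := by
    induction t with
    | zero => simp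
    | tmul y z => simpa using (CommHom.comm x y).mul_right (CommHom.comm x z)
    | add s t hs ht => simpa using hs.add_right ht

instance CommHom.comp_left (a : X →ₐ[k] B) (b : Y →ₐ[k] B) (g : W →ₐ[k] X) [CommHom a b] :
    CommHom (a.comp g) b := ⟨fun x y => CommHom.comm (g x) y⟩

instance CommHom.comp_right (a : X →ₐ[k] B) (b : Y →ₐ[k] B) (g : W →ₐ[k] Y) [CommHom a b] :
    CommHom a (b.comp g) := ⟨fun x y => CommHom.comm x (g y)⟩

theorem pairHom_lTensor (a : X →ₐ[k] B) (b : Y →ₐ[k] B) [CommHom a b] (g : W →ₐ[k] Y)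
    (t : X ⊗[k] W) :
    pairHom a b (g.toLinearMap.lTensor X t) = pairHom a (b.comp g) t := by
  induction t with
  | zero => simp
  | tmul x y => simp
  | add s t hs ht => simp only [map_add, hs, ht]

theorem pairHom_rTensor (a : X →ₐ[k] B) (b : Y →ₐ[k] B) [CommHom a b] (g : W →ₐ[k] X)
    (t : W ⊗[k] Y) :
    pairHom a b (g.toLinearMap.rTensor Y t) = pairHom (a.comp g) b t := by
  induction t with
  | zero => simp
  | tmul x y => simp
  | add s t hs ht => simp only [map_add, hs, ht]

theorem pairHom_assoc (a : X →ₐ[k] B) (b : Y →ₐ[k] B) (c : Z →ₐ[k] B) [CommHom a b]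
    [CommHom a c] [CommHom b c] (t : (X ⊗[k] Y) ⊗[k] Z) :
    pairHom a (pairHom b c) (TensorProduct.assoc k X Y Z t) = pairHom (pairHom a b) c t := by
  induction t with
  | zero => simp
  | tmul s z =>
    induction s with
    | zero => simp
    | tmul x y => simp [mul_assoc]
    | add s t hs ht => simp only [map_add, TensorProduct.add_tmul, hs, ht]
  | add s t hs ht => simp only [map_add, hs, ht]

/-- `z (a x * E) = z (a' x * E)` for all `E`. -/
def LEq (z : B →ₗ[k] N) (a a' : X →ₐ[k] B) : Prop := ∀ x E, z (a x * E) = z (a' x * E)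

/-- `z (E * a x) = z (E * a' x)` for all `E`. -/
def REq (z : B →ₗ[k] N) (a a' : X →ₐ[k] B) : Prop := ∀ x E, z (E * a x) = z (E * a' x)

theorem LEq.trans {z : B →ₗ[k] N} {a a' a'' : X →ₐ[k] B} (h : LEq z a a') (h' : LEq z a' a'') :
    LEq z a a'' := fun x E => (h x E).trans (h' x E)
theorem REq.trans {z : B →ₗ[k] N} {a a' a'' : X →ₐ[k] B} (h : REq z a a') (h' : REq z a' a'') :
    REq z a a'' := fun x E => (h x E).trans (h' x E)

theorem LEq.comp {z : B →ₗ[k] N} {a a' : X →ₐ[k] B} (h : LEq z a a') (g : W →ₐ[k] X) :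
    LEq z (a.comp g) (a'.comp g) := fun x E => h (g x) E
theorem REq.comp {z : B →ₗ[k] N} {a a' : X →ₐ[k] B} (h : REq z a a') (g : W →ₐ[k] X) :
    REq z (a.comp g) (a'.comp g) := fun x E => h (g x) E

theorem LEq.pair_left {z : B →ₗ[k] N} {a a' : X →ₐ[k] B} (h : LEq z a a') (b : Y →ₐ[k] B)
    [CommHom a b] [CommHom a' b] : LEq z (pairHom a b) (pairHom a' b) := by
  intro t E
  induction t with
  | zero => simp
  | tmul x y => simp only [pairHom_tmul, mul_assoc, h x]
  | add s t hs ht => simp only [map_add, add_mul, hs, ht]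

theorem LEq.pair_right {z : B →ₗ[k] N} {b b' : Y →ₐ[k] B} (h : LEq z b b') (a : X →ₐ[k] B)
    [CommHom a b] [CommHom a b'] : LEq z (pairHom a b) (pairHom a b') := by
  intro t E
  induction t with
  | zero => simp
  | tmul x y =>
    simp only [pairHom_tmul, (CommHom.comm x y : Commute (a x) (b y)).eq,
      (CommHom.comm x y : Commute (a x) (b' y)).eq, mul_assoc, h y]
  | add s t hs ht => simp only [map_add, add_mul, hs, ht]

theorem REq.pair_left {z : B →ₗ[k] N} {a a' : X →ₐ[k] B} (h : REq z a a') (b : Y →ₐ[k] B)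
    [CommHom a b] [CommHom a' b] : REq z (pairHom a b) (pairHom a' b) := by
  intro t E
  induction t with
  | zero => simp
  | tmul x y =>
    simp only [pairHom_tmul, (CommHom.comm x y : Commute (a x) (b y)).eq,
      (CommHom.comm x y : Commute (a' x) (b y)).eq, ← mul_assoc, h x]
  | add s t hs ht => simp only [map_add, mul_add, hs, ht]

theorem REq.pair_right {z : B →ₗ[k] N} {b b' : Y →ₐ[k] B} (h : REq z b b') (a : X →ₐ[k] B)
    [CommHom a b] [CommHom a b'] : REq z (pairHom a b) (pairHom a b') := by
  intro t E
  induction t with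
  | zero => simp
  | tmul x y => simp only [pairHom_tmul, ← mul_assoc, h y]
  | add s t hs ht => simp only [map_add, mul_add, hs, ht]

/-- `LEq` persists after multiplying on the left by an element commuting with both sides. -/
theorem LEq.mulLeft {z : B →ₗ[k] N} {a a' : X →ₐ[k] B} (h : LEq z a a') (u : B)
    (hu : ∀ x, Commute (a x) u) (hu' : ∀ x, Commute (a' x) u) :
    LEq (z ∘ₗ LinearMap.mulLeft k u) a a' := by
  intro x E
  simp only [LinearMap.comp_apply, LinearMap.mulLeft_apply, ← mul_assoc, ← (hu x).eq,
    ← (hu' x).eq]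
  simp only [mul_assoc, h x]

theorem REq.mulRight {z : B →ₗ[k] N} {a a' : X →ₐ[k] B} (h : REq z a a') (u : B)
    (hu : ∀ x, Commute (a x) u) (hu' : ∀ x, Commute (a' x) u) :
    REq (z ∘ₗ LinearMap.mulRight k u) a a' := by
  intro x E
  simp only [LinearMap.comp_apply, LinearMap.mulRight_apply, mul_assoc, (hu x).eq,
    (hu' x).eq]
  simp only [← mul_assoc, h x]

/-- `u * a x = a' x * u`. -/
def Intw (u : B) (a a' : X →ₐ[k] B) : Prop := ∀ x, u * a x = a' x * u

theorem Intw.comp {u : B} {a a' : X →ₐ[k] B} (h : Intw u a a') (g : W →ₐ[k] X) :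
    Intw u (a.comp g) (a'.comp g) := fun x => h (g x)

theorem Intw.pair {u : B} {a a' : X →ₐ[k] B} {b b' : Y →ₐ[k] B} (h : Intw u a a')
    (h' : Intw u b b') [CommHom a b] [CommHom a' b'] :
    Intw u (pairHom a b) (pairHom a' b') := by
  intro t
  induction t with
  | zero => simp
  | tmul x y => rw [pairHom_tmul, pairHom_tmul, ← mul_assoc, h x, mul_assoc, h' y, mul_assoc]
  | add s t hs ht => simp only [map_add, add_mul, mul_add, hs, ht]

theorem Intw.of_comm (a : X →ₐ[k] B) (b : Y →ₐ[k] B) [CommHom a b] (x : X) :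
    Intw (a x) b b := fun y => CommHom.comm x y

theorem Intw.of_comm' (a : X →ₐ[k] B) (b : Y →ₐ[k] B) [CommHom a b] (y : Y) :
    Intw (b y) a a := fun x => ((CommHom.comm x y : Commute (a x) (b y)).eq).symm

end PairHom

/-! ### Convolution as tensor product: associator, pentagon, unit constraints -/

namespace QuasiBialgebra

variable {k : Type*} {H B N : Type*} [Field k] [Ring H] [Algebra k H]
  [Semiring B] [Algebra k B] [AddCommMonoid N] [Module k N] (Q : QuasiBialgebra k H)

/-- The trivial homomorphism `h ↦ ε(h) 1`. -/
def eps (B : Type*) [Semiring B] [Algebra k B] : H →ₐ[k] B := (Algebra.ofId k B).comp Q.ε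

theorem eps_apply (h : H) : Q.eps B h = algebraMap k B (Q.ε h) := rfl

instance (b : H →ₐ[k] B) : CommHom (Q.eps B) b := ⟨fun x y => Algebra.commutes (Q.ε x) (b y)⟩
instance (b : H →ₐ[k] B) : CommHom b (Q.eps B) :=
  ⟨fun x y => (Algebra.commutes (Q.ε y) (b x)).symm⟩

/-- The convolution `h ↦ ∑ a(h₁) b(h₂)`. -/
def cp (a b : H →ₐ[k] B) [CommHom a b] : H →ₐ[k] B := (pairHom a b).comp Q.Δ

theorem cp_apply (a b : H →ₐ[k] B) [CommHom a b] (h : H) : Q.cp a b h = pairHom a b (Q.Δ h) := rfl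

instance (a b c : H →ₐ[k] B) [CommHom a b] [CommHom a c] [CommHom b c] :
    CommHom (Q.cp a b) c := inferInstanceAs (CommHom ((pairHom a b).comp Q.Δ) c)

instance (a b c : H →ₐ[k] B) [CommHom a b] [CommHom a c] [CommHom b c] :
    CommHom a (Q.cp b c) := inferInstanceAs (CommHom a ((pairHom b c).comp Q.Δ))

/-- `∑ a(X¹) b(X²) c(X³)` as a unit. -/
def ass (a b c : H →ₐ[k] B) [CommHom a b] [CommHom a c] [CommHom b c] : Bˣ :=
  Units.map (pairHom a (pairHom b c) : H ⊗[k] (H ⊗[k] H) →* B) Q.Φ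

theorem coe_ass (a b c : H →ₐ[k] B) [CommHom a b] [CommHom a c] [CommHom b c] :
    (Q.ass a b c : B) = pairHom a (pairHom b c) (Q.Φ : H ⊗[k] (H ⊗[k] H)) := rfl

/-- Quasi-coassociativity pushed forward along the triple pairing: this is what makes `ass` an
associator for `cp`. -/
theorem ass_intw (a b c : H →ₐ[k] B) [CommHom a b] [CommHom a c] [CommHom b c] :
    Intw (Q.ass a b c : B) (Q.cp (Q.cp a b) c) (Q.cp a (Q.cp b c)) := by
  intro h
  have h1 : Q.cp a (Q.cp b c) h =
      pairHom a (pairHom b c) (Q.Δ.toLinearMap.lTensor H (Q.Δ h)) := by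
    rw [pairHom_lTensor]; rfl
  have h2 : Q.cp (Q.cp a b) c h = pairHom a (pairHom b c)
      (TensorProduct.assoc k H H H (Q.Δ.toLinearMap.rTensor H (Q.Δ h))) := by
    rw [pairHom_assoc, pairHom_rTensor]; rfl
  rw [h1, h2, coe_ass, ← map_mul, ← map_mul, Q.quasi_coassoc, mul_assoc, mul_assoc,
    Units.inv_mul, mul_one]

theorem pentagon (a b c d : H →ₐ[k] B) [CommHom a b] [CommHom a c] [CommHom b c] [CommHom a d]
    [CommHom b d] [CommHom c d] :
    Q.ass b c d * Q.ass a (Q.cp b c) d * Q.ass a b c =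
      Q.ass a b (Q.cp c d) * Q.ass (Q.cp a b) c d := by
  apply Units.ext
  have key := congrArg (pairHom a (pairHom b (pairHom c d))) Q.cocycle
  rw [map_mul, map_mul, map_mul, pairHom_tmul, map_one, one_mul, pairHom_assoc,
    pairHom_rTensor] at key
  have h1 : ∀ t : H ⊗[k] (H ⊗[k] H), pairHom a (pairHom b (pairHom c d))
      (((TensorProduct.assoc k H H H).toLinearMap ∘ₗ Q.Δ.toLinearMap.rTensor H).lTensor H t) =
      pairHom a (pairHom (Q.cp b c) d) t := by
    intro t
    induction t with
    | zero => simp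
    | tmul x y =>
      rw [LinearMap.lTensor_tmul, pairHom_tmul, pairHom_tmul, LinearMap.comp_apply,
        LinearEquiv.coe_coe, pairHom_assoc, pairHom_rTensor]
      rfl
    | add s t hs ht => simp only [map_add, hs, ht]
  have h2 : ∀ t : H ⊗[k] (H ⊗[k] H), pairHom a (pairHom b (pairHom c d))
      ((((TensorProduct.mk k H H).flip 1).lTensor H).lTensor H t) =
      pairHom a (pairHom b c) t := by
    intro t
    induction t with
    | zero => simp
    | tmul x y =>
      rw [LinearMap.lTensor_tmul, pairHom_tmul, pairHom_tmul]
      congr 1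
      induction y with
      | zero => simp
      | tmul y z => simp
      | add s t hs ht => simp only [map_add, hs, ht]
    | add s t hs ht => simp only [map_add, hs, ht]
  have h3 : ∀ t : H ⊗[k] (H ⊗[k] H), pairHom a (pairHom b (pairHom c d))
      ((Q.Δ.toLinearMap.lTensor H).lTensor H t) = pairHom a (pairHom b (Q.cp c d)) t := by
    intro t
    induction t with
    | zero => simp
    | tmul x y =>
      rw [LinearMap.lTensor_tmul, pairHom_tmul, pairHom_tmul, pairHom_lTensor]
      rfl
    | add s t hs ht => simp only [map_add, hs, ht]
  rw [h1, h2, h3] at key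
  exact key

@[simp] theorem cp_eps_right (a : H →ₐ[k] B) : Q.cp a (Q.eps B) = a := by
  ext h
  have : CommHom a (Algebra.ofId k B : k →ₐ[k] B) := ⟨fun x y =>
    (Algebra.commutes y (a x)).symm⟩
  have key := congrArg (pairHom a (Algebra.ofId k B : k →ₐ[k] B)) (Q.counit_right h)
  rw [pairHom_lTensor, pairHom_tmul, map_one, mul_one] at key
  exact key

@[simp] theorem cp_eps_left (a : H →ₐ[k] B) : Q.cp (Q.eps B) a = a := by
  ext h
  have : CommHom (Algebra.ofId k B : k →ₐ[k] B) a := ⟨fun x y => Algebra.commutes x (a y)⟩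
  have key := congrArg (pairHom (Algebra.ofId k B : k →ₐ[k] B) a) (Q.counit_left h)
  rw [pairHom_rTensor, pairHom_tmul, map_one, one_mul] at key
  exact key

@[simp] theorem ass_eps₂ (a c : H →ₐ[k] B) [CommHom a c] : Q.ass a (Q.eps B) c = 1 := by
  apply Units.ext
  have : CommHom (Algebra.ofId k B : k →ₐ[k] B) c := ⟨fun x y => Algebra.commutes x (c y)⟩
  have : CommHom a (Algebra.ofId k B : k →ₐ[k] B) := ⟨fun x y =>
    (Algebra.commutes y (a x)).symm⟩
  have key := congrArg (pairHom a (pairHom (Algebra.ofId k B : k →ₐ[k] B) c)) Q.counit_middle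
  simp only [pairHom_tmul, map_one, one_mul] at key
  rw [Units.val_one, ← key, coe_ass]
  generalize (Q.Φ : H ⊗[k] (H ⊗[k] H)) = t
  induction t with
  | zero => simp
  | tmul x y => rw [LinearMap.lTensor_tmul, pairHom_tmul, pairHom_tmul, pairHom_rTensor]; rfl
  | add s t hs ht => simp only [map_add, hs, ht]

-- In the pentagon with two leading unit objects everything but this associator is trivial, and the
-- associator squares to itself; being invertible, it is `1`. The last slot is treated in the same
-- way.
@[simp] theorem ass_eps₁ (b c : H →ₐ[k] B) [CommHom b c] : Q.ass (Q.eps B) b c = 1 := by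
  have := Q.pentagon (Q.eps B) (Q.eps B) b c
  simpa using this

@[simp] theorem ass_eps₃ (a b : H →ₐ[k] B) [CommHom a b] : Q.ass a b (Q.eps B) = 1 := by
  have := Q.pentagon a b (Q.eps B) (Q.eps B)
  simpa using this

theorem _root_.LEq.cp_left {z : B →ₗ[k] N} {a a' : H →ₐ[k] B} (h : LEq z a a')
    (b : H →ₐ[k] B) [CommHom a b] [CommHom a' b] : LEq z (Q.cp a b) (Q.cp a' b) :=
  (h.pair_left b).comp Q.Δ

theorem _root_.LEq.cp_right {z : B →ₗ[k] N} {b b' : H →ₐ[k] B} (h : LEq z b b')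
    (a : H →ₐ[k] B) [CommHom a b] [CommHom a b'] : LEq z (Q.cp a b) (Q.cp a b') :=
  (h.pair_right a).comp Q.Δ

theorem _root_.LEq.cp_eps_left {z : B →ₗ[k] N} {a : H →ₐ[k] B} (h : LEq z a (Q.eps B))
    (b : H →ₐ[k] B) [CommHom a b] : LEq z (Q.cp a b) b := by
  simpa using h.cp_left Q b

theorem _root_.LEq.cp_eps_right {z : B →ₗ[k] N} {b : H →ₐ[k] B} (h : LEq z b (Q.eps B))
    (a : H →ₐ[k] B) [CommHom a b] : LEq z (Q.cp a b) a := by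
  simpa using h.cp_right Q a

theorem _root_.LEq.ass₁ {z : B →ₗ[k] N} {a b c a' : H →ₐ[k] B} (h : LEq z a a')
    [CommHom a b] [CommHom a c] [CommHom b c] [CommHom a' b] [CommHom a' c] (E : B) :
    z ((Q.ass a b c : B) * E) = z ((Q.ass a' b c : B) * E) :=
  (h.pair_left _) _ E

/-- The lemmas of this family erase an associator standing at an end of the word, as soon as `z`
cannot distinguish one of its arguments from the unit object. -/
theorem _root_.LEq.ass_eps₁ {z : B →ₗ[k] N} {a b c : H →ₐ[k] B} (h : LEq z a (Q.eps B))
    [CommHom a b] [CommHom a c] [CommHom b c] (E : B) : z ((Q.ass a b c : B) * E) = z E := by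
  rw [h.ass₁ Q, QuasiBialgebra.ass_eps₁]; simp

theorem _root_.LEq.ass_inv₁ {z : B →ₗ[k] N} {a b c a' : H →ₐ[k] B} (h : LEq z a a')
    [CommHom a b] [CommHom a c] [CommHom b c] [CommHom a' b] [CommHom a' c] (E : B) :
    z ((((Q.ass a b c)⁻¹ : Bˣ) : B) * E) = z ((((Q.ass a' b c)⁻¹ : Bˣ) : B) * E) :=
  (h.pair_left _) _ E

theorem _root_.LEq.ass₂ {z : B →ₗ[k] N} {a b c b' : H →ₐ[k] B} (h : LEq z b b')
    [CommHom a b] [CommHom a c] [CommHom b c] [CommHom a b'] [CommHom b' c] (E : B) :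
    z ((Q.ass a b c : B) * E) = z ((Q.ass a b' c : B) * E) :=
  ((h.pair_left c).pair_right a) _ E

theorem _root_.LEq.ass_eps₂ {z : B →ₗ[k] N} {a b c : H →ₐ[k] B} (h : LEq z b (Q.eps B))
    [CommHom a b] [CommHom a c] [CommHom b c] (E : B) : z ((Q.ass a b c : B) * E) = z E := by
  rw [h.ass₂ Q, QuasiBialgebra.ass_eps₂]; simp

theorem _root_.LEq.ass_inv₂ {z : B →ₗ[k] N} {a b c b' : H →ₐ[k] B} (h : LEq z b b')
    [CommHom a b] [CommHom a c] [CommHom b c] [CommHom a b'] [CommHom b' c] (E : B) :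
    z ((((Q.ass a b c)⁻¹ : Bˣ) : B) * E) = z ((((Q.ass a b' c)⁻¹ : Bˣ) : B) * E) :=
  ((h.pair_left c).pair_right a) _ E

theorem _root_.LEq.ass_inv_eps₂ {z : B →ₗ[k] N} {a b c : H →ₐ[k] B} (h : LEq z b (Q.eps B))
    [CommHom a b] [CommHom a c] [CommHom b c] (E : B) : z ((((Q.ass a b c)⁻¹ : Bˣ) : B) * E) = z E := by
  rw [h.ass_inv₂ Q, QuasiBialgebra.ass_eps₂]; simp

theorem _root_.LEq.ass₃ {z : B →ₗ[k] N} {a b c c' : H →ₐ[k] B} (h : LEq z c c')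
    [CommHom a b] [CommHom a c] [CommHom b c] [CommHom a c'] [CommHom b c'] (E : B) :
    z ((Q.ass a b c : B) * E) = z ((Q.ass a b c' : B) * E) :=
  ((h.pair_right b).pair_right a) _ E

theorem _root_.LEq.ass_eps₃ {z : B →ₗ[k] N} {a b c : H →ₐ[k] B} (h : LEq z c (Q.eps B))
    [CommHom a b] [CommHom a c] [CommHom b c] (E : B) : z ((Q.ass a b c : B) * E) = z E := by
  rw [h.ass₃ Q, QuasiBialgebra.ass_eps₃]; simp

theorem _root_.LEq.ass_inv₃ {z : B →ₗ[k] N} {a b c c' : H →ₐ[k] B} (h : LEq z c c')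
    [CommHom a b] [CommHom a c] [CommHom b c] [CommHom a c'] [CommHom b c'] (E : B) :
    z ((((Q.ass a b c)⁻¹ : Bˣ) : B) * E) = z ((((Q.ass a b c')⁻¹ : Bˣ) : B) * E) :=
  ((h.pair_right b).pair_right a) _ E

theorem _root_.LEq.ass_inv_eps₃ {z : B →ₗ[k] N} {a b c : H →ₐ[k] B} (h : LEq z c (Q.eps B))
    [CommHom a b] [CommHom a c] [CommHom b c] (E : B) : z ((((Q.ass a b c)⁻¹ : Bˣ) : B) * E) = z E := by
  rw [h.ass_inv₃ Q, QuasiBialgebra.ass_eps₃]; simp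

theorem _root_.REq.cp_left {z : B →ₗ[k] N} {a a' : H →ₐ[k] B} (h : REq z a a')
    (b : H →ₐ[k] B) [CommHom a b] [CommHom a' b] : REq z (Q.cp a b) (Q.cp a' b) :=
  (h.pair_left b).comp Q.Δ

theorem _root_.REq.cp_right {z : B →ₗ[k] N} {b b' : H →ₐ[k] B} (h : REq z b b')
    (a : H →ₐ[k] B) [CommHom a b] [CommHom a b'] : REq z (Q.cp a b) (Q.cp a b') :=
  (h.pair_right a).comp Q.Δ

theorem _root_.REq.cp_eps_left {z : B →ₗ[k] N} {a : H →ₐ[k] B} (h : REq z a (Q.eps B))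
    (b : H →ₐ[k] B) [CommHom a b] : REq z (Q.cp a b) b := by
  simpa using h.cp_left Q b

theorem _root_.REq.cp_eps_right {z : B →ₗ[k] N} {b : H →ₐ[k] B} (h : REq z b (Q.eps B))
    (a : H →ₐ[k] B) [CommHom a b] : REq z (Q.cp a b) a := by
  simpa using h.cp_right Q a

theorem _root_.REq.ass_inv₁ {z : B →ₗ[k] N} {a b c a' : H →ₐ[k] B} (h : REq z a a')
    [CommHom a b] [CommHom a c] [CommHom b c] [CommHom a' b] [CommHom a' c] (E : B) :
    z (E * (((Q.ass a b c)⁻¹ : Bˣ) : B)) = z (E * (((Q.ass a' b c)⁻¹ : Bˣ) : B)) :=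
  (h.pair_left _) _ E

theorem _root_.REq.ass_inv_eps₁ {z : B →ₗ[k] N} {a b c : H →ₐ[k] B} (h : REq z a (Q.eps B))
    [CommHom a b] [CommHom a c] [CommHom b c] (E : B) : z (E * (((Q.ass a b c)⁻¹ : Bˣ) : B)) = z E := by
  rw [h.ass_inv₁ Q, QuasiBialgebra.ass_eps₁]; simp

theorem _root_.REq.ass₂ {z : B →ₗ[k] N} {a b c b' : H →ₐ[k] B} (h : REq z b b')
    [CommHom a b] [CommHom a c] [CommHom b c] [CommHom a b'] [CommHom b' c] (E : B) :
    z (E * (Q.ass a b c : B)) = z (E * (Q.ass a b' c : B)) :=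
  ((h.pair_left c).pair_right a) _ E

theorem _root_.REq.ass_eps₂ {z : B →ₗ[k] N} {a b c : H →ₐ[k] B} (h : REq z b (Q.eps B))
    [CommHom a b] [CommHom a c] [CommHom b c] (E : B) : z (E * (Q.ass a b c : B)) = z E := by
  rw [h.ass₂ Q, QuasiBialgebra.ass_eps₂]; simp

theorem _root_.REq.ass_inv₂ {z : B →ₗ[k] N} {a b c b' : H →ₐ[k] B} (h : REq z b b')
    [CommHom a b] [CommHom a c] [CommHom b c] [CommHom a b'] [CommHom b' c] (E : B) :
    z (E * (((Q.ass a b c)⁻¹ : Bˣ) : B)) = z (E * (((Q.ass a b' c)⁻¹ : Bˣ) : B)) :=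
  ((h.pair_left c).pair_right a) _ E

theorem _root_.REq.ass₃ {z : B →ₗ[k] N} {a b c c' : H →ₐ[k] B} (h : REq z c c')
    [CommHom a b] [CommHom a c] [CommHom b c] [CommHom a c'] [CommHom b c'] (E : B) :
    z (E * (Q.ass a b c : B)) = z (E * (Q.ass a b c' : B)) :=
  ((h.pair_right b).pair_right a) _ E

theorem _root_.REq.ass_eps₃ {z : B →ₗ[k] N} {a b c : H →ₐ[k] B} (h : REq z c (Q.eps B))
    [CommHom a b] [CommHom a c] [CommHom b c] (E : B) : z (E * (Q.ass a b c : B)) = z E := by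
  rw [h.ass₃ Q, QuasiBialgebra.ass_eps₃]; simp

theorem _root_.REq.ass_inv₃ {z : B →ₗ[k] N} {a b c c' : H →ₐ[k] B} (h : REq z c c')
    [CommHom a b] [CommHom a c] [CommHom b c] [CommHom a c'] [CommHom b c'] (E : B) :
    z (E * (((Q.ass a b c)⁻¹ : Bˣ) : B)) = z (E * (((Q.ass a b c')⁻¹ : Bˣ) : B)) :=
  ((h.pair_right b).pair_right a) _ E

theorem _root_.REq.ass_inv_eps₃ {z : B →ₗ[k] N} {a b c : H →ₐ[k] B} (h : REq z c (Q.eps B))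
    [CommHom a b] [CommHom a c] [CommHom b c] (E : B) : z (E * (((Q.ass a b c)⁻¹ : Bˣ) : B)) = z E := by
  rw [h.ass_inv₃ Q, QuasiBialgebra.ass_eps₃]; simp

end QuasiBialgebra
end

/-! ### Coherence identities with contracted pairs of strands -/

noncomputable section
namespace QuasiBialgebra

variable {k : Type*} {H B N : Type*} [Field k] [Ring H] [Algebra k H]
  [Semiring B] [Algebra k B] [AddCommMonoid N] [Module k N] (Q : QuasiBialgebra k H)

theorem _root_.Intw.cp {u : B} {a a' b b' : H →ₐ[k] B} (h : Intw u a a') (h' : Intw u b b')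
    [CommHom a b] [CommHom a' b'] : Intw u (Q.cp a b) (Q.cp a' b') := (h.pair h').comp Q.Δ

theorem _root_.Intw.ass {u : Bˣ} {a a' b b' c c' : H →ₐ[k] B} (h₁ : Intw (u : B) a a')
    (h₂ : Intw (u : B) b b') (h₃ : Intw (u : B) c c') [CommHom a b] [CommHom a c] [CommHom b c]
    [CommHom a' b'] [CommHom a' c'] [CommHom b' c'] :
    u * Q.ass a b c = Q.ass a' b' c' * u :=
  Units.ext ((h₁.pair (h₂.pair h₃)) _)

variable (a b c d e : H →ₐ[k] B)

theorem ass_comm_right [CommHom a b] [CommHom a c] [CommHom b c] [CommHom a d] [CommHom b d]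
    [CommHom c d] : Intw (Q.ass a b c : B) d d :=
  Intw.of_comm (pairHom a (pairHom b c)) d _

theorem ass_comm_left [CommHom a b] [CommHom a c] [CommHom b c] [CommHom d a] [CommHom d b]
    [CommHom d c] : Intw (Q.ass a b c : B) d d :=
  Intw.of_comm' d (pairHom a (pairHom b c)) _

theorem commute_ass [CommHom a b] [CommHom a c] [CommHom b c] [CommHom d a] [CommHom d b]
    [CommHom d c] (x : H) : Commute (d x) (Q.ass a b c : B) :=
  CommHom.comm (a := d) (b := pairHom a (pairHom b c)) x _

theorem commute_ass_inv [CommHom a b] [CommHom a c] [CommHom b c] [CommHom d a] [CommHom d b]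
    [CommHom d c] (x : H) : Commute (d x) (((Q.ass a b c)⁻¹ : Bˣ) : B) :=
  CommHom.comm (a := d) (b := pairHom a (pairHom b c)) x _

theorem ass_nat₁ [CommHom a b] [CommHom a c] [CommHom b c] [CommHom a d] [CommHom b d]
    [CommHom c d] [CommHom a e] [CommHom b e] [CommHom c e] [CommHom d e] :
    Q.ass a b c * Q.ass (Q.cp (Q.cp a b) c) d e =
      Q.ass (Q.cp a (Q.cp b c)) d e * Q.ass a b c :=
  (Q.ass_intw a b c).ass Q (Q.ass_comm_right a b c d) (Q.ass_comm_right a b c e)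

theorem ass_nat₂ [CommHom a b] [CommHom a c] [CommHom b c] [CommHom a d] [CommHom b d]
    [CommHom c d] [CommHom a e] [CommHom b e] [CommHom c e] [CommHom d e] :
    Q.ass b c d * Q.ass a (Q.cp (Q.cp b c) d) e =
      Q.ass a (Q.cp b (Q.cp c d)) e * Q.ass b c d :=
  Intw.ass Q (Q.ass_comm_left b c d a) (Q.ass_intw b c d) (Q.ass_comm_right b c d e)

/-- Two pentagons, for `a, b, c, d` and for `a, bc, d, e`, glued along naturality of the associator
in its middle and first arguments. -/
theorem ass_five [CommHom a b] [CommHom a c] [CommHom b c] [CommHom a d] [CommHom b d]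
    [CommHom c d] [CommHom a e] [CommHom b e] [CommHom c e] [CommHom d e] :
    Q.ass a (Q.cp b (Q.cp c d)) e * Q.ass a b (Q.cp c d) * Q.ass (Q.cp a b) c d *
        (Q.ass (Q.cp (Q.cp a b) c) d e)⁻¹ =
      Q.ass b c d * (Q.ass (Q.cp b c) d e)⁻¹ * Q.ass a (Q.cp b c) (Q.cp d e) * Q.ass a b c := by
  have p1 := Q.pentagon a b c d
  have p2 := Q.pentagon a (Q.cp b c) d e
  have n1 := Q.ass_nat₂ a b c d e
  have n2 := Q.ass_nat₁ a b c d e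
  rw [mul_inv_eq_iff_eq_mul, mul_assoc (Q.ass a (Q.cp b (Q.cp c d)) e), ← p1, ← mul_assoc,
    ← mul_assoc, ← n1, mul_assoc _ (Q.ass a b c), n2, ← mul_assoc]
  congr 1
  rw [mul_assoc _ (Q.ass a (Q.cp b c) (Q.cp d e)), ← p2]
  group

section Invariant

variable {a b c d e} {z : B →ₗ[k] N}

/-- On the right `a` may be fattened to `a(bc)`; the associator moves it to `(ab)c` on the left,
where `ab` disappears. An element thus slides along the bent strand from `a` to `c`. -/
theorem apply_ass_inv_mul [CommHom a b] [CommHom a c] [CommHom b c]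
    (hl : LEq z (Q.cp a b) (Q.eps B)) (hr : REq z (Q.cp b c) (Q.eps B)) (h : H) :
    z (((Q.ass a b c)⁻¹ : Bˣ) * a h) = z (c h * ((Q.ass a b c)⁻¹ : Bˣ)) := by
  rw [← hr.cp_eps_right Q a, ← hl.cp_eps_left Q c]
  congr 1
  rw [Units.inv_mul_eq_iff_eq_mul, ← mul_assoc, Units.eq_mul_inv_iff_mul_eq]
  exact ((Q.ass_intw a b c) h).symm

theorem apply_mul_ass [CommHom a b] [CommHom a c] [CommHom b c]
    (hl : LEq z (Q.cp b c) (Q.eps B)) (hr : REq z (Q.cp a b) (Q.eps B)) (h : H) :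
    z (a h * Q.ass a b c) = z (Q.ass a b c * c h) := by
  rw [← hl.cp_eps_right Q a, ← hr.cp_eps_left Q c]
  exact congrArg z ((Q.ass_intw a b c) h).symm

/-- A bent strand may be read off at either end: in the pentagon for `a, b, c, d` the three
associators that involve a contracted pair disappear. -/
theorem apply_ass_inv_eq [CommHom a b] [CommHom a c] [CommHom b c] [CommHom a d] [CommHom b d]
    [CommHom c d] (hl : LEq z (Q.cp a b) (Q.eps B)) (hl' : LEq z (Q.cp c d) (Q.eps B))
    (hr : REq z (Q.cp b c) (Q.eps B)) :
    z (((Q.ass a b c)⁻¹ : Bˣ) : B) = z (Q.ass b c d) := by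
  have key : (Q.ass a b (Q.cp c d))⁻¹ * (Q.ass b c d * Q.ass a (Q.cp b c) d) =
      Q.ass (Q.cp a b) c d * (Q.ass a b c)⁻¹ := by
    rw [inv_mul_eq_iff_eq_mul, ← mul_assoc, eq_mul_inv_iff_mul_eq, Q.pentagon]
  rw [← hl.ass_eps₁ Q (b := c) (c := d), ← Units.val_mul, ← key, Units.val_mul,
    hl'.ass_inv_eps₃ Q, Units.val_mul, hr.ass_eps₂ Q]

theorem apply_ass_eq [CommHom a b] [CommHom a c] [CommHom b c] [CommHom a d] [CommHom b d]
    [CommHom c d] (hr : REq z (Q.cp a b) (Q.eps B)) (hr' : REq z (Q.cp c d) (Q.eps B))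
    (hl : LEq z (Q.cp b c) (Q.eps B)) :
    z (Q.ass a b c) = z (((Q.ass b c d)⁻¹ : Bˣ) : B) := by
  have key : Q.ass a (Q.cp b c) d * Q.ass a b c * (Q.ass (Q.cp a b) c d)⁻¹ =
      (Q.ass b c d)⁻¹ * Q.ass a b (Q.cp c d) := by
    rw [eq_inv_mul_iff_mul_eq, ← mul_assoc, ← mul_assoc, mul_inv_eq_iff_eq_mul, Q.pentagon]
  rw [← hr'.ass_eps₃ Q (a := a) (b := b) (E := ((Q.ass b c d)⁻¹ : Bˣ)), ← Units.val_mul, ← key,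
    Units.val_mul, hr.ass_inv_eps₁ Q, Units.val_mul, hl.ass_eps₂ Q]

/-- Straightening of a five-fold zigzag. -/
theorem apply_five_zigzag [CommHom a b] [CommHom a c] [CommHom b c] [CommHom a d] [CommHom b d]
    [CommHom c d] [CommHom a e] [CommHom b e] [CommHom c e] [CommHom d e]
    (hl : LEq z (Q.cp a b) (Q.eps B)) (hl' : LEq z (Q.cp c d) (Q.eps B))
    (hr : REq z (Q.cp b c) (Q.eps B)) :
    z (((Q.ass a b e)⁻¹ * Q.ass b c d : Bˣ) : B) =
      z (((Q.ass c d e)⁻¹ * (Q.ass a b c)⁻¹ : Bˣ) : B) := by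
  have n2 := Q.ass_nat₂ a b c d e
  have n1 := Q.ass_nat₁ a b c d e
  calc z (((Q.ass a b e)⁻¹ * Q.ass b c d : Bˣ) : B)
      = z (((Q.ass a (Q.cp b (Q.cp c d)) e)⁻¹ * Q.ass b c d : Bˣ) : B) := by
        rw [Units.val_mul, Units.val_mul, (hl'.cp_eps_right Q b).ass_inv₂ Q]
    _ = z ((Q.ass b c d * (Q.ass a (Q.cp (Q.cp b c) d) e)⁻¹ : Bˣ) : B) := by
        congr 2
        rw [inv_mul_eq_iff_eq_mul, ← mul_assoc, eq_mul_inv_iff_mul_eq, n2]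
    _ = z ((Q.ass b c d * (Q.ass a d e)⁻¹ : Bˣ) : B) := by
        rw [Units.val_mul, Units.val_mul, (hr.cp_eps_left Q d).ass_inv₂ Q]
    -- Associators invisible to `z` are inserted so that a pentagon becomes available. The pair `b,
    -- c` is not at the right end, but it commutes with the factor `(ass a d e)⁻¹` that separates it
    -- from there.
    _ = z ((Q.ass b c d * Q.ass a (Q.cp b c) d * (Q.ass (Q.cp a (Q.cp b c)) d e)⁻¹ : Bˣ) : B) := by
        have := CommHom.symm a (Q.cp b c)
        rw [Units.val_mul _ (Q.ass (Q.cp a (Q.cp b c)) d e)⁻¹, (hr.cp_eps_right Q a).ass_inv₁ Q,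
          Units.val_mul, Units.val_mul]
        exact ((hr.mulRight ((Q.ass a d e)⁻¹ : Bˣ)
          (Q.commute_ass_inv a d e _) (Q.commute_ass_inv a d e _)).ass_eps₂ Q _).symm
    _ = z (((Q.ass c d e)⁻¹ * (Q.ass a b c)⁻¹ : Bˣ) : B) := by
        have : (Q.ass a b (Q.cp c d))⁻¹ * (Q.ass b c d * Q.ass a (Q.cp b c) d *
            (Q.ass (Q.cp a (Q.cp b c)) d e)⁻¹) = Q.ass (Q.cp a b) c d *
            ((Q.ass (Q.cp (Q.cp a b) c) d e)⁻¹ * (Q.ass a b c)⁻¹) := by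
          rw [← mul_inv_rev, n1, inv_mul_eq_iff_eq_mul, ← mul_assoc, ← Q.pentagon]
          group
        rw [← hl'.ass_inv_eps₃ Q (a := a) (b := b), ← Units.val_mul, this, Units.val_mul,
          hl.ass_eps₁ Q, Units.val_mul, (hl.cp_eps_left Q c).ass_inv₁ Q, Units.val_mul]

theorem apply_eps_mul (z : B →ₗ[k] N) (h : H) (E : B) : z (Q.eps B h * E) = Q.ε h • z E := by
  rw [eps_apply, ← Algebra.smul_def, map_smul]

theorem apply_mul_eps (z : B →ₗ[k] N) (h : H) (E : B) : z (E * Q.eps B h) = Q.ε h • z E := by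
  rw [eps_apply, ← Algebra.commutes, ← Algebra.smul_def, map_smul]

theorem _root_.LEq.mulLeft_eps {z : B →ₗ[k] N} {a : H →ₐ[k] B} (h : LEq z a (Q.eps B)) (u : B)
    (hu : ∀ x, Commute (a x) u) : LEq (z ∘ₗ LinearMap.mulLeft k u) a (Q.eps B) :=
  h.mulLeft u hu fun x => Algebra.commutes (Q.ε x) u

theorem _root_.REq.mulRight_eps {z : B →ₗ[k] N} {a : H →ₐ[k] B} (h : REq z a (Q.eps B)) (u : B)
    (hu : ∀ x, Commute (a x) u) : REq (z ∘ₗ LinearMap.mulRight k u) a (Q.eps B) :=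
  h.mulRight u hu fun x => Algebra.commutes (Q.ε x) u

/-- `[a,b,c][ab,c,d]⁻¹`, which turns `(ab)(cd)` into `(a(bc))d`. -/
def nestA (a b c d : H →ₐ[k] B) [CommHom a b] [CommHom a c] [CommHom b c] [CommHom a d]
    [CommHom b d] [CommHom c d] : Bˣ := Q.ass a b c * (Q.ass (Q.cp a b) c d)⁻¹

section Four
variable [CommHom a b] [CommHom a c] [CommHom b c] [CommHom a d] [CommHom b d] [CommHom c d]

variable (a b c d) in
theorem nestA_intw : Intw (Q.nestA a b c d : B) (Q.cp (Q.cp a b) (Q.cp c d))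
    (Q.cp (Q.cp a (Q.cp b c)) d) := by
  intro h
  have h1 : (((Q.ass (Q.cp a b) c d)⁻¹ : Bˣ) : B) * Q.cp (Q.cp a b) (Q.cp c d) h =
      Q.cp (Q.cp (Q.cp a b) c) d h * ((Q.ass (Q.cp a b) c d)⁻¹ : Bˣ) := by
    rw [Units.inv_mul_eq_iff_eq_mul, ← mul_assoc, Units.eq_mul_inv_iff_mul_eq]
    exact (Q.ass_intw (Q.cp a b) c d h).symm
  have h2 : (Q.ass a b c : B) * Q.cp (Q.cp (Q.cp a b) c) d h =
      Q.cp (Q.cp a (Q.cp b c)) d h * (Q.ass a b c : B) :=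
    (Q.ass_intw a b c).cp Q (Q.ass_comm_right a b c d) h
  rw [nestA, Units.val_mul, mul_assoc, h1, ← mul_assoc, h2, mul_assoc]

variable (a b c d) in
-- The pentagon gives a second factorisation, in which the inner pair `bc` is a single argument and
-- can be erased.
theorem nestA_eq : Q.nestA a b c d =
    (Q.ass a (Q.cp b c) d)⁻¹ * (Q.ass b c d)⁻¹ * Q.ass a b (Q.cp c d) := by
  rw [nestA, mul_inv_eq_iff_eq_mul, mul_assoc _ (Q.ass a b (Q.cp c d)), ← Q.pentagon]
  group

theorem nestA_inv_eq : (Q.nestA a b c d)⁻¹ =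
    (Q.ass a b (Q.cp c d))⁻¹ * Q.ass b c d * Q.ass a (Q.cp b c) d := by
  rw [nestA_eq]; group

/-- After rebracketing to `(a(bc))d`, contracting the inner pair leaves `ad`, which is contracted in
turn. -/
theorem apply_nestA_mul (hl : LEq z (Q.cp b c) (Q.eps B)) (hl' : LEq z (Q.cp a d) (Q.eps B))
    (h : H) : z (Q.nestA a b c d * Q.cp (Q.cp a b) (Q.cp c d) h) =
      Q.ε h • z (Q.nestA a b c d) := by
  rw [Q.nestA_intw a b c d h, (((hl.cp_eps_right Q a).cp_left Q d).trans hl') h, apply_eps_mul]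

theorem apply_mul_nestA_inv (hr : REq z (Q.cp b c) (Q.eps B))
    (hr' : REq z (Q.cp a d) (Q.eps B)) (h : H) :
    z (Q.cp (Q.cp a b) (Q.cp c d) h * ((Q.nestA a b c d)⁻¹ : Bˣ)) =
      Q.ε h • z (((Q.nestA a b c d)⁻¹ : Bˣ) : B) := by
  have : Q.cp (Q.cp a b) (Q.cp c d) h * ((Q.nestA a b c d)⁻¹ : Bˣ) =
      ((Q.nestA a b c d)⁻¹ : Bˣ) * Q.cp (Q.cp a (Q.cp b c)) d h := by
    rw [Units.eq_inv_mul_iff_mul_eq, ← mul_assoc, Q.nestA_intw a b c d h, mul_assoc, Units.mul_inv, mul_one]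
  rw [this, (((hr.cp_eps_right Q a).cp_left Q d).trans hr') h, apply_mul_eps]

theorem apply_nestA_inv (hr : REq z (Q.cp b c) (Q.eps B)) :
    z (((Q.nestA a b c d)⁻¹ : Bˣ) : B) =
      z (((Q.ass a b (Q.cp c d))⁻¹ * Q.ass b c d : Bˣ) : B) := by
  rw [nestA_inv_eq, Units.val_mul, hr.ass_eps₂ Q]

theorem apply_nestA_inv_zigzag (hr : REq z (Q.cp b c) (Q.eps B))
    (hl : LEq z (Q.cp c d) (Q.eps B)) :
    z (((Q.nestA a b c d)⁻¹ : Bˣ) : B) = z (Q.ass b c d) := by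
  rw [Q.apply_nestA_inv hr, Units.val_mul, hl.ass_inv_eps₃ Q]

theorem apply_nestA_zigzag (hl : LEq z (Q.cp b c) (Q.eps B))
    (hr : REq z (Q.cp c d) (Q.eps B)) :
    z (Q.nestA a b c d : B) = z (((Q.ass b c d)⁻¹ : Bˣ) : B) := by
  rw [nestA_eq, Units.val_mul, hr.ass_eps₃ Q, Units.val_mul, hl.ass_inv_eps₂ Q]

end Four

section Five
variable [CommHom a b] [CommHom a c] [CommHom b c] [CommHom a d] [CommHom b d]
    [CommHom c d] [CommHom a e] [CommHom b e] [CommHom c e] [CommHom d e]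

/-- For coevaluations `c, d` nested inside `b, e`: inserting them one after the other or as a single
nested block differs only by rebracketing. -/
theorem apply_column_five (hr : REq z (Q.cp c d) (Q.eps B)) :
    z ((Q.ass a b c * Q.ass (Q.cp (Q.cp a b) c) d e * (Q.ass (Q.cp a b) c d)⁻¹ *
      (Q.ass a b e)⁻¹ : Bˣ) : B) =
    z (((Q.ass a (Q.cp b c) (Q.cp d e))⁻¹ * (Q.nestA b c d e)⁻¹ : Bˣ) : B) := by
  have K : Q.ass a b c * Q.ass (Q.cp (Q.cp a b) c) d e * (Q.ass (Q.cp a b) c d)⁻¹ *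
      (Q.ass a b (Q.cp c d))⁻¹ * (Q.ass a (Q.cp b (Q.cp c d)) e)⁻¹ =
      (Q.ass a (Q.cp b c) (Q.cp d e))⁻¹ * (Q.nestA b c d e)⁻¹ := by
    have := congrArg (fun u => Q.ass a b c * u⁻¹) (Q.ass_five a b c d e)
    simpa [nestA, mul_assoc] using this
  have h1 : CommHom (Q.cp c d) a := CommHom.symm a (Q.cp c d)
  have h2 : CommHom (Q.cp c d) b := CommHom.symm b (Q.cp c d)
  rw [← K, Units.val_mul _ (Q.ass a (Q.cp b (Q.cp c d)) e)⁻¹,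
    (hr.cp_eps_right Q b).ass_inv₂ Q, Units.val_mul _ (Q.ass a b (Q.cp c d))⁻¹, Units.val_mul]
  -- The pair `c, d` is separated from the right end by `(ass a b e)⁻¹`; it commutes with this
  -- factor, so its invariance still applies.
  exact ((hr.mulRight_eps Q _ (Q.commute_ass_inv a b e (Q.cp c d))).ass_inv_eps₃ Q _).symm

/-- The counterpart for evaluations: `c, d` is nested inside `b, e`, with a free strand `a`. -/
theorem apply_row_five (hl : LEq z (Q.cp c d) (Q.eps B)) :
    z ((Q.ass a b e * Q.ass (Q.cp a b) c d : Bˣ) : B) =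
    z ((Q.nestA b c d e * Q.ass a (Q.cp b c) (Q.cp d e) * Q.ass (Q.cp a (Q.cp b c)) d e *
      Q.ass a b c : Bˣ) : B) := by
  have K : Q.nestA b c d e * Q.ass a (Q.cp b c) (Q.cp d e) * Q.ass (Q.cp a (Q.cp b c)) d e *
      Q.ass a b c = Q.ass a (Q.cp b (Q.cp c d)) e * (Q.ass a b (Q.cp c d) *
        Q.ass (Q.cp a b) c d) := by
    have five := mul_inv_eq_iff_eq_mul.mp (Q.ass_five a b c d e)
    rw [mul_assoc _ _ (Q.ass a b c), ← Q.ass_nat₁ a b c d e, ← mul_assoc, nestA, ← five, mul_assoc]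
  have h1 : CommHom (Q.cp c d) a := CommHom.symm a (Q.cp c d)
  have h2 : CommHom (Q.cp c d) b := CommHom.symm b (Q.cp c d)
  rw [K, Units.val_mul, Units.val_mul (Q.ass a (Q.cp b (Q.cp c d)) e),
    (hl.cp_eps_right Q b).ass₂ Q, Units.val_mul]
  exact ((hl.mulLeft_eps Q _ (Q.commute_ass a b e (Q.cp c d))).ass_eps₃ Q _).symm

end Five

section Six
variable (g : H →ₐ[k] B) [CommHom a b] [CommHom a c] [CommHom b c] [CommHom a d] [CommHom b d]
  [CommHom c d] [CommHom a e] [CommHom b e] [CommHom c e] [CommHom d e] [CommHom a g]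
  [CommHom b g] [CommHom c g] [CommHom d g] [CommHom e g]

/-- For three nested evaluations `c, d` inside `b, e` inside `a, g`, the outer two or the inner two
may be grouped first. Only the innermost pair has to be invariant. -/
theorem apply_row_six (hl : LEq z (Q.cp c d) (Q.eps B)) :
    z ((Q.nestA a b e g * Q.nestA (Q.cp a b) c d (Q.cp e g) * Q.ass d e g : Bˣ) : B) =
    z ((Q.nestA b c d e * Q.nestA a (Q.cp b c) (Q.cp d e) g * Q.ass a b c : Bˣ) : B) := by
  have K : Q.nestA b c d e * Q.nestA a (Q.cp b c) (Q.cp d e) g * Q.ass a b c =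
      Q.ass a (Q.cp b (Q.cp c d)) e * (Q.ass a b (Q.cp c d) *
        ((Q.ass (Q.cp (Q.cp a b) (Q.cp c d)) e g)⁻¹ *
          (Q.nestA (Q.cp a b) c d (Q.cp e g) * Q.ass d e g))) := by
    have n1 := Q.ass_nat₁ a b c (Q.cp d e) g
    have n2 := Q.ass_nat₁ (Q.cp a b) c d e g
    have p := Q.pentagon (Q.cp (Q.cp a b) c) d e g
    have five := Q.ass_five a b c d e
    have q1 : (Q.ass (Q.cp a (Q.cp b c)) (Q.cp d e) g)⁻¹ * Q.ass a b c =
        Q.ass a b c * (Q.ass (Q.cp (Q.cp a b) c) (Q.cp d e) g)⁻¹ := by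
      rw [inv_mul_eq_iff_eq_mul, ← mul_assoc, eq_mul_inv_iff_mul_eq, n1]
    have q2 : (Q.ass (Q.cp (Q.cp a b) (Q.cp c d)) e g)⁻¹ * Q.ass (Q.cp a b) c d =
        Q.ass (Q.cp a b) c d * (Q.ass (Q.cp (Q.cp (Q.cp a b) c) d) e g)⁻¹ := by
      rw [inv_mul_eq_iff_eq_mul, ← mul_assoc, eq_mul_inv_iff_mul_eq, n2]
    have q3 : (Q.ass (Q.cp (Q.cp (Q.cp a b) c) d) e g)⁻¹ *
        ((Q.ass (Q.cp (Q.cp a b) c) d (Q.cp e g))⁻¹ * Q.ass d e g) =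
        (Q.ass (Q.cp (Q.cp a b) c) d e)⁻¹ * (Q.ass (Q.cp (Q.cp a b) c) (Q.cp d e) g)⁻¹ := by
      rw [← mul_assoc, ← mul_inv_rev, ← p]
      group
    calc _ = Q.ass b c d * (Q.ass (Q.cp b c) d e)⁻¹ * Q.ass a (Q.cp b c) (Q.cp d e) *
          ((Q.ass (Q.cp a (Q.cp b c)) (Q.cp d e) g)⁻¹ * Q.ass a b c) := by
          simp only [nestA, mul_assoc]
      _ = Q.ass a (Q.cp b (Q.cp c d)) e * (Q.ass a b (Q.cp c d) * (Q.ass (Q.cp a b) c d *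
          ((Q.ass (Q.cp (Q.cp a b) c) d e)⁻¹ * (Q.ass (Q.cp (Q.cp a b) c) (Q.cp d e) g)⁻¹))) := by
          rw [q1, ← mul_assoc, ← five]; simp only [mul_assoc]
      _ = _ := by
          rw [← q3, ← mul_assoc (Q.ass (Q.cp a b) c d), ← q2]; simp only [nestA, mul_assoc]
  have h1 : CommHom (Q.cp c d) a := CommHom.symm a (Q.cp c d)
  have h2 : CommHom (Q.cp c d) b := CommHom.symm b (Q.cp c d)
  have hz := hl.mulLeft_eps Q _ (Q.commute_ass a b e (Q.cp c d))
  rw [K, Units.val_mul (Q.ass a (Q.cp b (Q.cp c d)) e),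
    (hl.cp_eps_right Q b).ass₂ Q, Units.val_mul (Q.ass a b (Q.cp c d))]
  refine Eq.trans ?_ (hz.ass_eps₃ Q (a := a) (b := b) _).symm
  rw [Units.val_mul (Q.ass (Q.cp (Q.cp a b) (Q.cp c d)) e g)⁻¹,
    (hz.cp_eps_right Q (Q.cp a b)).ass_inv₁ Q]
  simp only [LinearMap.comp_apply, LinearMap.mulLeft_apply, ← Units.val_mul]
  simp only [nestA, mul_assoc]

/-- Two nested bent strands, `a, d, e` and `b, c, g`, are disentangled into two separate zigzags
once the pairs `b, c` and `d, e` have been erased. -/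
theorem apply_zigzag_six (hl : LEq z (Q.cp b c) (Q.eps B)) (hl' : LEq z (Q.cp a d) (Q.eps B))
    (hr : REq z (Q.cp d e) (Q.eps B)) (hr' : REq z (Q.cp c g) (Q.eps B)) :
    z ((Q.nestA a b c d * (Q.ass (Q.cp a b) (Q.cp c d) (Q.cp e g))⁻¹ *
      (Q.nestA c d e g)⁻¹ : Bˣ) : B) = z (((Q.ass a d e)⁻¹ * (Q.ass b c g)⁻¹ : Bˣ) : B) := by
  have K : Q.nestA a b c d * (Q.ass (Q.cp a b) (Q.cp c d) (Q.cp e g))⁻¹ * (Q.nestA c d e g)⁻¹ =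
      Q.ass (Q.cp (Q.cp a (Q.cp b c)) d) e g * ((Q.ass (Q.cp a (Q.cp b c)) d e)⁻¹ *
        Q.ass a b c) * (Q.ass (Q.cp a b) c (Q.cp d e))⁻¹ *
        (Q.ass (Q.cp a b) (Q.cp c (Q.cp d e)) g)⁻¹ := by
    have p1 := Q.pentagon (Q.cp a b) (Q.cp c d) e g
    have p2 := Q.pentagon (Q.cp a b) c d e
    have n0 := Q.ass_nat₂ (Q.cp a b) c d e g
    have n1 := Q.ass_nat₁ (Q.cp a b) c d e g
    have n2 := (Q.ass_nat₁ a b c d e)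
    have n3 : Q.ass a b c * Q.ass (Q.cp (Q.cp (Q.cp a b) c) d) e g =
        Q.ass (Q.cp (Q.cp a (Q.cp b c)) d) e g * Q.ass a b c :=
      Intw.ass Q ((Q.ass_intw a b c).cp Q (Q.ass_comm_right a b c d))
        (Q.ass_comm_right a b c e) (Q.ass_comm_right a b c g)
    have q1 : (Q.ass (Q.cp a b) (Q.cp c d) (Q.cp e g))⁻¹ * Q.ass (Q.cp c d) e g =
        Q.ass (Q.cp (Q.cp a b) (Q.cp c d)) e g * (Q.ass (Q.cp a b) (Q.cp c d) e)⁻¹ *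
          (Q.ass (Q.cp a b) (Q.cp (Q.cp c d) e) g)⁻¹ := by
      rw [inv_mul_eq_iff_eq_mul, ← mul_assoc, ← mul_assoc, ← p1]; group
    have q2 : (Q.ass (Q.cp a b) (Q.cp (Q.cp c d) e) g)⁻¹ * (Q.ass c d e)⁻¹ =
        (Q.ass c d e)⁻¹ * (Q.ass (Q.cp a b) (Q.cp c (Q.cp d e)) g)⁻¹ := by
      rw [← mul_inv_rev, ← mul_inv_rev, n0]
    have q3 : (Q.ass (Q.cp a b) (Q.cp c d) e)⁻¹ * (Q.ass c d e)⁻¹ =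
        Q.ass (Q.cp a b) c d * (Q.ass (Q.cp (Q.cp a b) c) d e)⁻¹ *
          (Q.ass (Q.cp a b) c (Q.cp d e))⁻¹ := by
      rw [mul_assoc, ← mul_inv_rev, ← mul_inv_rev, ← p2]; group
    have q4 : (Q.ass (Q.cp a b) c d)⁻¹ * Q.ass (Q.cp (Q.cp a b) (Q.cp c d)) e g *
        Q.ass (Q.cp a b) c d = Q.ass (Q.cp (Q.cp (Q.cp a b) c) d) e g := by
      rw [mul_assoc, inv_mul_eq_iff_eq_mul, n1]
    have q5 : Q.ass a b c * (Q.ass (Q.cp (Q.cp a b) c) d e)⁻¹ =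
        (Q.ass (Q.cp a (Q.cp b c)) d e)⁻¹ * Q.ass a b c := by
      rw [mul_inv_eq_iff_eq_mul, mul_assoc, n2, inv_mul_cancel_left]
    calc _ = Q.ass a b c * (Q.ass (Q.cp a b) c d)⁻¹ *
          ((Q.ass (Q.cp a b) (Q.cp c d) (Q.cp e g))⁻¹ * Q.ass (Q.cp c d) e g) *
          (Q.ass c d e)⁻¹ := by
          simp only [nestA, mul_inv_rev, inv_inv, mul_assoc]
      _ = Q.ass a b c * (Q.ass (Q.cp a b) c d)⁻¹ * Q.ass (Q.cp (Q.cp a b) (Q.cp c d)) e g *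
          ((Q.ass (Q.cp a b) (Q.cp c d) e)⁻¹ * ((Q.ass (Q.cp a b) (Q.cp (Q.cp c d) e) g)⁻¹ *
          (Q.ass c d e)⁻¹)) := by
          rw [q1]; simp only [mul_assoc]
      _ = Q.ass a b c * ((Q.ass (Q.cp a b) c d)⁻¹ * Q.ass (Q.cp (Q.cp a b) (Q.cp c d)) e g *
          Q.ass (Q.cp a b) c d) * (Q.ass (Q.cp (Q.cp a b) c) d e)⁻¹ *
          (Q.ass (Q.cp a b) c (Q.cp d e))⁻¹ * (Q.ass (Q.cp a b) (Q.cp c (Q.cp d e)) g)⁻¹ := by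
          rw [q2, ← mul_assoc (Q.ass (Q.cp a b) (Q.cp c d) e)⁻¹, q3]; simp only [mul_assoc]
      _ = _ := by
          rw [q4, n3, mul_assoc _ (Q.ass a b c), q5]
  have h1 : CommHom (Q.cp d e) a := CommHom.symm a (Q.cp d e)
  have h2 : CommHom (Q.cp d e) b := CommHom.symm b (Q.cp d e)
  have h3 : CommHom (Q.cp d e) c := CommHom.symm c (Q.cp d e)
  have h4 : CommHom (Q.cp b c) a := CommHom.symm a (Q.cp b c)
  have hz := hr.mulRight_eps Q _ (Q.commute_ass_inv (Q.cp a b) c g (Q.cp d e))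
  have hz' := hl.mulLeft_eps Q _ (Q.commute_ass_inv a d e (Q.cp b c))
  rw [K, Units.val_mul _ (Q.ass (Q.cp a b) (Q.cp c (Q.cp d e)) g)⁻¹,
    (hr.cp_eps_right Q c).ass_inv₂ Q, Units.val_mul _ (Q.ass (Q.cp a b) c (Q.cp d e))⁻¹]
  refine (hz.ass_inv_eps₃ Q (a := Q.cp a b) (b := c) _).trans ?_
  rw [LinearMap.comp_apply, LinearMap.mulRight_apply, Units.val_mul, mul_assoc,
    (((hl.cp_eps_right Q a).cp_left Q d).trans hl').ass_eps₁ Q, Units.val_mul, mul_assoc,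
    (hl.cp_eps_right Q a).ass_inv₁ Q, ← Units.val_mul (Q.ass a b c)]
  have := Q.nestA_eq a b c g
  rw [nestA] at this
  rw [this, Units.val_mul, ← mul_assoc, hr'.ass_eps₃ Q, Units.val_mul, Units.val_mul]
  exact hz'.ass_inv_eps₂ Q _

end Six

end Invariant
end QuasiBialgebra
end

/-! ### Actions on tensor factors and matrix coefficients -/

noncomputable section

section Legs

variable {k : Type*} {X Y V W N : Type*} [Field k] [Ring X] [Algebra k X] [Ring Y] [Algebra k Y]
  [AddCommMonoid V] [Module k V] [AddCommMonoid W] [Module k W] [AddCommMonoid N] [Module k N]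

/-- An action on the first tensor factor. -/
def onL (W : Type*) [AddCommMonoid W] [Module k W] (a : X →ₐ[k] Module.End k V) :
    X →ₐ[k] Module.End k (V ⊗[k] W) := (Module.End.rTensorAlgHom k V W).comp a

/-- An action on the second tensor factor. -/
def onR (W : Type*) [AddCommMonoid W] [Module k W] (a : X →ₐ[k] Module.End k V) :
    X →ₐ[k] Module.End k (W ⊗[k] V) := (Module.End.lTensorAlgHom k V W).comp a

@[simp] theorem onL_apply_tmul (a : X →ₐ[k] Module.End k V) (x : X) (v : V) (w : W) :
    onL W a x (v ⊗ₜ[k] w) = a x v ⊗ₜ[k] w := rfl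

@[simp] theorem onR_apply_tmul (a : X →ₐ[k] Module.End k V) (x : X) (v : V) (w : W) :
    onR W a x (w ⊗ₜ[k] v) = w ⊗ₜ[k] a x v := rfl

instance (a : X →ₐ[k] Module.End k V) (b : Y →ₐ[k] Module.End k W) :
    CommHom (onL W a) (onR V b) where
  comm x y := by
    refine TensorProduct.ext' fun v w => ?_
    simp

instance (a : X →ₐ[k] Module.End k V) (b : Y →ₐ[k] Module.End k W) :
    CommHom (onR V b) (onL W a) := CommHom.symm _ _

instance (a : X →ₐ[k] Module.End k V) (b : Y →ₐ[k] Module.End k V) [CommHom a b] :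
    CommHom (onL W a) (onL W b) where
  comm x y := (CommHom.comm x y : Commute (a x) (b y)).map (Module.End.rTensorAlgHom k V W)

instance (a : X →ₐ[k] Module.End k V) (b : Y →ₐ[k] Module.End k V) [CommHom a b] :
    CommHom (onR W a) (onR W b) where
  comm x y := (CommHom.comm x y : Commute (a x) (b y)).map (Module.End.lTensorAlgHom k V W)

/-- The matrix coefficient `E ↦ φ (E v)`. -/
def matCoeff (φ : V →ₗ[k] N) (v : V) : Module.End k V →ₗ[k] N := φ ∘ₗ LinearMap.applyₗ v

@[simp] theorem matCoeff_apply (φ : V →ₗ[k] N) (v : V) (E : Module.End k V) :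
    matCoeff φ v E = φ (E v) := rfl

/-- The regular left action. -/
def legL (k X : Type*) [Field k] [Ring X] [Algebra k X] : X →ₐ[k] Module.End k X :=
  Algebra.lmul k X

@[simp] theorem legL_apply (x y : X) : legL k X x y = x * y := rfl

@[elab_as_elim]
theorem tensor3_induction {A B C : Type*} [AddCommGroup A] [Module k A] [AddCommGroup B]
    [Module k B] [AddCommGroup C] [Module k C] {P : A ⊗[k] (B ⊗[k] C) → Prop}
    (t : A ⊗[k] (B ⊗[k] C)) (zero : P 0) (pure : ∀ a b c, P (a ⊗ₜ[k] (b ⊗ₜ[k] c)))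
    (add : ∀ x y, P x → P y → P (x + y)) : P t := by
  induction t with
  | zero => exact zero
  | add x y hx hy => exact add x y hx hy
  | tmul a u =>
    induction u with
    | zero => simpa using zero
    | add x y hx hy => rw [TensorProduct.tmul_add]; exact add _ _ hx hy
    | tmul b c => exact pure a b c

end Legs

/-! ### Cancellability of the antipode -/

namespace QuasiHopfAlgebra

variable {k : Type*} {H A : Type*} [Field k] [Ring H] [Algebra k H] [Ring A] [Algebra k A]
  (Q : QuasiHopfAlgebra k H)

/-- The action `x · y = y S(x)`. -/
def legS : H →ₐ[k] Module.End k H := AlgHom.ofLinearMap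
  (LinearMap.mk₂ k (fun x y => y * Q.S x) (by simp [mul_add]) (by simp) (by simp [add_mul])
    (by simp)) (by ext; simp [Q.S_one]) (by intro x y; ext; simp [Q.S_mul, mul_assoc])

@[simp] theorem legS_apply (x y : H) : Q.legS x y = y * Q.S x := rfl

instance : CommHom (legL k H) Q.legS where
  comm x y := by ext z; simp [mul_assoc]

instance : CommHom Q.legS (legL k H) := CommHom.symm _ _

theorem evα_Δ (h : H) : Q.evα (Q.Δ h) = Q.ε h • Q.α := Q.antipode_left h

theorem evβ_Δ (h : H) : Q.evβ (Q.Δ h) = Q.ε h • Q.β := Q.antipode_right h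

theorem leq_of {V N : Type*} [AddCommGroup V] [Module k V] [AddCommGroup N] [Module k N]
    {φ : V →ₗ[k] N} {v : V} {a b : H →ₐ[k] Module.End k V} [CommHom a b]
    (h : ∀ h t, φ (pairHom a b (Q.Δ h) t) = Q.ε h • φ t) :
    LEq (matCoeff φ v) (Q.cp a b) (Q.eps _) := by
  intro x E
  rw [Q.apply_eps_mul]
  exact h x (E v)

theorem req_of {V N : Type*} [AddCommGroup V] [Module k V] [AddCommGroup N] [Module k N]
    {φ : V →ₗ[k] N} {v : V} {a b : H →ₐ[k] Module.End k V} [CommHom a b]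
    (h : ∀ h, pairHom a b (Q.Δ h) v = Q.ε h • v) :
    REq (matCoeff φ v) (Q.cp a b) (Q.eps _) := by
  intro x E
  rw [Q.apply_mul_eps, matCoeff_apply, Module.End.mul_apply, Q.cp_apply, h, map_smul, map_smul,
    matCoeff_apply]

section Epi

variable (g₁ g₂ : H →ₐ[k] A)

/-- `x ⊗ y ⊗ z ↦ g₁(x β S(y)) g₂(α z)`. -/
def zig : H ⊗[k] (H ⊗[k] H) →ₗ[k] A :=
  LinearMap.mul' k A ∘ₗ TensorProduct.map (g₁.toLinearMap ∘ₗ Q.evβ)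
    (g₂.toLinearMap ∘ₗ LinearMap.mulLeft k Q.α) ∘ₗ (TensorProduct.assoc k H H H).symm.toLinearMap

@[simp] theorem zig_tmul (x y z : H) :
    Q.zig g₁ g₂ (x ⊗ₜ[k] (y ⊗ₜ[k] z)) = g₁ (x * Q.β * Q.S y) * g₂ (Q.α * z) := by
  simp [zig, evβ_tmul]

variable {g₁ g₂} (hg : ∀ x, g₁ (Q.S x) = g₂ (Q.S x))
include hg

/-- The element `h` slides along a zigzag: `β` absorbs the first two strands and `α` the last two.
The latter needs `hg`, which carries `S(h₁)` from the `g₁` side to the `g₂` side, where it meets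
`α`. -/
theorem mul_zig (h : H) : g₁ h * Q.zig g₁ g₂ Q.Φ = Q.zig g₁ g₂ Q.Φ * g₂ h := by
  let φ : H ⊗[k] H →ₗ[k] A := LinearMap.mul' k A ∘ₗ TensorProduct.map g₁.toLinearMap
    (g₂.toLinearMap ∘ₗ LinearMap.mulLeft k Q.α)
  let a := onL H (legL k H)
  let b := onL H Q.legS
  let c := onR H (legL k H)
  have hl : LEq (matCoeff φ (Q.β ⊗ₜ[k] 1)) (Q.cp b c) (Q.eps _) := by
    refine Q.leq_of fun h t => ?_
    induction t with
    | zero => simp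
    | add x y hx hy => simp only [map_add, smul_add, hx, hy]
    | tmul x y =>
      have : ∀ T, φ (pairHom b c T (x ⊗ₜ[k] y)) = g₁ x * g₂ (Q.evα T) * g₂ y := by
        intro T
        induction T with
        | zero => simp
        | add x y hx hy => simp only [map_add, mul_add, add_mul, LinearMap.add_apply, hx, hy]
        | tmul p q => simp [b, c, φ, evα_tmul, hg, mul_assoc]
      rw [this, evα_Δ]
      simp [φ, mul_assoc]
  have hr : REq (matCoeff φ (Q.β ⊗ₜ[k] 1)) (Q.cp a b) (Q.eps _) := by
    refine Q.req_of fun h => ?_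
    have : ∀ T, pairHom a b T (Q.β ⊗ₜ[k] (1 : H)) = Q.evβ T ⊗ₜ[k] (1 : H) := by
      intro T
      induction T with
      | zero => simp
      | add x y hx hy => simp only [map_add, TensorProduct.add_tmul, LinearMap.add_apply, hx, hy]
      | tmul p q => simp [a, b, evβ_tmul, mul_assoc]
    rw [this, evβ_Δ, TensorProduct.smul_tmul']
  have key := Q.apply_mul_ass hl hr h
  have e1 : ∀ T, matCoeff φ (Q.β ⊗ₜ[k] 1) (a h * pairHom a (pairHom b c) T) =
      g₁ h * Q.zig g₁ g₂ T := by
    intro T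
    induction T using tensor3_induction with
    | zero => simp
    | add x y hx hy => simp only [map_add, mul_add, hx, hy]
    | pure x y z => simp [φ, a, b, c, mul_assoc]
  have e2 : ∀ T, matCoeff φ (Q.β ⊗ₜ[k] 1) (pairHom a (pairHom b c) T * c h) =
      Q.zig g₁ g₂ T * g₂ h := by
    intro T
    induction T using tensor3_induction with
    | zero => simp
    | add x y hx hy => simp only [map_add, add_mul, hx, hy]
    | pure x y z => simp [φ, a, b, c, mul_assoc]
  rw [← e1, ← e2]
  exact key

end Epi

end QuasiHopfAlgebra
end

/-! ### Bijectivity of the antipode in finite dimension -/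

noncomputable section

namespace QuasiHopfAlgebra

variable {k : Type*} {H A : Type*} [Field k] [Ring H] [Algebra k H] [Ring A] [Algebra k A]
  (Q : QuasiHopfAlgebra k H)

/-- `x ⊗ y ⊗ z ↦ S(x) α y β S(z)`. -/
def zagInv : H ⊗[k] (H ⊗[k] H) →ₗ[k] H :=
  LinearMap.mul' k H ∘ₗ (TensorProduct.map (LinearMap.mulRight k Q.α ∘ₗ Q.S)
      (LinearMap.mul' k H ∘ₗ TensorProduct.map (LinearMap.mulRight k Q.β) Q.S))

@[simp] theorem zagInv_tmul (x y z : H) :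
    Q.zagInv (x ⊗ₜ[k] (y ⊗ₜ[k] z)) = Q.S x * Q.α * y * Q.β * Q.S z := by
  simp [zagInv, mul_assoc]

theorem zagInv_phiInv : Q.zagInv Q.phiInv = 1 := Q.antipode_reassoc_inv

/-- `x ⊗ y ⊗ z ↦ x β S(y) α z`. -/
def zag : H ⊗[k] (H ⊗[k] H) →ₗ[k] H :=
  LinearMap.mul' k H ∘ₗ (TensorProduct.map (LinearMap.mulRight k Q.β)
      (LinearMap.mul' k H ∘ₗ TensorProduct.map Q.S (LinearMap.mulLeft k Q.α)))

@[simp] theorem zag_tmul (x y z : H) :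
    Q.zag (x ⊗ₜ[k] (y ⊗ₜ[k] z)) = x * Q.β * Q.S y * Q.α * z := by
  simp [zag, mul_assoc]

theorem zag_phi : Q.zag Q.phi = 1 := Q.antipode_reassoc

section Epi

variable {g₁ g₂ : H →ₐ[k] A} (hg : ∀ x, g₁ (Q.S x) = g₂ (Q.S x))
include hg

/-- The axiom `∑ X¹ β S(X²) α X³ = 1` does not apply when its two halves are mapped by different
homomorphisms. The five-strand zigzag trades the mixed expression for a product of two unmixed
expressions `∑ S(x¹) α x² β S(x³) = 1`. -/
theorem zig_phi : Q.zig g₁ g₂ Q.Φ = 1 := by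
  let φ : H ⊗[k] (H ⊗[k] H) →ₗ[k] A := LinearMap.mul' k A ∘ₗ TensorProduct.map
    (g₁.toLinearMap ∘ₗ Q.evα) (g₂.toLinearMap ∘ₗ LinearMap.mulLeft k Q.α) ∘ₗ
      (TensorProduct.assoc k H H H).symm.toLinearMap
  let v : H ⊗[k] (H ⊗[k] H) := 1 ⊗ₜ[k] (Q.β ⊗ₜ[k] Q.β)
  let a := onL (H ⊗[k] H) (legL k H)
  let b := onR H (onL H (legL k H))
  let c := onR H (onL H Q.legS)
  let d := onR H (onR H (legL k H))
  let e := onR H (onR H Q.legS)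
  have hφ : ∀ x y z, φ (x ⊗ₜ[k] (y ⊗ₜ[k] z)) = g₁ (Q.S x * Q.α * y) * g₂ (Q.α * z) := by
    intro x y z
    simp [φ, evα_tmul]
  have hl : LEq (matCoeff φ v) (Q.cp a b) (Q.eps _) := by
    refine Q.leq_of fun h t => ?_
    induction t using tensor3_induction with
    | zero => simp
    | add x y hx hy => simp only [map_add, smul_add, hx, hy]
    | pure x y z =>
      have : ∀ T, φ (pairHom a b T (x ⊗ₜ[k] (y ⊗ₜ[k] z))) =
          g₁ (Q.S x * Q.evα T * y) * g₂ (Q.α * z) := by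
        intro T
        induction T with
        | zero => simp
        | add x y hx hy => simp only [map_add, mul_add, add_mul, LinearMap.add_apply, hx, hy]
        | tmul p q => simp [a, b, hφ, evα_tmul, Q.S_mul, mul_assoc]
      rw [this, evα_Δ, hφ]
      simp
  -- The pair straddles `g₁` and `g₂`; `hg` moves `S(h₁)` across before `α` absorbs it.
  have hl' : LEq (matCoeff φ v) (Q.cp c d) (Q.eps _) := by
    refine Q.leq_of fun h t => ?_
    induction t using tensor3_induction with
    | zero => simp
    | add x y hx hy => simp only [map_add, smul_add, hx, hy]
    | pure x y z =>
      have : ∀ T, φ (pairHom c d T (x ⊗ₜ[k] (y ⊗ₜ[k] z))) =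
          g₁ (Q.S x * Q.α * y) * g₂ (Q.evα T * z) := by
        intro T
        induction T with
        | zero => simp
        | add x y hx hy => simp only [map_add, mul_add, add_mul, LinearMap.add_apply, hx, hy]
        | tmul p q => simp [c, d, hφ, evα_tmul, hg, mul_assoc]
      rw [this, evα_Δ, hφ]
      simp
  have hr : REq (matCoeff φ v) (Q.cp b c) (Q.eps _) := by
    refine Q.req_of fun h => ?_
    have : ∀ T, pairHom b c T v = 1 ⊗ₜ[k] (Q.evβ T ⊗ₜ[k] Q.β) := by
      intro T
      induction T with
      | zero => simp
      | add x y hx hy =>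
        simp only [map_add, TensorProduct.add_tmul, TensorProduct.tmul_add, LinearMap.add_apply,
          hx, hy]
      | tmul p q => simp [b, c, v, evβ_tmul, mul_assoc]
    rw [this, evβ_Δ]
    simp only [v, ← TensorProduct.smul_tmul', TensorProduct.tmul_smul]
  have key := Q.apply_five_zigzag hl hl' hr (e := e)
  have e1 : ∀ T, matCoeff φ v (pairHom a (pairHom b e) T * pairHom b (pairHom c d) Q.Φ) =
      Q.zig g₁ g₂ Q.Φ * g₂ (Q.zagInv T) := by
    intro T
    induction T using tensor3_induction with
    | zero => simp
    | add x y hx hy => simp only [map_add, mul_add, add_mul, hx, hy]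
    | pure p q r =>
      have : ∀ T', matCoeff φ v (pairHom a (pairHom b e) (p ⊗ₜ[k] (q ⊗ₜ[k] r)) *
          pairHom b (pairHom c d) T') =
          g₁ (Q.S p * Q.α * q) * Q.zig g₁ g₂ T' * g₂ (Q.β * Q.S r) := by
        intro T'
        induction T' using tensor3_induction with
        | zero => simp
        | add x y hx hy => simp only [map_add, mul_add, add_mul, hx, hy]
        | pure x y z => simp [a, b, c, d, e, v, hφ, mul_assoc]
      -- Sliding `g₁(S(p) α q)` through the zigzag turns it into `g₂(S(p) α q)`, which joins `g₂(β
      -- S(r))` to form the second unit axiom.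
      rw [this, Q.mul_zig hg, zagInv_tmul, mul_assoc, ← map_mul]
      simp only [mul_assoc]
  have e2 : ∀ T T', matCoeff φ v (pairHom c (pairHom d e) T * pairHom a (pairHom b c) T') =
      g₁ (Q.zagInv T') * g₂ (Q.zagInv T) := by
    intro T T'
    induction T using tensor3_induction with
    | zero => simp
    | add x y hx hy => simp only [map_add, mul_add, add_mul, hx, hy]
    | pure p q r =>
      induction T' using tensor3_induction with
      | zero => simp
      | add x y hx hy => simp only [map_add, mul_add, add_mul, hx, hy]
      | pure x y z => simp [a, b, c, d, e, v, hφ, mul_assoc, hg]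
  have f1 := e1 Q.phiInv
  have f2 := e2 Q.phiInv Q.phiInv
  rw [zagInv_phiInv, map_one, mul_one] at f1
  rw [zagInv_phiInv, map_one, map_one, mul_one] at f2
  rw [← f1, ← f2]
  exact key

theorem hom_ext_of_comp_antipode : g₁ = g₂ := by
  ext h
  have := Q.mul_zig hg h
  rwa [Q.zig_phi hg, one_mul, mul_one] at this

end Epi

/-- An endomorphism that can be cancelled from the right need not be onto in general; Fitting's
lemma supplies the retraction on which cancellation can act. -/
theorem antipode_bijective [FiniteDimensional k H] : Function.Bijective Q.S := by
  let φ : H →ₐ[k] H := AlgHom.ofLinearMap (Q.S ∘ₗ Q.S) (by simp [Q.S_one]) (by simp [Q.S_mul])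
  -- Since `S` reverses products, `g ∘ S` is an algebra map into the opposite algebra; the two
  -- factors `S` are cancelled one at a time.
  have hφ : ∀ g₁ g₂ : H →ₐ[k] H, g₁.comp φ = g₂.comp φ → g₁ = g₂ := by
    intro g₁ g₂ h
    let op : (H →ₐ[k] H) → (H →ₐ[k] Hᵐᵒᵖ) := fun g => AlgHom.ofLinearMap
      ((MulOpposite.opLinearEquiv k).toLinearMap ∘ₗ g.toLinearMap ∘ₗ Q.S)
      (by simp [Q.S_one]) (by simp [Q.S_mul])
    have h1 : op g₁ = op g₂ := Q.hom_ext_of_comp_antipode fun x =>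
      congrArg MulOpposite.op (DFunLike.congr_fun h x)
    exact Q.hom_ext_of_comp_antipode fun x =>
      MulOpposite.op_injective (DFunLike.congr_fun h1 x)
  have hpow : ∀ (n : ℕ) (g₁ g₂ : H →ₐ[k] H), g₁.comp (φ ^ n) = g₂.comp (φ ^ n) → g₁ = g₂ := by
    intro n
    induction n with
    | zero => exact fun g₁ g₂ h => AlgHom.ext fun x => DFunLike.congr_fun h x
    | succ n ih =>
      intro g₁ g₂ h
      rw [pow_succ] at h
      exact ih _ _ (hφ _ _ h)
  -- Positivity of `n` ensures that the range of the power lies in the range of `S`.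
  obtain ⟨n, hn, hd⟩ : ∃ n, 1 ≤ n ∧ Disjoint (LinearMap.ker (φ.toLinearMap ^ n))
      (LinearMap.range (φ.toLinearMap ^ n)) := by
    obtain ⟨n, hn⟩ := Filter.eventually_atTop.mp
      (LinearMap.eventually_isCompl_ker_pow_range_pow φ.toLinearMap)
    exact ⟨n + 1, by omega, (hn _ (by omega)).disjoint⟩
  set f : H →ₐ[k] H := φ ^ n with hf
  have hfl : f.toLinearMap = φ.toLinearMap ^ n := by
    rw [hf]
    exact map_pow (AlgHom.toEnd : (H →ₐ[k] H) →* Module.End k H) φ n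
  rw [← hfl] at hd
  let fR : f.range →ₐ[k] f.range := f.rangeRestrict.comp f.range.val
  have hinj : Function.Injective fR := by
    rw [injective_iff_map_eq_zero]
    rintro ⟨x, hx⟩ h
    have h' : f x = 0 := congrArg Subtype.val h
    have := (Submodule.disjoint_def.mp hd) x h' hx
    exact Subtype.ext this
  have hbij : Function.Bijective fR :=
    ⟨hinj, LinearMap.surjective_of_injective (f := fR.toLinearMap) hinj⟩
  let e := AlgEquiv.ofBijective fR hbij
  -- The Fitting projection onto the range of `f`, which is an algebra map. It fixes that range, so
  -- `π ∘ f = f`, and cancelling `f` gives `π = id`.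
  let π : H →ₐ[k] H := f.range.val.comp (e.symm.toAlgHom.comp f.rangeRestrict)
  have hπ : π = AlgHom.id k H := by
    apply hpow n
    ext h
    have : f.rangeRestrict (f h) = e (f.rangeRestrict h) := rfl
    change ((e.symm (f.rangeRestrict (f h)) : f.range) : H) = f h
    rw [this, e.symm_apply_apply]
    rfl
  have hsurj : Function.Surjective Q.S := by
    intro h
    obtain ⟨y, hy⟩ := (e.symm (f.rangeRestrict h)).2
    have h1 : f y = h := hy.trans (DFunLike.congr_fun hπ h)
    obtain ⟨m, rfl⟩ := Nat.exists_eq_add_of_le' hn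
    rw [hf, pow_succ'] at h1
    exact ⟨_, h1⟩
  exact ⟨LinearMap.injective_iff_surjective.mpr hsurj, hsurj⟩

end QuasiHopfAlgebra
end

/-! ### Invariance of evaluations and coevaluations; the elements `γ` and `δ` -/

noncomputable section

namespace QuasiHopfAlgebra

section Quadruple

variable {k : Type*} {H B : Type*} [Field k] [Ring H] [Algebra k H] [Semiring B] [Algebra k B]
  (Q : QuasiHopfAlgebra k H) (a b c d : H →ₐ[k] B) [CommHom a b] [CommHom a c] [CommHom b c]
  [CommHom a d] [CommHom b d] [CommHom c d]

theorem quad_tensorOne (t : H ⊗[k] (H ⊗[k] H)) :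
    pairHom a (pairHom b (pairHom c d)) (tensorOne k H t) = pairHom a (pairHom b c) t := by
  induction t using tensor3_induction with
  | zero => simp
  | add x y hx hy => simp only [map_add, hx, hy]
  | pure x y z => simp [tensorOne]

theorem quad_Δ₁ (t : H ⊗[k] (H ⊗[k] H)) :
    pairHom a (pairHom b (pairHom c d)) (Q.Δ₁ t) = pairHom (Q.cp a b) (pairHom c d) t := by
  rw [Δ₁, LinearMap.comp_apply, LinearEquiv.coe_coe, pairHom_assoc, pairHom_rTensor]
  rfl

/-- `A` and `B` are the universal instances of `nestA` and its inverse, so coherence for four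
strands applies to `γ` and `δ`. -/
theorem quad_A : pairHom a (pairHom b (pairHom c d)) Q.A = (Q.nestA a b c d : B) := by
  rw [A, map_mul, quad_tensorOne, quad_Δ₁]
  rfl

theorem quad_B : pairHom a (pairHom b (pairHom c d)) Q.B =
    (((Q.nestA a b c d)⁻¹ : Bˣ) : B) := by
  rw [QuasiHopfAlgebra.B, map_mul, quad_tensorOne, quad_Δ₁, QuasiBialgebra.nestA, mul_inv_rev,
    inv_inv]
  rfl

end Quadruple

variable {k : Type*} {H : Type*} [Field k] [Ring H] [Algebra k H] (Q : QuasiHopfAlgebra k H)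

section Invariants

variable {V W N M : Type*} [AddCommMonoid V] [Module k V] [AddCommMonoid W] [Module k W]
  [AddCommMonoid N] [Module k N] [AddCommMonoid M] [Module k M]

/-- `φ` is invariant under the action `h ↦ ∑ a(h₁) b(h₂)`. -/
def RowInv (φ : V →ₗ[k] N) (a b : H →ₐ[k] Module.End k V) [CommHom a b] : Prop :=
  ∀ h t, φ (pairHom a b (Q.Δ h) t) = Q.ε h • φ t

/-- `v` is invariant under the action `h ↦ ∑ a(h₁) b(h₂)`. -/
def ColInv (v : V) (a b : H →ₐ[k] Module.End k V) [CommHom a b] : Prop :=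
  ∀ h, pairHom a b (Q.Δ h) v = Q.ε h • v

variable {Q} {φ : V →ₗ[k] N} {ψ : W →ₗ[k] M} {v : V} {w : W}

theorem RowInv.leq {a b : H →ₐ[k] Module.End k V} [CommHom a b] (h : Q.RowInv φ a b) :
    LEq (matCoeff φ v) (Q.cp a b) (Q.eps _) := by
  intro x E
  rw [Q.apply_eps_mul]
  exact h x (E v)

theorem ColInv.req {a b : H →ₐ[k] Module.End k V} [CommHom a b] (h : Q.ColInv v a b) :
    REq (matCoeff φ v) (Q.cp a b) (Q.eps _) := by
  intro x E
  rw [Q.apply_mul_eps, matCoeff_apply, Module.End.mul_apply, Q.cp_apply, h, map_smul, map_smul,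
    matCoeff_apply]

theorem onL_pair (a b : H →ₐ[k] Module.End k V) [CommHom a b] (t : H ⊗[k] H) :
    pairHom (onL W a) (onL W b) t = (pairHom a b t).rTensor W := by
  induction t with
  | zero => simp
  | add x y hx hy => simp only [map_add, hx, hy, LinearMap.rTensor_add]
  | tmul x y => rw [pairHom_tmul, pairHom_tmul, LinearMap.rTensor_mul]; rfl

theorem onR_pair (a b : H →ₐ[k] Module.End k V) [CommHom a b] (t : H ⊗[k] H) :
    pairHom (onR W a) (onR W b) t = (pairHom a b t).lTensor W := by
  induction t with
  | zero => simp
  | add x y hx hy => simp only [map_add, hx, hy, LinearMap.lTensor_add]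
  | tmul x y => rw [pairHom_tmul, pairHom_tmul, LinearMap.lTensor_mul]; rfl

theorem RowInv.map_left {a b : H →ₐ[k] Module.End k V} [CommHom a b] (h : Q.RowInv φ a b)
    (ψ : W →ₗ[k] M) : Q.RowInv (TensorProduct.map φ ψ) (onL W a) (onL W b) := by
  intro x t
  rw [onL_pair]
  induction t with
  | zero => simp
  | add x y hx hy => simp only [map_add, smul_add, hx, hy]
  | tmul p q => simp [h x, TensorProduct.smul_tmul']

theorem RowInv.map_right {a b : H →ₐ[k] Module.End k W} [CommHom a b] (h : Q.RowInv ψ a b)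
    (φ : V →ₗ[k] N) : Q.RowInv (TensorProduct.map φ ψ) (onR V a) (onR V b) := by
  intro x t
  rw [onR_pair]
  induction t with
  | zero => simp
  | add x y hx hy => simp only [map_add, smul_add, hx, hy]
  | tmul p q => simp [h x]

theorem RowInv.comp {a b : H →ₐ[k] Module.End k V} [CommHom a b] (h : Q.RowInv φ a b)
    (g : N →ₗ[k] M) : Q.RowInv (g ∘ₗ φ) a b := by
  intro x t
  rw [LinearMap.comp_apply, h x t, map_smul, LinearMap.comp_apply]

theorem ColInv.tmul_left {a b : H →ₐ[k] Module.End k V} [CommHom a b] (h : Q.ColInv v a b)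
    (w : W) : Q.ColInv (v ⊗ₜ[k] w) (onL W a) (onL W b) := by
  intro x
  rw [onL_pair, LinearMap.rTensor_tmul, h x, TensorProduct.smul_tmul']

theorem ColInv.tmul_right {a b : H →ₐ[k] Module.End k W} [CommHom a b] (h : Q.ColInv w a b)
    (v : V) : Q.ColInv (v ⊗ₜ[k] w) (onR V a) (onR V b) := by
  intro x
  rw [onR_pair, LinearMap.lTensor_tmul, h x, TensorProduct.tmul_smul]

variable (Q) in
-- The antipode axiom for `α`, read as invariance of an evaluation; `colInv_β` is the dual reading
-- for `β`.
theorem rowInv_evα : Q.RowInv Q.evα (onL H (legL k H)) (onR H (legL k H)) := by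
  intro h t
  induction t with
  | zero => simp
  | add x y hx hy => simp only [map_add, smul_add, hx, hy]
  | tmul x y =>
    have : ∀ T, Q.evα (pairHom (onL H (legL k H)) (onR H (legL k H)) T (x ⊗ₜ[k] y)) =
        Q.S x * Q.evα T * y := by
      intro T
      induction T with
      | zero => simp
      | add x y hx hy => simp only [map_add, mul_add, add_mul, LinearMap.add_apply, hx, hy]
      | tmul p q => simp [evα_tmul, Q.S_mul, mul_assoc]
    rw [this, evα_Δ, evα_tmul]
    simp

variable (Q) in
theorem colInv_β : Q.ColInv Q.β (legL k H) Q.legS := by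
  intro h
  have : ∀ T, pairHom (legL k H) Q.legS T Q.β = Q.evβ T := by
    intro T
    induction T with
    | zero => simp
    | add x y hx hy => simp only [map_add, LinearMap.add_apply, hx, hy]
    | tmul p q => simp [evβ_tmul, mul_assoc]
  rw [this, evβ_Δ]

variable (Q) in
/-- `x ⊗ y ↦ x α y`. -/
def mulα : H ⊗[k] H →ₗ[k] H := LinearMap.mul' k H ∘ₗ (LinearMap.mulRight k Q.α).rTensor H

variable (Q) in
@[simp] theorem mulα_tmul (x y : H) : Q.mulα (x ⊗ₜ[k] y) = x * Q.α * y := rfl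

variable (Q) in
theorem rowInv_mulα : Q.RowInv Q.mulα (onL H Q.legS) (onR H (legL k H)) := by
  intro h t
  induction t with
  | zero => simp
  | add x y hx hy => simp only [map_add, smul_add, hx, hy]
  | tmul x y =>
    have : ∀ T, Q.mulα (pairHom (onL H Q.legS) (onR H (legL k H)) T (x ⊗ₜ[k] y)) =
        x * Q.evα T * y := by
      intro T
      induction T with
      | zero => simp
      | add x y hx hy => simp only [map_add, mul_add, add_mul, LinearMap.add_apply, hx, hy]
      | tmul p q => simp [evα_tmul, mul_assoc]
    rw [this, evα_Δ, mulα_tmul]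
    simp

end Invariants

/-- `x ⊗ y ↦ S(y) ⊗ S(x)`. -/
def flipS : H ⊗[k] H →ₗ[k] H ⊗[k] H :=
  TensorProduct.map Q.S Q.S ∘ₗ (TensorProduct.comm k H H).toLinearMap

@[simp] theorem flipS_tmul (x y : H) : Q.flipS (x ⊗ₜ[k] y) = Q.S y ⊗ₜ[k] Q.S x := by
  simp [flipS]

theorem flipS_mul (x y : H ⊗[k] H) : Q.flipS (x * y) = Q.flipS y * Q.flipS x := by
  induction x with
  | zero => simp
  | add x x' hx hy => simp only [map_add, mul_add, add_mul, hx, hy]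
  | tmul p q =>
    induction y with
    | zero => simp
    | add x x' hx hy => simp only [map_add, mul_add, add_mul, hx, hy]
    | tmul r s => simp [Q.S_mul]

theorem flipS_one : Q.flipS 1 = 1 := by
  rw [Algebra.TensorProduct.one_def, flipS_tmul, Q.S_one]

theorem SSop_apply (h : H) : Q.SSop h = Q.flipS (Q.Δ h) := rfl

@[simp] theorem SSop_mul (x y : H) : Q.SSop (x * y) = Q.SSop y * Q.SSop x := by
  simp only [SSop_apply, map_mul, flipS_mul]

@[simp] theorem SSop_one : Q.SSop 1 = 1 := by
  rw [SSop_apply, map_one, flipS_one]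

/-- `a ⊗ b ⊗ c ⊗ d ↦ S(b) α c ⊗ S(a) α d`. -/
def rowTwo : H ⊗[k] (H ⊗[k] (H ⊗[k] H)) →ₗ[k] H ⊗[k] H :=
  TensorProduct.map Q.evα Q.evα ∘ₗ permA k H

@[simp] theorem rowTwo_tmul (a b c d : H) : Q.rowTwo (a ⊗ₜ[k] (b ⊗ₜ[k] (c ⊗ₜ[k] d))) =
    (Q.S b * Q.α * c) ⊗ₜ[k] (Q.S a * Q.α * d) := by
  simp [rowTwo, permA_tmul, evα_tmul]

theorem γ_eq : Q.γ = Q.rowTwo Q.A := rfl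

/-- `a ⊗ b ⊗ c ⊗ d ↦ a β S(d) ⊗ b β S(c)`. -/
def colTwo : H ⊗[k] (H ⊗[k] (H ⊗[k] H)) →ₗ[k] H ⊗[k] H :=
  TensorProduct.map Q.evβ Q.evβ ∘ₗ permB k H

@[simp] theorem colTwo_tmul (a b c d : H) : Q.colTwo (a ⊗ₜ[k] (b ⊗ₜ[k] (c ⊗ₜ[k] d))) =
    (a * Q.β * Q.S d) ⊗ₜ[k] (b * Q.β * Q.S c) := by
  simp [colTwo, permB_tmul, evβ_tmul]

theorem δ_eq : Q.δ = Q.colTwo Q.B := rfl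

@[elab_as_elim]
theorem _root_.tensor4_induction {A B C D : Type*} [AddCommGroup A] [Module k A] [AddCommGroup B]
    [Module k B] [AddCommGroup C] [Module k C] [AddCommGroup D] [Module k D]
    {P : A ⊗[k] (B ⊗[k] (C ⊗[k] D)) → Prop}
    (t : A ⊗[k] (B ⊗[k] (C ⊗[k] D))) (zero : P 0)
    (pure : ∀ a b c d, P (a ⊗ₜ[k] (b ⊗ₜ[k] (c ⊗ₜ[k] d))))
    (add : ∀ x y, P x → P y → P (x + y)) : P t := by
  induction t with
  | zero => exact zero
  | add x y hx hy => exact add x y hx hy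
  | tmul a u =>
    induction u using tensor3_induction with
    | zero => simpa using zero
    | add x y hx hy => rw [TensorProduct.tmul_add]; exact add _ _ hx hy
    | pure b c d => exact pure a b c d

/-- `x ⊗ y ↦ (S ⊗ S)(Δᵒᵖ(x)) γ Δ(y)`. -/
def evγ : H ⊗[k] H →ₗ[k] H ⊗[k] H :=
  LinearMap.mul' k (H ⊗[k] H) ∘ₗ
    TensorProduct.map (LinearMap.mulRight k Q.γ ∘ₗ Q.SSop) Q.Δ.toLinearMap

@[simp] theorem evγ_tmul (x y : H) : Q.evγ (x ⊗ₜ[k] y) = Q.SSop x * Q.γ * Q.Δ y := rfl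

/-- `x ⊗ y ↦ Δ(x) δ (S ⊗ S)(Δᵒᵖ(y))`. -/
def evδ : H ⊗[k] H →ₗ[k] H ⊗[k] H :=
  LinearMap.mul' k (H ⊗[k] H) ∘ₗ
    TensorProduct.map (LinearMap.mulRight k Q.δ ∘ₗ Q.Δ.toLinearMap) Q.SSop

@[simp] theorem evδ_tmul (x y : H) : Q.evδ (x ⊗ₜ[k] y) = Q.Δ x * Q.δ * Q.SSop y := rfl

/-- Four strands: `γ` is the nested evaluation of `b, c` inside `a, d`, and `A` is exactly the
rebracketing that lets `h` act on the inner and then on the outer pair. -/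
theorem evγ_Δ (h : H) : Q.evγ (Q.Δ h) = Q.ε h • Q.γ := by
  let φ : (H ⊗[k] H) ⊗[k] (H ⊗[k] H) →ₗ[k] H ⊗[k] H := TensorProduct.map Q.evα Q.evα
  let b := onL (H ⊗[k] H) (onL H (legL k H))
  let c := onL (H ⊗[k] H) (onR H (legL k H))
  let a := onR (H ⊗[k] H) (onL H (legL k H))
  let d := onR (H ⊗[k] H) (onR H (legL k H))
  let z := matCoeff φ ((1 ⊗ₜ[k] 1) ⊗ₜ[k] (1 ⊗ₜ[k] 1))
  have key := Q.apply_nestA_mul (z := z) (Q.rowInv_evα.map_left Q.evα).leq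
    (Q.rowInv_evα.map_right Q.evα).leq h
  have e1 : ∀ T P R, z (pairHom a (pairHom b (pairHom c d)) T * (pairHom a b P * pairHom c d R)) =
      Q.flipS P * Q.rowTwo T * R := by
    intro T P R
    induction T using tensor4_induction with
    | zero => simp
    | add x y hx hy => simp only [map_add, mul_add, add_mul, hx, hy]
    | pure x y u w =>
      induction P with
      | zero => simp
      | add x y hx hy => simp only [map_add, mul_add, add_mul, hx, hy]
      | tmul p q =>
        induction R with
        | zero => simp
        | add x y hx hy => simp only [map_add, mul_add, hx, hy]
        | tmul r s => simp [a, b, c, d, z, φ, evα_tmul, Q.S_mul, mul_assoc]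
  have e2 : ∀ T, z (pairHom a (pairHom b (pairHom c d)) Q.A *
      pairHom (Q.cp a b) (Q.cp c d) T) = Q.evγ T := by
    intro T
    induction T with
    | zero => simp
    | add x y hx hy => simp only [map_add, mul_add, hx, hy]
    | tmul p q => rw [pairHom_tmul, Q.cp_apply, Q.cp_apply, e1]; rfl
  rw [← e2, quad_A]
  refine key.trans ?_
  rw [← quad_A]
  have := e1 Q.A 1 1
  simp only [map_one, mul_one, flipS_one, one_mul] at this
  rw [γ_eq, ← this]

/-- The dual statement, for the nested coevaluation of `b, c` inside `a, d`. -/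
theorem evδ_Δ (h : H) : Q.evδ (Q.Δ h) = Q.ε h • Q.δ := by
  let a := onL H (legL k H)
  let d := onL H Q.legS
  let b := onR H (legL k H)
  let c := onR H Q.legS
  let z := matCoeff (LinearMap.id : H ⊗[k] H →ₗ[k] H ⊗[k] H) (Q.β ⊗ₜ[k] Q.β)
  have key := Q.apply_mul_nestA_inv (z := z) (Q.colInv_β.tmul_right Q.β).req
    (Q.colInv_β.tmul_left Q.β).req h
  have e1 : ∀ T P R, z (pairHom a b P * pairHom c d R * pairHom a (pairHom b (pairHom c d)) T) =
      P * Q.colTwo T * Q.flipS R := by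
    intro T P R
    induction T using tensor4_induction with
    | zero => simp
    | add x y hx hy => simp only [map_add, mul_add, add_mul, hx, hy]
    | pure x y u w =>
      induction P with
      | zero => simp
      | add x y hx hy => simp only [map_add, add_mul, hx, hy]
      | tmul p q =>
        induction R with
        | zero => simp
        | add x y hx hy => simp only [map_add, mul_add, add_mul, hx, hy]
        | tmul r s => simp [a, b, c, d, z, mul_assoc]
  have e2 : ∀ T, z (pairHom (Q.cp a b) (Q.cp c d) T *
      pairHom a (pairHom b (pairHom c d)) Q.B) = Q.evδ T := by
    intro T
    induction T with
    | zero => simp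
    | add x y hx hy => simp only [map_add, add_mul, hx, hy]
    | tmul p q => rw [pairHom_tmul, Q.cp_apply, Q.cp_apply, e1]; rfl
  rw [← e2, quad_B]
  refine key.trans ?_
  rw [← quad_B]
  have := e1 Q.B 1 1
  simp only [map_one, mul_one, flipS_one, one_mul] at this
  rw [δ_eq, ← this]

end QuasiHopfAlgebra
end

/-! ### The gauge element `f`: intertwining property and inverse -/

noncomputable section

namespace QuasiHopfAlgebra

variable {k : Type*} {H : Type*} [Field k] [Ring H] [Algebra k H] (Q : QuasiHopfAlgebra k H)

/-- `x ⊗ y ⊗ z ↦ (S ⊗ S)(Δᵒᵖ(x)) γ Δ(y β S(z))`. -/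
def evF : H ⊗[k] (H ⊗[k] H) →ₗ[k] H ⊗[k] H := LinearMap.mul' k (H ⊗[k] H) ∘ₗ
    (TensorProduct.map (LinearMap.mulRight k Q.γ ∘ₗ Q.SSop) (Q.Δ.toLinearMap ∘ₗ Q.evβ))

@[simp] theorem evF_tmul (x y z : H) : Q.evF (x ⊗ₜ[k] (y ⊗ₜ[k] z)) =
    Q.SSop x * Q.γ * Q.Δ (y * Q.β * Q.S z) := by
  simp [evF, evβ_tmul]

theorem f_eq : Q.f = Q.evF Q.phiInv := rfl

/-- `x ⊗ y ⊗ z ↦ Δ(S(x) α y) δ (S ⊗ S)(Δᵒᵖ(z))`. -/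
def evG : H ⊗[k] (H ⊗[k] H) →ₗ[k] H ⊗[k] H := LinearMap.mul' k (H ⊗[k] H) ∘ₗ
    (TensorProduct.map (LinearMap.mulRight k Q.δ ∘ₗ Q.Δ.toLinearMap ∘ₗ Q.evα) Q.SSop) ∘ₗ
      (TensorProduct.assoc k H H H).symm.toLinearMap

@[simp] theorem evG_tmul (x y z : H) : Q.evG (x ⊗ₜ[k] (y ⊗ₜ[k] z)) =
    Q.Δ (Q.S x * Q.α * y) * Q.δ * Q.SSop z := by
  simp [evG, evα_tmul]

theorem fInv_eq : Q.fInv = Q.evG Q.phiInv := rfl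

/-- With respect to `Δ` and `(S ⊗ S) ∘ Δᵒᵖ`, the element `γ` plays the part that `α` plays for `H`,
so the zigzag arguments can be repeated with `γ`. -/
theorem rowInv_evγ : Q.RowInv Q.evγ (onL H (legL k H)) (onR H (legL k H)) := by
  intro h t
  induction t with
  | zero => simp
  | add x y hx hy => simp only [map_add, smul_add, hx, hy]
  | tmul x y =>
    have : ∀ T, Q.evγ (pairHom (onL H (legL k H)) (onR H (legL k H)) T (x ⊗ₜ[k] y)) =
        Q.SSop x * Q.evγ T * Q.Δ y := by
      intro T
      induction T with
      | zero => simp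
      | add x y hx hy => simp only [map_add, mul_add, add_mul, LinearMap.add_apply, hx, hy]
      | tmul p q => simp [mul_assoc]
    rw [this, evγ_Δ, evγ_tmul]
    simp

/-- `f Δ(S(h)) = (S ⊗ S)(Δᵒᵖ(h)) f`. -/
theorem f_mul_Δ_S (h : H) : Q.f * Q.Δ (Q.S h) = Q.SSop h * Q.f := by
  let a := onL H (legL k H)
  let b := onR H (legL k H)
  let c := onR H Q.legS
  let z := matCoeff Q.evγ (1 ⊗ₜ[k] Q.β)
  -- `f` is a bent strand, with `γ` as evaluation and `β` as coevaluation; `h` slides along it.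
  have key := Q.apply_ass_inv_mul (z := z) Q.rowInv_evγ.leq (Q.colInv_β.tmul_right 1).req h
  have e1 : ∀ T, z (pairHom a (pairHom b c) T * a h) = Q.SSop h * Q.evF T := by
    intro T
    induction T using tensor3_induction with
    | zero => simp
    | add x y hx hy => simp only [map_add, mul_add, add_mul, hx, hy]
    | pure x y w => simp [a, b, c, z, mul_assoc]
  have e2 : ∀ T, z (c h * pairHom a (pairHom b c) T) = Q.evF T * Q.Δ (Q.S h) := by
    intro T
    induction T using tensor3_induction with
    | zero => simp
    | add x y hx hy => simp only [map_add, mul_add, add_mul, hx, hy]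
    | pure x y w => simp [a, b, c, z, mul_assoc]
  rw [f_eq, ← e1, ← e2]
  exact key.symm

/-- `f Δ(α) = γ`. -/
theorem f_mul_Δ_α : Q.f * Q.Δ Q.α = Q.γ := by
  let φ : H ⊗[k] (H ⊗[k] H) →ₗ[k] H ⊗[k] H :=
    Q.evγ ∘ₗ TensorProduct.map LinearMap.id Q.mulα
  let a := onL (H ⊗[k] H) (legL k H)
  let b := onR H (onL H (legL k H))
  let c := onR H (onL H Q.legS)
  let d := onR H (onR H (legL k H))
  have hl : Q.RowInv φ a b := by
    intro h t
    have : ∀ T, φ (pairHom a b T t) = Q.evγ (pairHom (onL H (legL k H)) (onR H (legL k H)) T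
        (TensorProduct.map LinearMap.id Q.mulα t)) := by
      intro T
      induction T with
      | zero => simp
      | add x y hx hy => simp only [map_add, LinearMap.add_apply, hx, hy]
      | tmul p q =>
        induction t using tensor3_induction with
        | zero => simp
        | add x y hx hy => simp only [map_add, hx, hy]
        | pure x y w => simp [a, b, φ, mul_assoc]
    rw [this, Q.rowInv_evγ]
    rfl
  let z := matCoeff φ (1 ⊗ₜ[k] (Q.β ⊗ₜ[k] 1))
  -- Read from its other end, the bent strand with the extra evaluation `α` becomes `γ` followed by
  -- `Δ` of `∑ X¹ β S(X²) α X³ = 1`.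
  have key := Q.apply_ass_inv_eq (z := z) (a := a) (b := b) (c := c) (d := d) hl.leq
    ((Q.rowInv_mulα.map_right LinearMap.id).comp Q.evγ).leq
    ((Q.colInv_β.tmul_left 1).tmul_right 1).req
  have e1 : ∀ T, z (pairHom a (pairHom b c) T) = Q.evF T * Q.Δ Q.α := by
    intro T
    induction T using tensor3_induction with
    | zero => simp
    | add x y hx hy => simp only [map_add, add_mul, hx, hy]
    | pure x y w => simp [a, b, c, z, φ, mul_assoc]
  have e2 : ∀ T, z (pairHom b (pairHom c d) T) = Q.γ * Q.Δ (Q.zag T) := by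
    intro T
    induction T using tensor3_induction with
    | zero => simp
    | add x y hx hy => simp only [map_add, mul_add, hx, hy]
    | pure x y w => simp [b, c, d, z, φ, mul_assoc]
  have h2 := e2 Q.phi
  rw [zag_phi, map_one, mul_one] at h2
  rw [f_eq, ← e1, ← h2]
  exact key

theorem f_mul_Δ_S_α (x y : H) : Q.f * Q.Δ (Q.S x * Q.α * y) = Q.SSop x * Q.γ * Q.Δ y := by
  rw [map_mul, map_mul, ← mul_assoc, ← mul_assoc, f_mul_Δ_S, mul_assoc _ Q.f, f_mul_Δ_α]

/-- The right action `y · h = y (S ⊗ S)(Δᵒᵖ(h))`. -/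
def legSS : H →ₐ[k] Module.End k (H ⊗[k] H) := AlgHom.ofLinearMap
  (LinearMap.mk₂ k (fun x y => y * Q.SSop x) (by simp [mul_add]) (by simp) (by simp [add_mul])
    (by simp)) (by ext; simp) (by intro x y; ext; simp [mul_assoc])

@[simp] theorem legSS_apply (x : H) (y : H ⊗[k] H) : Q.legSS x y = y * Q.SSop x := rfl

instance : CommHom ((legL k (H ⊗[k] H)).comp Q.Δ) Q.legSS where
  comm x y := by
    apply LinearMap.ext
    intro t
    simp [mul_assoc]

theorem colInv_δ : Q.ColInv Q.δ ((legL k (H ⊗[k] H)).comp Q.Δ) Q.legSS := by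
  intro h
  have : ∀ T, pairHom ((legL k (H ⊗[k] H)).comp Q.Δ) Q.legSS T Q.δ = Q.evδ T := by
    intro T
    induction T with
    | zero => simp
    | add x y hx hy => simp only [map_add, LinearMap.add_apply, hx, hy]
    | tmul p q => simp [mul_assoc]
  rw [this, evδ_Δ]

/-- `Δ(β) f⁻¹ = δ`. -/
theorem Δ_β_mul_fInv : Q.Δ Q.β * Q.fInv = Q.δ := by
  let φ : H ⊗[k] (H ⊗[k] H) →ₗ[k] H ⊗[k] H := LinearMap.mul' k (H ⊗[k] H) ∘ₗ
    TensorProduct.map (Q.Δ.toLinearMap ∘ₗ LinearMap.mulRight k Q.α) LinearMap.id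
  let a := onL (H ⊗[k] H) (legL k H)
  let b := onL (H ⊗[k] H) Q.legS
  let c := onR H ((legL k (H ⊗[k] H)).comp Q.Δ)
  let d := onR H Q.legSS
  have hφ : ∀ x u, φ (x ⊗ₜ[k] u) = Q.Δ (x * Q.α) * u := fun x u => by simp [φ]
  have hl : Q.RowInv φ b c := by
    intro h t
    induction t with
    | zero => simp
    | add x y hx hy => simp only [map_add, smul_add, hx, hy]
    | tmul x u =>
      have : ∀ T, φ (pairHom b c T (x ⊗ₜ[k] u)) = Q.Δ (x * Q.evα T) * u := by
        intro T
        induction T with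
        | zero => simp
        | add x y hx hy => simp only [map_add, mul_add, add_mul, LinearMap.add_apply, hx, hy]
        | tmul p q => simp [b, c, hφ, evα_tmul, mul_assoc]
      rw [this, evα_Δ, hφ]
      simp
  let z := matCoeff φ (Q.β ⊗ₜ[k] Q.δ)
  -- The mirror image: two coevaluations `β`, `δ` joined by one evaluation `α`.
  have key := Q.apply_ass_eq (z := z) (a := a) (b := b) (c := c) (d := d)
    (Q.colInv_β.tmul_left _).req (Q.colInv_δ.tmul_right _).req hl.leq
  have e1 : ∀ T, z (pairHom a (pairHom b c) T) = Q.Δ (Q.zag T) * Q.δ := by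
    intro T
    induction T using tensor3_induction with
    | zero => simp
    | add x y hx hy => simp only [map_add, add_mul, hx, hy]
    | pure x y w => simp [a, b, c, z, hφ, mul_assoc]
  have e2 : ∀ T, z (pairHom b (pairHom c d) T) = Q.Δ Q.β * Q.evG T := by
    intro T
    induction T using tensor3_induction with
    | zero => simp
    | add x y hx hy => simp only [map_add, mul_add, hx, hy]
    | pure x y w => simp [b, c, d, z, hφ, mul_assoc]
  have h1 := e1 Q.phi
  rw [zag_phi, map_one, one_mul] at h1
  rw [fInv_eq, ← e2, ← h1]
  exact key.symm

/-- `x ⊗ y ⊗ z ↦ (S ⊗ S)(Δᵒᵖ(x)) γ Δ(y) δ (S ⊗ S)(Δᵒᵖ(z))`. -/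
def zagInvΔ : H ⊗[k] (H ⊗[k] H) →ₗ[k] H ⊗[k] H :=
  LinearMap.mul' k (H ⊗[k] H) ∘ₗ TensorProduct.map (LinearMap.mulRight k Q.γ ∘ₗ Q.SSop) Q.evδ

@[simp] theorem zagInvΔ_tmul (x y z : H) : Q.zagInvΔ (x ⊗ₜ[k] (y ⊗ₜ[k] z)) =
    Q.SSop x * Q.γ * (Q.Δ y * Q.δ * Q.SSop z) := by
  simp [zagInvΔ]

/-- Unfolding `γ` and `δ` gives two nested zigzags; separated, each of them is `∑ S(x¹) α x² β S(x³)
= 1`. -/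
theorem zagInvΔ_phiInv : Q.zagInvΔ Q.phiInv = 1 := by
  let φ : (H ⊗[k] H) ⊗[k] (H ⊗[k] H) →ₗ[k] H ⊗[k] H := TensorProduct.map Q.evα Q.evα
  let b := onL (H ⊗[k] H) (onL H (legL k H))
  let c := onL (H ⊗[k] H) (onR H (legL k H))
  let g := onL (H ⊗[k] H) (onR H Q.legS)
  let a := onR (H ⊗[k] H) (onL H (legL k H))
  let d := onR (H ⊗[k] H) (onR H (legL k H))
  let e := onR (H ⊗[k] H) (onR H Q.legS)
  let z := matCoeff φ ((1 ⊗ₜ[k] Q.β) ⊗ₜ[k] (1 ⊗ₜ[k] Q.β))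
  have key := Q.apply_zigzag_six (z := z) (a := a) (b := b) (c := c) (d := d) (e := e) g
    (Q.rowInv_evα.map_left Q.evα).leq (Q.rowInv_evα.map_right Q.evα).leq
    ((Q.colInv_β.tmul_right 1).tmul_right _).req ((Q.colInv_β.tmul_right 1).tmul_left _).req
  have e1 : ∀ T P R W T', z (pairHom a (pairHom b (pairHom c d)) T *
      (pairHom a b P * (pairHom c d R * pairHom e g W)) *
      pairHom c (pairHom d (pairHom e g)) T') =
      Q.flipS P * Q.rowTwo T * (R * Q.colTwo T' * Q.flipS W) := by
    intro T P R W T'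
    induction T using tensor4_induction with
    | zero => simp
    | add x y hx hy => simp only [map_add, mul_add, add_mul, hx, hy]
    | pure x y u w =>
      induction T' using tensor4_induction with
      | zero => simp
      | add x y hx hy => simp only [map_add, mul_add, add_mul, hx, hy]
      | pure x' y' u' w' =>
        induction P with
        | zero => simp
        | add x y hx hy => simp only [map_add, mul_add, add_mul, hx, hy]
        | tmul p q =>
          induction R with
          | zero => simp
          | add x y hx hy => simp only [map_add, mul_add, add_mul, hx, hy]
          | tmul r s =>
            induction W with
            | zero => simp
            | add x y hx hy => simp only [map_add, mul_add, add_mul, hx, hy]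
            | tmul m n => simp [a, b, c, d, e, g, z, φ, evα_tmul, Q.S_mul, mul_assoc]
  have e2 : ∀ T, z (pairHom a (pairHom b (pairHom c d)) Q.A *
      pairHom (Q.cp a b) (pairHom (Q.cp c d) (Q.cp e g)) T *
      pairHom c (pairHom d (pairHom e g)) Q.B) = Q.zagInvΔ T := by
    intro T
    induction T using tensor3_induction with
    | zero => simp
    | add x y hx hy => simp only [map_add, mul_add, add_mul, hx, hy]
    | pure p q r =>
      rw [pairHom_tmul, pairHom_tmul, Q.cp_apply, Q.cp_apply, Q.cp_apply, e1]
      simp only [zagInvΔ_tmul, SSop_apply, γ_eq, δ_eq]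
  have e3 : ∀ T T', z (pairHom a (pairHom d e) T * pairHom b (pairHom c g) T') =
      Q.zagInv T' ⊗ₜ[k] Q.zagInv T := by
    intro T T'
    induction T using tensor3_induction with
    | zero => simp
    | add x y hx hy => simp only [map_add, add_mul, TensorProduct.tmul_add, hx, hy]
    | pure p q r =>
      induction T' using tensor3_induction with
      | zero => simp
      | add x y hx hy => simp only [map_add, mul_add, TensorProduct.add_tmul, hx, hy]
      | pure x y w => simp [a, b, c, d, e, g, z, φ, evα_tmul, mul_assoc]
  have h2 := e2 Q.phiInv
  have h3 := e3 Q.phiInv Q.phiInv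
  rw [quad_A, quad_B] at h2
  rw [zagInv_phiInv] at h3
  rw [← h2, Algebra.TensorProduct.one_def, ← h3]
  exact key

/-- Moving `f` past `Δ(S(x) α y)` produces `(S ⊗ S)(Δᵒᵖ(x)) γ Δ(y)`, and the product turns into the
double zigzag. -/
theorem f_mul_fInv : Q.f * Q.fInv = 1 := by
  have : ∀ T, Q.f * Q.evG T = Q.zagInvΔ T := by
    intro T
    induction T using tensor3_induction with
    | zero => simp
    | add x y hx hy => simp only [map_add, mul_add, hx, hy]
    | pure p q r =>
      rw [evG_tmul, zagInvΔ_tmul, map_mul, map_mul, ← mul_assoc, ← mul_assoc, ← mul_assoc,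
        ← mul_assoc, f_mul_Δ_S, mul_assoc _ Q.f, f_mul_Δ_α]
      simp only [mul_assoc]
  rw [fInv_eq, this, zagInvΔ_phiInv]

/-- In a Noetherian ring a one-sided inverse is two-sided. -/
theorem fInv_mul_f [FiniteDimensional k H] : Q.fInv * Q.f = 1 := by
  have : IsNoetherianRing (H ⊗[k] H) := IsNoetherianRing.of_finite k _
  exact mul_eq_one_symm Q.f_mul_fInv

theorem Δ_β [FiniteDimensional k H] : Q.Δ Q.β = Q.δ * Q.f := by
  rw [← Δ_β_mul_fInv, mul_assoc, fInv_mul_f, mul_one]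

theorem Δ_S_mul_fInv [FiniteDimensional k H] (h : H) :
    Q.Δ (Q.S h) * Q.fInv = Q.fInv * Q.SSop h := by
  rw [← one_mul (Q.Δ (Q.S h) * Q.fInv), ← fInv_mul_f, mul_assoc, ← mul_assoc Q.f, f_mul_Δ_S,
    mul_assoc (Q.SSop h), f_mul_fInv, mul_one]

end QuasiHopfAlgebra
end

/-! ### The twisted cocycle identity for `f` -/

noncomputable section

section TripleLegs

variable (k : Type*) (H : Type*) [Field k] [Ring H] [Algebra k H]

/-- `x ↦ x ⊗ 1 ⊗ 1`. -/
def leg₁ : H →ₐ[k] H ⊗[k] (H ⊗[k] H) := Algebra.TensorProduct.includeLeft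

/-- `x ↦ 1 ⊗ x ⊗ 1`. -/
def leg₂ : H →ₐ[k] H ⊗[k] (H ⊗[k] H) :=
  Algebra.TensorProduct.includeRight.comp Algebra.TensorProduct.includeLeft

/-- `x ↦ 1 ⊗ 1 ⊗ x`. -/
def leg₃ : H →ₐ[k] H ⊗[k] (H ⊗[k] H) :=
  Algebra.TensorProduct.includeRight.comp Algebra.TensorProduct.includeRight

variable {k H}

@[simp] theorem leg₁_apply (x : H) : leg₁ k H x = x ⊗ₜ[k] (1 ⊗ₜ[k] 1) := rfl
@[simp] theorem leg₂_apply (x : H) : leg₂ k H x = 1 ⊗ₜ[k] (x ⊗ₜ[k] 1) := rfl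
@[simp] theorem leg₃_apply (x : H) : leg₃ k H x = 1 ⊗ₜ[k] (1 ⊗ₜ[k] x) := rfl

instance : CommHom (leg₁ k H) (leg₂ k H) := ⟨fun x y => by simp [commute_iff_eq]⟩
instance : CommHom (leg₁ k H) (leg₃ k H) := ⟨fun x y => by simp [commute_iff_eq]⟩
instance : CommHom (leg₂ k H) (leg₃ k H) := ⟨fun x y => by simp [commute_iff_eq]⟩

theorem triple_legs (t : H ⊗[k] (H ⊗[k] H)) :
    pairHom (leg₁ k H) (pairHom (leg₂ k H) (leg₃ k H)) t = t := by
  induction t using tensor3_induction with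
  | zero => simp
  | add x y hx hy => simp only [map_add, hx, hy]
  | pure x y z => simp

theorem pair_leg₂₃ (t : H ⊗[k] H) : pairHom (leg₂ k H) (leg₃ k H) t = 1 ⊗ₜ[k] t := by
  induction t with
  | zero => simp
  | add x y hx hy => simp only [map_add, TensorProduct.tmul_add, hx, hy]
  | tmul x y => simp

end TripleLegs

namespace QuasiHopfAlgebra

variable {k : Type*} {H : Type*} [Field k] [Ring H] [Algebra k H] (Q : QuasiHopfAlgebra k H)

/-- `Δ ⊗ id` with values in `H ⊗ H ⊗ H`. -/
def Δid : H ⊗[k] H →ₐ[k] H ⊗[k] (H ⊗[k] H) :=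
  pairHom (Q.cp (leg₁ k H) (leg₂ k H)) (leg₃ k H)

/-- `id ⊗ Δ`. -/
def idΔ : H ⊗[k] H →ₐ[k] H ⊗[k] (H ⊗[k] H) :=
  pairHom (leg₁ k H) (Q.cp (leg₂ k H) (leg₃ k H))

variable (k H) in
/-- `t ↦ t ⊗ 1`. -/
def legs₁₂ : H ⊗[k] H →ₐ[k] H ⊗[k] (H ⊗[k] H) := pairHom (leg₁ k H) (leg₂ k H)

variable (k H) in
/-- `t ↦ 1 ⊗ t`. -/
def legs₂₃ : H ⊗[k] H →ₐ[k] H ⊗[k] (H ⊗[k] H) := pairHom (leg₂ k H) (leg₃ k H)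

theorem legs₁₂_tmul (x y : H) : legs₁₂ k H (x ⊗ₜ[k] y) = x ⊗ₜ[k] (y ⊗ₜ[k] 1) := by simp [legs₁₂]

theorem legs₂₃_apply (t : H ⊗[k] H) : legs₂₃ k H t = 1 ⊗ₜ[k] t := pair_leg₂₃ t

theorem Δid_tmul (x y : H) : Q.Δid (x ⊗ₜ[k] y) = legs₁₂ k H (Q.Δ x) * leg₃ k H y := by
  rw [Δid, pairHom_tmul]; rfl

theorem idΔ_tmul (x y : H) : Q.idΔ (x ⊗ₜ[k] y) = x ⊗ₜ[k] Q.Δ y := by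
  rw [idΔ, pairHom_tmul, Q.cp_apply, pair_leg₂₃, leg₁_apply,
    Algebra.TensorProduct.tmul_mul_tmul, mul_one, ← Algebra.TensorProduct.one_def, one_mul]

theorem Φ_mul_Δid_Δ (h : H) : Q.phi * Q.Δid (Q.Δ h) = Q.idΔ (Q.Δ h) * Q.phi := by
  have := Q.ass_intw (leg₁ k H) (leg₂ k H) (leg₃ k H) h
  rw [Q.coe_ass, triple_legs] at this
  exact this

theorem legs₁₂_leg₃_comm (t : H ⊗[k] H) (x : H) :
    Commute (legs₁₂ k H t) (leg₃ k H x) :=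
  CommHom.comm (a := pairHom (leg₁ k H) (leg₂ k H)) t x

/-- `x ⊗ y ⊗ z ↦ S(z) ⊗ S(y) ⊗ S(x)`. -/
def flipS₃ : H ⊗[k] (H ⊗[k] H) →ₗ[k] H ⊗[k] (H ⊗[k] H) :=
  (TensorProduct.assoc k H H H).toLinearMap ∘ₗ TensorProduct.map Q.flipS Q.S ∘ₗ
    (TensorProduct.comm k H (H ⊗[k] H)).toLinearMap

@[simp] theorem flipS₃_tmul (x y z : H) : Q.flipS₃ (x ⊗ₜ[k] (y ⊗ₜ[k] z)) =
    Q.S z ⊗ₜ[k] (Q.S y ⊗ₜ[k] Q.S x) := by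
  simp [flipS₃]

theorem flipS₃_mul (x y : H ⊗[k] (H ⊗[k] H)) : Q.flipS₃ (x * y) = Q.flipS₃ y * Q.flipS₃ x := by
  induction x using tensor3_induction with
  | zero => simp
  | add x x' hx hy => simp only [map_add, mul_add, add_mul, hx, hy]
  | pure p q r =>
    induction y using tensor3_induction with
    | zero => simp
    | add x x' hx hy => simp only [map_add, mul_add, add_mul, hx, hy]
    | pure a b c => simp [Q.S_mul]

theorem flipS₃_legs₁₂_mul (t : H ⊗[k] H) (x : H) :
    Q.flipS₃ (legs₁₂ k H t * leg₃ k H x) = Q.S x ⊗ₜ[k] Q.flipS t := by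
  induction t with
  | zero => simp
  | add x y hx hy => simp only [map_add, add_mul, TensorProduct.tmul_add, hx, hy]
  | tmul p q => simp [legs₁₂]

theorem flipS₃_tmul' (x : H) (t : H ⊗[k] H) :
    Q.flipS₃ (x ⊗ₜ[k] t) = legs₁₂ k H (Q.flipS t) * leg₃ k H (Q.S x) := by
  induction t with
  | zero => simp
  | add x y hx hy => simp only [map_add, add_mul, TensorProduct.tmul_add, hx, hy]
  | tmul p q => simp [legs₁₂]

theorem legs₂₃_f_mul_idΔ_flipS (t : H ⊗[k] H) :
    legs₂₃ k H Q.f * Q.idΔ (Q.flipS t) = Q.flipS₃ (Q.Δid t) * legs₂₃ k H Q.f := by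
  induction t with
  | zero => simp
  | add x y hx hy => simp only [map_add, add_mul, mul_add, hx, hy]
  | tmul p q =>
    rw [flipS_tmul, idΔ_tmul, Δid_tmul, flipS₃_legs₁₂_mul, legs₂₃_apply,
      Algebra.TensorProduct.tmul_mul_tmul, Algebra.TensorProduct.tmul_mul_tmul, f_mul_Δ_S,
      one_mul, mul_one, SSop_apply]

theorem legs₁₂_f_mul_Δid_flipS (t : H ⊗[k] H) :
    legs₁₂ k H Q.f * Q.Δid (Q.flipS t) = Q.flipS₃ (Q.idΔ t) * legs₁₂ k H Q.f := by
  induction t with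
  | zero => simp
  | add x y hx hy => simp only [map_add, add_mul, mul_add, hx, hy]
  | tmul p q =>
    rw [flipS_tmul, idΔ_tmul, Δid_tmul, flipS₃_tmul', ← mul_assoc, ← map_mul, f_mul_Δ_S,
      mul_assoc, ← (legs₁₂_leg₃_comm Q.f (Q.S p)).eq, ← mul_assoc, ← map_mul, SSop_apply]

/-- The cocycle identity after multiplication by the iterated coproduct of `α`. Since `f Δ(S(x) α y)
= (S ⊗ S)(Δᵒᵖ(x)) γ Δ(y)`, both sides are threefold nested evaluations, grouped from the outside on
the left and from the inside on the right. -/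
theorem row_cocycle : legs₂₃ k H Q.f * Q.idΔ Q.γ * Q.phi =
    Q.flipS₃ Q.phi * (legs₁₂ k H Q.f * Q.Δid Q.γ) := by
  let φ : (H ⊗[k] H) ⊗[k] ((H ⊗[k] H) ⊗[k] (H ⊗[k] H)) →ₗ[k] H ⊗[k] (H ⊗[k] H) :=
    TensorProduct.map Q.evα (TensorProduct.map Q.evα Q.evα)
  let V := H ⊗[k] H
  let c := onL (V ⊗[k] V) (onL H (legL k H))
  let d := onL (V ⊗[k] V) (onR H (legL k H))
  let b := onR V (onL V (onL H (legL k H)))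
  let e := onR V (onL V (onR H (legL k H)))
  let a := onR V (onR V (onL H (legL k H)))
  let g := onR V (onR V (onR H (legL k H)))
  let z := matCoeff φ ((1 ⊗ₜ[k] 1) ⊗ₜ[k] ((1 ⊗ₜ[k] 1) ⊗ₜ[k] (1 ⊗ₜ[k] 1)))
  have key := Q.apply_row_six (z := z) (a := a) (b := b) (c := c) (d := d) (e := e) g
    (Q.rowInv_evα.map_left _).leq
  have e1 : ∀ T P q r R T', z (pairHom a (pairHom b (pairHom e g)) T *
      (pairHom a b P * (c q * (d r * pairHom e g R))) * pairHom d (pairHom e g) T') =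
      ((Q.S q * Q.α * r) ⊗ₜ[k] (Q.flipS P * Q.rowTwo T * R)) * T' := by
    intro T P q r R T'
    induction T using tensor4_induction with
    | zero => simp
    | add x y hx hy => simp only [map_add, mul_add, add_mul, TensorProduct.tmul_add, hx, hy]
    | pure x y u w =>
      induction T' using tensor3_induction with
      | zero => simp
      | add x y hx hy => simp only [map_add, mul_add, hx, hy]
      | pure x' y' u' =>
        induction P with
        | zero => simp
        | add x y hx hy => simp only [map_add, mul_add, add_mul, TensorProduct.tmul_add, hx, hy]
        | tmul p s =>
          induction R with
          | zero => simp
          | add x y hx hy => simp only [map_add, mul_add, add_mul, TensorProduct.tmul_add, hx, hy]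
          | tmul m n => simp [a, b, c, d, e, g, z, φ, evα_tmul, Q.S_mul, mul_assoc]
  have e1' : ∀ T, z (pairHom a (pairHom b (pairHom e g)) Q.A *
      pairHom (Q.cp a b) (pairHom c (pairHom d (Q.cp e g))) T * pairHom d (pairHom e g) Q.phi) =
      legs₂₃ k H Q.f * Q.idΔ (Q.rowTwo T) * Q.phi := by
    intro T
    induction T using tensor4_induction with
    | zero => simp
    | add x y hx hy => simp only [map_add, mul_add, add_mul, hx, hy]
    | pure x y u w =>
      rw [pairHom_tmul, pairHom_tmul, pairHom_tmul, Q.cp_apply, Q.cp_apply, e1, rowTwo_tmul,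
        idΔ_tmul, legs₂₃_apply, Algebra.TensorProduct.tmul_mul_tmul, f_mul_Δ_S_α, one_mul]
      rfl
  have e2 : ∀ T x P R y T', z (pairHom b (pairHom c (pairHom d e)) T *
      (a x * (pairHom b c P * (pairHom d e R * g y))) * pairHom a (pairHom b c) T') =
      Q.flipS₃ T' * (legs₁₂ k H (Q.flipS P * Q.rowTwo T * R) * leg₃ k H (Q.S x * Q.α * y)) := by
    intro T q P R r T'
    induction T using tensor4_induction with
    | zero => simp
    | add x y hx hy => simp only [map_add, mul_add, add_mul, hx, hy]
    | pure x y u w =>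
      induction T' using tensor3_induction with
      | zero => simp
      | add x y hx hy => simp only [map_add, mul_add, add_mul, hx, hy]
      | pure x' y' u' =>
        induction P with
        | zero => simp
        | add x y hx hy => simp only [map_add, mul_add, add_mul, hx, hy]
        | tmul p s =>
          induction R with
          | zero => simp
          | add x y hx hy => simp only [map_add, mul_add, add_mul, hx, hy]
          | tmul m n =>
            simp [a, b, c, d, e, g, z, φ, evα_tmul, legs₁₂_tmul, Q.S_mul, mul_assoc]
  have e2' : ∀ T, z (pairHom b (pairHom c (pairHom d e)) Q.A *
      pairHom a (pairHom (Q.cp b c) (pairHom (Q.cp d e) g)) T * pairHom a (pairHom b c) Q.phi) =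
      Q.flipS₃ Q.phi * (legs₁₂ k H Q.f * Q.Δid (Q.rowTwo T)) := by
    intro T
    induction T using tensor4_induction with
    | zero => simp
    | add x y hx hy => simp only [map_add, mul_add, add_mul, hx, hy]
    | pure x y u w =>
      rw [pairHom_tmul, pairHom_tmul, pairHom_tmul, Q.cp_apply, Q.cp_apply, e2, rowTwo_tmul,
        Δid_tmul, ← mul_assoc (legs₁₂ k H Q.f), ← map_mul, f_mul_Δ_S_α]
      rfl
  have h1 := e1' Q.A
  have h2 := e2' Q.A
  rw [quad_A, quad_A] at h1 h2
  rw [γ_eq, ← h1, ← h2]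
  exact key

/-- `(1 ⊗ f)(id ⊗ Δ)(f) Φ = (S ⊗ S ⊗ S)(Φ³²¹) (f ⊗ 1)(Δ ⊗ id)(f)`. -/
theorem f_cocycle : legs₂₃ k H Q.f * Q.idΔ Q.f * Q.phi =
    Q.flipS₃ Q.phi * (legs₁₂ k H Q.f * Q.Δid Q.f) := by
  set F₁ := legs₂₃ k H Q.f * Q.idΔ Q.f * Q.phi with hF₁
  set F₂ := Q.flipS₃ Q.phi * (legs₁₂ k H Q.f * Q.Δid Q.f) with hF₂
  -- Both candidates intertwine the same two actions of `h`, by `f Δ(S h) = (S ⊗ S)(Δᵒᵖ h) f` used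
  -- twice.
  have i1 : ∀ h, F₁ * Q.Δid (Q.Δ (Q.S h)) = Q.flipS₃ (Q.Δid (Q.Δ h)) * F₁ := by
    intro h
    rw [hF₁, mul_assoc, Φ_mul_Δid_Δ, ← mul_assoc, mul_assoc (legs₂₃ k H Q.f), ← map_mul,
      f_mul_Δ_S, map_mul, ← mul_assoc, SSop_apply, legs₂₃_f_mul_idΔ_flipS]
    simp only [mul_assoc]
  have i2 : ∀ h, F₂ * Q.Δid (Q.Δ (Q.S h)) = Q.flipS₃ (Q.Δid (Q.Δ h)) * F₂ := by
    intro h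
    rw [hF₂, mul_assoc, mul_assoc (legs₁₂ k H Q.f), ← map_mul, f_mul_Δ_S, map_mul,
      ← mul_assoc (legs₁₂ k H Q.f), SSop_apply, legs₁₂_f_mul_Δid_flipS, ← mul_assoc, ← mul_assoc,
      ← flipS₃_mul, ← Φ_mul_Δid_Δ, flipS₃_mul]
    simp only [mul_assoc]
  have hα : F₁ * Q.Δid (Q.Δ Q.α) = F₂ * Q.Δid (Q.Δ Q.α) := by
    rw [hF₁, hF₂, mul_assoc, Φ_mul_Δid_Δ, ← mul_assoc, mul_assoc (legs₂₃ k H Q.f), ← map_mul,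
      f_mul_Δ_α, row_cocycle, mul_assoc (Q.flipS₃ Q.phi), mul_assoc (legs₁₂ k H Q.f), ← map_mul,
      f_mul_Δ_α]
  -- Agreement on `α` together with the common intertwining rule gives agreement on every `S(x) α y
  -- β S(z)`, hence on their sum over `Φ⁻¹`, which is `1`.
  have hT : ∀ T, F₁ * Q.Δid (Q.Δ (Q.zagInv T)) = F₂ * Q.Δid (Q.Δ (Q.zagInv T)) := by
    intro T
    induction T using tensor3_induction with
    | zero => simp
    | add x y hx hy => simp only [map_add, mul_add, hx, hy]
    | pure x y w =>
      simp only [zagInv_tmul, map_mul, ← mul_assoc, i1, i2]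
      rw [mul_assoc _ F₁, hα, ← mul_assoc]
  simpa [zagInv_phiInv] using hT Q.phiInv

end QuasiHopfAlgebra
end

/-! ### Comultiplication of `p_R`, `q_R`, `U` and `V` -/

noncomputable section

namespace QuasiHopfAlgebra

section

variable {k : Type*} {H B : Type*} [Field k] [Ring H] [Algebra k H] [Semiring B] [Algebra k B]
  (Q : QuasiHopfAlgebra k H) (a b c : H →ₐ[k] B) [CommHom a b] [CommHom a c] [CommHom b c]

theorem triple_legs₁₂ (t : H ⊗[k] H) :
    pairHom a (pairHom b c) (legs₁₂ k H t) = pairHom a b t := by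
  induction t with
  | zero => simp
  | add x y hx hy => simp only [map_add, hx, hy]
  | tmul x y => simp [legs₁₂_tmul]

theorem triple_Δid (t : H ⊗[k] H) :
    pairHom a (pairHom b c) (Q.Δid t) = pairHom (Q.cp a b) c t := by
  induction t with
  | zero => simp
  | add x y hx hy => simp only [map_add, hx, hy]
  | tmul x y => rw [Δid_tmul, map_mul, triple_legs₁₂]; simp [Q.cp_apply]

theorem triple_idΔ (t : H ⊗[k] H) :
    pairHom a (pairHom b c) (Q.idΔ t) = pairHom a (Q.cp b c) t := by
  induction t with
  | zero => simp
  | add x y hx hy => simp only [map_add, hx, hy]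
  | tmul x y => rw [idΔ_tmul]; simp [Q.cp_apply]

end

variable {k : Type*} {H : Type*} [Field k] [Ring H] [Algebra k H] (Q : QuasiHopfAlgebra k H)

theorem flipS₃_legs₂₃ (t : H ⊗[k] H) : Q.flipS₃ (legs₂₃ k H t) = legs₁₂ k H (Q.flipS t) := by
  rw [legs₂₃_apply, flipS₃_tmul', Q.S_one, map_one, mul_one]

theorem flipS₃_legs₁₂ (t : H ⊗[k] H) : Q.flipS₃ (legs₁₂ k H t) = legs₂₃ k H (Q.flipS t) := by
  have := Q.flipS₃_legs₁₂_mul t 1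
  rwa [map_one, mul_one, Q.S_one, ← legs₂₃_apply] at this

/-- `a ⊗ t ↦ (Δ ⊗ id)(Δ(a) p_R) (p_R ⊗ 1) (1 ⊗ S²¹(t))`. -/
def pCol : H ⊗[k] (H ⊗[k] H) →ₗ[k] H ⊗[k] (H ⊗[k] H) :=
  LinearMap.mul' k _ ∘ₗ TensorProduct.map
    (LinearMap.mulRight k (legs₁₂ k H Q.pR) ∘ₗ Q.Δid.toLinearMap ∘ₗ
      LinearMap.mulRight k Q.pR ∘ₗ Q.Δ.toLinearMap)
    ((legs₂₃ k H).toLinearMap ∘ₗ Q.flipS)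

@[simp] theorem pCol_tmul (a : H) (t : H ⊗[k] H) : Q.pCol (a ⊗ₜ[k] t) =
    Q.Δid (Q.Δ a * Q.pR) * legs₁₂ k H Q.pR * legs₂₃ k H (Q.flipS t) := by
  simp [pCol]

/-- Two nested coevaluations: inserted one after the other they give two copies of `p_R`, inserted
jointly they give `δ`. -/
theorem phi_mul_pCol_phi : Q.phi * Q.pCol Q.phi = Q.evδ.lTensor H Q.phiInv := by
  let a := onL (H ⊗[k] H) (legL k H)
  let b := onR H (onL H (legL k H))
  let e := onR H (onL H Q.legS)
  let c := onR H (onR H (legL k H))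
  let d := onR H (onR H Q.legS)
  let z := matCoeff (LinearMap.id : H ⊗[k] (H ⊗[k] H) →ₗ[k] _) (1 ⊗ₜ[k] (Q.β ⊗ₜ[k] Q.β))
  have key := Q.apply_column_five (z := z) (a := a) (b := b) (c := c) (d := d) (e := e)
    ((Q.colInv_β.tmul_right _).tmul_right _).req
  have e1 : ∀ T G y w P n o T', z (pairHom a (pairHom b c) T *
      (pairHom a (pairHom b c) G * (d y * e w)) *
      (pairHom a b P * (c n * d o)) * pairHom a (pairHom b e) T') =
      T * (G * (legs₁₂ k H P * leg₃ k H (n * Q.β * Q.S o)) *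
        legs₁₂ k H (Q.evβ.lTensor H T') * legs₂₃ k H (Q.flipS (y ⊗ₜ[k] w))) := by
    intro T G y w P n o T'
    induction T using tensor3_induction with
    | zero => simp
    | add x y hx hy => simp only [map_add, add_mul, hx, hy]
    | pure x₁ x₂ x₃ =>
      induction G using tensor3_induction with
      | zero => simp
      | add x y hx hy => simp only [map_add, mul_add, add_mul, hx, hy]
      | pure y₁ y₂ y₃ =>
        induction P with
        | zero => simp
        | add x y hx hy => simp only [map_add, mul_add, add_mul, hx, hy]
        | tmul p q =>
          induction T' using tensor3_induction with
          | zero => simp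
          | add x y hx hy => simp only [map_add, mul_add, add_mul, hx, hy]
          | pure z₁ z₂ z₃ =>
            simp [a, b, c, d, e, z, legs₁₂_tmul, legs₂₃_apply, evβ_tmul, mul_assoc]
  have e1' : ∀ T, z (pairHom a (pairHom b c) Q.phi *
      pairHom (Q.cp (Q.cp a b) c) (pairHom d e) T *
      pairHom (Q.cp a b) (pairHom c d) Q.phiInv * pairHom a (pairHom b e) Q.phiInv) =
      Q.phi * Q.pCol T := by
    intro T
    induction T using tensor3_induction with
    | zero => simp
    | add x y hx hy => simp only [map_add, mul_add, add_mul, hx, hy]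
    | pure x y w =>
      have : ∀ T', z (pairHom a (pairHom b c) Q.phi *
          pairHom (Q.cp (Q.cp a b) c) (pairHom d e) (x ⊗ₜ[k] (y ⊗ₜ[k] w)) *
          pairHom (Q.cp a b) (pairHom c d) T' * pairHom a (pairHom b e) Q.phiInv) =
          Q.phi * (Q.Δid (Q.Δ x * Q.evβ.lTensor H T') * legs₁₂ k H Q.pR *
            legs₂₃ k H (Q.flipS (y ⊗ₜ[k] w))) := by
        intro T'
        induction T' using tensor3_induction with
        | zero => simp
        | add x y hx hy => simp only [map_add, mul_add, add_mul, hx, hy]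
        | pure x' y' w' =>
          rw [pairHom_tmul, pairHom_tmul, pairHom_tmul, pairHom_tmul, Q.cp_apply _ c,
            ← triple_Δid, Q.cp_apply, e1, LinearMap.lTensor_tmul, evβ_tmul, map_mul Q.Δid,
            Δid_tmul]
          rfl
      exact this Q.phiInv
  have e2 : ∀ x P R T, z (a x * (pairHom b c P * pairHom d e R) *
      pairHom b (pairHom c (pairHom d e)) T) = x ⊗ₜ[k] (P * Q.colTwo T * Q.flipS R) := by
    intro x P R T
    induction T using tensor4_induction with
    | zero => simp
    | add x y hx hy => simp only [map_add, mul_add, add_mul, TensorProduct.tmul_add, hx, hy]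
    | pure x y u w =>
      induction P with
      | zero => simp
      | add x y hx hy => simp only [map_add, mul_add, add_mul, TensorProduct.tmul_add, hx, hy]
      | tmul p q =>
        induction R with
        | zero => simp
        | add x y hx hy => simp only [map_add, mul_add, add_mul, TensorProduct.tmul_add, hx, hy]
        | tmul m n => simp [a, b, c, d, e, z, mul_assoc]
  have e2' : ∀ T, z (pairHom a (pairHom (Q.cp b c) (Q.cp d e)) T *
      pairHom b (pairHom c (pairHom d e)) Q.B) = Q.evδ.lTensor H T := by
    intro T
    induction T using tensor3_induction with
    | zero => simp
    | add x y hx hy => simp only [map_add, add_mul, hx, hy]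
    | pure x y w =>
      rw [pairHom_tmul, pairHom_tmul, Q.cp_apply, Q.cp_apply, e2]
      rfl
  have h1 := e1' Q.phi
  have h2 := e2' Q.phiInv
  rw [quad_B] at h2
  rw [← h1, ← h2]
  exact key

/-- `f⁻¹` passes `Δ(S(x³))` and then turns `Δ(β)` into `δ`. With `phi_mul_pCol_phi` this computes
`(id ⊗ Δ)(p_R)(1 ⊗ f⁻¹)`. -/
theorem idΔ_pR_mul_fInv [FiniteDimensional k H] :
    Q.idΔ Q.pR * legs₂₃ k H Q.fInv = Q.evδ.lTensor H Q.phiInv := by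
  have : ∀ T, Q.idΔ (Q.evβ.lTensor H T) * legs₂₃ k H Q.fInv = Q.evδ.lTensor H T := by
    intro T
    induction T using tensor3_induction with
    | zero => simp
    | add x y hx hy => simp only [map_add, add_mul, hx, hy]
    | pure x y w =>
      rw [LinearMap.lTensor_tmul, LinearMap.lTensor_tmul, idΔ_tmul, legs₂₃_apply,
        Algebra.TensorProduct.tmul_mul_tmul, mul_one, evβ_tmul, evδ_tmul, map_mul, map_mul,
        mul_assoc, Δ_S_mul_fInv, ← mul_assoc, mul_assoc (Q.Δ y), Δ_β_mul_fInv]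
  exact this Q.phiInv

section BijectiveAntipode

variable (hS : Function.Bijective Q.S)

theorem flipS_V : Q.flipS (Q.V hS) = Q.f * Q.pR := by
  have : ∀ t, Q.flipS (TensorProduct.map (Q.Sinv hS) (Q.Sinv hS)
      (TensorProduct.comm k H H t)) = t := by
    intro t
    induction t with
    | zero => simp
    | add x y hx hy => simp only [map_add, hx, hy]
    | tmul x y => simp [S_Sinv]
  exact this _

theorem U_eq : Q.U hS = Q.fInv * Q.flipS (Q.qR hS) := rfl

theorem SSop_Sinv (h : H) : Q.SSop (Q.Sinv hS h) * Q.f = Q.f * Q.Δ h := by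
  rw [← f_mul_Δ_S, S_Sinv]

theorem flipS_injective (hS : Function.Bijective Q.S) : Function.Injective Q.flipS := by
  have : Function.LeftInverse ((TensorProduct.comm k H H).symm.toLinearMap ∘ₗ
      TensorProduct.map (Q.Sinv hS) (Q.Sinv hS)) Q.flipS := by
    intro t
    induction t with
    | zero => simp
    | add x y hx hy => rw [map_add, map_add, hx, hy]
    | tmul x y => simp [Sinv_S]
  exact this.injective

theorem flipS₃_injective (hS : Function.Bijective Q.S) : Function.Injective Q.flipS₃ := by
  have h : ∀ t, TensorProduct.map (Q.Sinv hS) (TensorProduct.map (Q.Sinv hS) (Q.Sinv hS))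
      ((TensorProduct.map LinearMap.id (TensorProduct.comm k H H).toLinearMap ∘ₗ
        (TensorProduct.comm k (H ⊗[k] H) H).toLinearMap ∘ₗ
          (TensorProduct.assoc k H H H).symm.toLinearMap) (Q.flipS₃ t)) = t := by
    intro t
    induction t using tensor3_induction with
    | zero => simp
    | add x y hx hy => rw [map_add, map_add, map_add, hx, hy]
    | pure x y w => simp [Sinv_S]
  exact fun x y e => by rw [← h x, e, h y]

/-- `a ⊗ t ↦ (t ⊗ 1) (1 ⊗ V) (id ⊗ Δ)(V Δ(S⁻¹(a)))`. -/
def VCol : H ⊗[k] (H ⊗[k] H) →ₗ[k] H ⊗[k] (H ⊗[k] H) :=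
  LinearMap.mul' k _ ∘ₗ (TensorProduct.comm k _ _).toLinearMap ∘ₗ TensorProduct.map
    (LinearMap.mulLeft k (legs₂₃ k H (Q.V hS)) ∘ₗ Q.idΔ.toLinearMap ∘ₗ
      LinearMap.mulLeft k (Q.V hS) ∘ₗ Q.Δ.toLinearMap ∘ₗ Q.Sinv hS)
    (legs₁₂ k H).toLinearMap

@[simp] theorem VCol_tmul (a : H) (t : H ⊗[k] H) : Q.VCol hS (a ⊗ₜ[k] t) =
    legs₁₂ k H t * (legs₂₃ k H (Q.V hS) * Q.idΔ (Q.V hS * Q.Δ (Q.Sinv hS a))) := by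
  simp [VCol]

/-- `a ⊗ t ↦ (Δ ⊗ id)(Δ(S(a)) U) (t ⊗ 1)`. -/
def UCol : H ⊗[k] (H ⊗[k] H) →ₗ[k] H ⊗[k] (H ⊗[k] H) :=
  LinearMap.mul' k _ ∘ₗ TensorProduct.map
    (Q.Δid.toLinearMap ∘ₗ LinearMap.mulRight k (Q.U hS) ∘ₗ Q.Δ.toLinearMap ∘ₗ Q.S)
    (legs₁₂ k H).toLinearMap

@[simp] theorem UCol_tmul (a : H) (t : H ⊗[k] H) : Q.UCol hS (a ⊗ₜ[k] t) =
    Q.Δid (Q.Δ (Q.S a) * Q.U hS) * legs₁₂ k H t := by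
  simp [UCol]

/-- Two nested evaluations: separately they give two copies of `q_R`, jointly they give `γ`.
Applying `flipS₃` throughout removes the inverse antipode from `q_R`. -/
theorem row_qR : Q.flipS₃ (legs₁₂ k H (Q.qR hS) * Q.Δid (Q.qR hS)) =
    Q.flipS₃ Q.phi * (LinearMap.mul' k _ ∘ₗ TensorProduct.map
      (Q.flipS₃ ∘ₗ Q.idΔ.toLinearMap ∘ₗ LinearMap.mulLeft k (Q.qR hS) ∘ₗ Q.Δ.toLinearMap)
      ((legs₁₂ k H).toLinearMap ∘ₗ LinearMap.mulLeft k Q.f)) Q.phi := by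
  let φ : (H ⊗[k] H) ⊗[k] ((H ⊗[k] H) ⊗[k] H) →ₗ[k] H ⊗[k] (H ⊗[k] H) :=
    TensorProduct.map Q.evα (TensorProduct.map Q.evα Q.S)
  let c := onL ((H ⊗[k] H) ⊗[k] H) (onL H (legL k H))
  let d := onL ((H ⊗[k] H) ⊗[k] H) (onR H (legL k H))
  let b := onR (H ⊗[k] H) (onL H (onL H (legL k H)))
  let e := onR (H ⊗[k] H) (onL H (onR H (legL k H)))
  let a := onR (H ⊗[k] H) (onR (H ⊗[k] H) (legL k H))
  let z := matCoeff φ ((1 ⊗ₜ[k] 1) ⊗ₜ[k] ((1 ⊗ₜ[k] 1) ⊗ₜ[k] 1))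
  have key := Q.apply_row_five (z := z) (a := a) (b := b) (c := c) (d := d) (e := e)
    (Q.rowInv_evα.map_left _).leq
  have e1 : ∀ W P y w, z (pairHom a (pairHom b e) W * (pairHom a b P * (c y * d w))) =
      (Q.S y * Q.α * w) ⊗ₜ[k] (Q.flipS P * Q.flipS ((Q.evq hS).lTensor H W)) := by
    intro W P y w
    induction W using tensor3_induction with
    | zero => simp
    | add x y hx hy => simp only [map_add, mul_add, add_mul, TensorProduct.tmul_add, hx, hy]
    | pure x₁ x₂ x₃ =>
      induction P with
      | zero => simp
      | add x y hx hy => simp only [map_add, mul_add, add_mul, TensorProduct.tmul_add, hx, hy]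
      | tmul p q =>
        simp [a, b, c, d, e, z, φ, evα_tmul, evq_tmul, S_Sinv, Q.S_mul, mul_assoc]
  have e1' : ∀ T, z (pairHom a (pairHom b e) Q.phi * pairHom (Q.cp a b) (pairHom c d) T) =
      Q.flipS₃ (legs₁₂ k H (Q.qR hS) * Q.Δid ((Q.evq hS).lTensor H T)) := by
    intro T
    induction T using tensor3_induction with
    | zero => simp
    | add x y hx hy => simp only [map_add, mul_add, hx, hy]
    | pure x y w =>
      rw [pairHom_tmul, pairHom_tmul, Q.cp_apply, e1, LinearMap.lTensor_tmul, evq_tmul, Δid_tmul,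
        flipS₃_mul, flipS₃_legs₁₂_mul, flipS₃_legs₁₂, legs₂₃_apply,
        Algebra.TensorProduct.tmul_mul_tmul, mul_one, Q.S_mul, S_Sinv, mul_assoc]
      rfl
  have e2 : ∀ T x P R G s t T', z (pairHom b (pairHom c (pairHom d e)) T *
      (a x * (pairHom b c P * pairHom d e R)) *
      (pairHom a (pairHom b c) G * (d s * e t)) * pairHom a (pairHom b c) T') =
      Q.flipS₃ T' * (Q.flipS₃ G * (leg₃ k H (Q.S x) * legs₁₂ k H (Q.flipS P * Q.rowTwo T * R) *
        legs₁₂ k H (s ⊗ₜ[k] t))) := by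
    intro T x P R G s t T'
    induction T using tensor4_induction with
    | zero => simp
    | add x y hx hy => simp only [map_add, mul_add, add_mul, hx, hy]
    | pure y₁ y₂ y₃ y₄ =>
      induction T' using tensor3_induction with
      | zero => simp
      | add x y hx hy => simp only [map_add, mul_add, add_mul, hx, hy]
      | pure x' y' u' =>
        induction P with
        | zero => simp
        | add x y hx hy => simp only [map_add, mul_add, add_mul, hx, hy]
        | tmul p q =>
          induction R with
          | zero => simp
          | add x y hx hy => simp only [map_add, mul_add, add_mul, hx, hy]
          | tmul m n =>
            induction G using tensor3_induction with
            | zero => simp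
            | add x y hx hy => simp only [map_add, mul_add, add_mul, hx, hy]
            | pure g₁ g₂ g₃ =>
              simp [a, b, c, d, e, z, φ, evα_tmul, legs₁₂_tmul, Q.S_mul, mul_assoc]
  have e2' : ∀ Y T, z (pairHom b (pairHom c (pairHom d e)) Q.A *
      pairHom a (pairHom (Q.cp b c) (Q.cp d e)) Y * pairHom (Q.cp a (Q.cp b c)) (pairHom d e) T *
      pairHom a (pairHom b c) Q.phi) =
      Q.flipS₃ Q.phi * (LinearMap.mul' k _ ∘ₗ TensorProduct.map
      (Q.flipS₃ ∘ₗ Q.idΔ.toLinearMap ∘ₗ LinearMap.mulLeft k ((Q.evq hS).lTensor H Y) ∘ₗ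
        Q.Δ.toLinearMap) ((legs₁₂ k H).toLinearMap ∘ₗ LinearMap.mulLeft k Q.f)) T := by
    intro Y T
    induction T using tensor3_induction with
    | zero => simp
    | add x y hx hy => simp only [map_add, mul_add, add_mul, hx, hy]
    | pure x s t =>
      induction Y using tensor3_induction with
      | zero => simp
      | add x y hx hy =>
        simp only [map_add, mul_add, add_mul, hx, hy, LinearMap.comp_apply,
          TensorProduct.map_tmul, LinearMap.mulLeft_apply, LinearMap.mul'_apply]
      | pure y₁ y₂ y₃ =>
        rw [pairHom_tmul, pairHom_tmul, pairHom_tmul, pairHom_tmul, Q.cp_apply a, Q.cp_apply b,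
          Q.cp_apply d, ← triple_idΔ, e2]
        -- The factor `f` in the map exists for this conversion: it turns the doubled coefficient
        -- `S⁻¹(α y₃) y₂` of `q_R` into a `γ`-evaluation.
        have hkey : Q.flipS (Q.Δ (Q.Sinv hS (Q.α * y₃) * y₂)) * Q.f =
            Q.flipS (Q.Δ y₂) * Q.rowTwo Q.A * Q.Δ y₃ := by
          rw [← SSop_apply, ← f_mul_Δ_S, Q.S_mul, S_Sinv, ← mul_assoc, f_mul_Δ_S_α, SSop_apply,
            γ_eq]
        simp only [LinearMap.comp_apply, TensorProduct.map_tmul, LinearMap.mulLeft_apply,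
          LinearMap.mul'_apply, LinearMap.lTensor_tmul, AlgHom.toLinearMap_apply]
        rw [map_mul Q.idΔ, flipS₃_mul, idΔ_tmul, flipS₃_tmul', evq_tmul, map_mul (legs₁₂ k H) Q.f,
          ← hkey, (legs₁₂_leg₃_comm _ _).eq, map_mul (legs₁₂ k H) _ Q.f]
        simp only [mul_assoc]
  have h1 := e1' Q.phi
  have h2 := e2' Q.phi Q.phi
  rw [quad_A] at h2
  refine Eq.trans ?_ h2
  refine Eq.trans h1.symm ?_
  exact key

theorem legs₁₂_f_inv : legs₁₂ k H Q.f * legs₁₂ k H Q.fInv = 1 := by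
  rw [← map_mul, f_mul_fInv, map_one]

theorem legs₂₃_f_inv : legs₂₃ k H Q.f * legs₂₃ k H Q.fInv = 1 := by
  rw [← map_mul, f_mul_fInv, map_one]

theorem flipS₃_idΔ (t : H ⊗[k] H) : Q.flipS₃ (Q.idΔ t) =
    legs₁₂ k H Q.f * Q.Δid (Q.flipS t) * legs₁₂ k H Q.fInv := by
  rw [legs₁₂_f_mul_Δid_flipS, mul_assoc, legs₁₂_f_inv, mul_one]

theorem flipS₃_Δid (t : H ⊗[k] H) : Q.flipS₃ (Q.Δid t) =
    legs₂₃ k H Q.f * Q.idΔ (Q.flipS t) * legs₂₃ k H Q.fInv := by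
  rw [legs₂₃_f_mul_idΔ_flipS, mul_assoc, legs₂₃_f_inv, mul_one]

variable [FiniteDimensional k H]

theorem legs₁₂_inv_f : legs₁₂ k H Q.fInv * legs₁₂ k H Q.f = 1 := by
  rw [← map_mul, fInv_mul_f, map_one]

theorem legs₂₃_inv_f : legs₂₃ k H Q.fInv * legs₂₃ k H Q.f = 1 := by
  rw [← map_mul, fInv_mul_f, map_one]

/-- Half of the coassociativity of the coaction on `H*`. Applying the injective `flipS₃` turns `V`
into `f p_R`; the factors `f` are then governed by `f_cocycle` and the factors `p_R` by
`phi_mul_pCol_phi`. -/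
theorem VCol_phi_mul_phi : Q.VCol hS Q.phi * Q.phi = Q.Δid (Q.V hS) := by
  apply Q.flipS₃_injective hS
  have h : ∀ T, Q.flipS₃ (Q.VCol hS T) = legs₁₂ k H Q.f * Q.Δid Q.f * Q.pCol T := by
    intro T
    induction T with
    | zero => simp
    | add x y hx hy => simp only [map_add, mul_add, hx, hy]
    | tmul x t =>
      rw [VCol_tmul, flipS₃_mul, flipS₃_mul, flipS₃_legs₁₂, flipS₃_legs₂₃, flipS₃_idΔ, flipS_mul,
        flipS_V, ← SSop_apply, ← mul_assoc (Q.SSop _), SSop_Sinv, pCol_tmul, mul_assoc Q.f, map_mul,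
        map_mul (legs₁₂ k H)]
      simp only [mul_assoc]
      rw [← mul_assoc (legs₁₂ k H Q.fInv) (legs₁₂ k H Q.f), legs₁₂_inv_f, one_mul]
  rw [flipS₃_mul, h, flipS₃_Δid, flipS_V, ← mul_assoc, ← f_cocycle, mul_assoc, phi_mul_pCol_phi,
    ← idΔ_pR_mul_fInv, map_mul]
  simp only [mul_assoc]

theorem phi_mul_Δid_fInv : Q.phi * (Q.Δid Q.fInv * legs₁₂ k H Q.fInv) =
    Q.idΔ Q.fInv * legs₂₃ k H Q.fInv * Q.flipS₃ Q.phi := by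
  have h1 : Q.idΔ Q.fInv * legs₂₃ k H Q.fInv * (legs₂₃ k H Q.f * Q.idΔ Q.f) = 1 := by
    rw [mul_assoc, ← mul_assoc (legs₂₃ k H Q.fInv), legs₂₃_inv_f, one_mul, ← map_mul,
      fInv_mul_f, map_one]
  have h2 : legs₁₂ k H Q.f * Q.Δid Q.f * (Q.Δid Q.fInv * legs₁₂ k H Q.fInv) = 1 := by
    rw [mul_assoc, ← mul_assoc (Q.Δid Q.f), ← map_mul, f_mul_fInv, map_one, one_mul,
      legs₁₂_f_inv]
  calc _ = Q.idΔ Q.fInv * legs₂₃ k H Q.fInv * (legs₂₃ k H Q.f * Q.idΔ Q.f) *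
        (Q.phi * (Q.Δid Q.fInv * legs₁₂ k H Q.fInv)) := by rw [h1, one_mul]
    _ = Q.idΔ Q.fInv * legs₂₃ k H Q.fInv * (legs₂₃ k H Q.f * Q.idΔ Q.f * Q.phi) *
        (Q.Δid Q.fInv * legs₁₂ k H Q.fInv) := by simp only [mul_assoc]
    _ = Q.idΔ Q.fInv * legs₂₃ k H Q.fInv * Q.flipS₃ Q.phi *
        (legs₁₂ k H Q.f * Q.Δid Q.f * (Q.Δid Q.fInv * legs₁₂ k H Q.fInv)) := by
      rw [f_cocycle]; simp only [mul_assoc]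
    _ = _ := by rw [h2, mul_one]

/-- The other half: in `U = f⁻¹ · (S ⊗ S)(q_R²¹)` the factors `f⁻¹` obey the inverse of the cocycle
identity and the factors `q_R` obey `row_qR`. -/
theorem idΔ_U_mul : Q.idΔ (Q.U hS) * legs₂₃ k H (Q.U hS) = Q.phi * Q.UCol hS Q.phi := by
  have h1 : ∀ t, Q.Δid (Q.flipS t) =
      legs₁₂ k H Q.fInv * Q.flipS₃ (Q.idΔ t) * legs₁₂ k H Q.f := by
    intro t
    rw [flipS₃_idΔ, mul_assoc, mul_assoc, legs₁₂_inv_f, mul_one, ← mul_assoc, legs₁₂_inv_f,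
      one_mul]
  have h2 : ∀ t, Q.idΔ (Q.flipS t) * legs₂₃ k H Q.fInv =
      legs₂₃ k H Q.fInv * Q.flipS₃ (Q.Δid t) := by
    intro t
    rw [flipS₃_Δid, ← mul_assoc, ← mul_assoc, legs₂₃_inv_f, one_mul]
  have h : ∀ T, Q.UCol hS T = Q.Δid Q.fInv * legs₁₂ k H Q.fInv *
      (LinearMap.mul' k _ ∘ₗ TensorProduct.map
      (Q.flipS₃ ∘ₗ Q.idΔ.toLinearMap ∘ₗ LinearMap.mulLeft k (Q.qR hS) ∘ₗ Q.Δ.toLinearMap)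
      ((legs₁₂ k H).toLinearMap ∘ₗ LinearMap.mulLeft k Q.f)) T := by
    intro T
    induction T with
    | zero => simp
    | add x y hx hy => simp only [map_add, mul_add, hx, hy]
    | tmul x t =>
      simp only [LinearMap.comp_apply, TensorProduct.map_tmul, LinearMap.mulLeft_apply,
          LinearMap.mul'_apply, AlgHom.toLinearMap_apply, UCol_tmul]
      rw [U_eq, ← mul_assoc, Δ_S_mul_fInv, mul_assoc Q.fInv, SSop_apply, ← flipS_mul,
        map_mul Q.Δid, h1, map_mul (legs₁₂ k H)]
      simp only [mul_assoc]
  rw [h, ← mul_assoc Q.phi, phi_mul_Δid_fInv, mul_assoc _ (Q.flipS₃ Q.phi), ← row_qR, flipS₃_mul,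
    mul_assoc, ← mul_assoc (legs₂₃ k H Q.fInv), ← h2, flipS₃_legs₁₂, U_eq, map_mul, map_mul]
  simp only [mul_assoc]

end BijectiveAntipode

end QuasiHopfAlgebra
end

/-! ### Counit normalisations -/

noncomputable section

namespace QuasiHopfAlgebra

variable {k : Type*} {H : Type*} [Field k] [Ring H] [Algebra k H] (Q : QuasiHopfAlgebra k H)

section Counit

theorem pairHom_phi (a b c : H →ₐ[k] H) [CommHom a b] [CommHom a c] [CommHom b c]
    (h : Q.ass a b c = 1) : pairHom a (pairHom b c) Q.phi = 1 :=
  congrArg Units.val h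

theorem pairHom_phiInv (a b c : H →ₐ[k] H) [CommHom a b] [CommHom a c] [CommHom b c]
    (h : Q.ass a b c = 1) : pairHom a (pairHom b c) Q.phiInv = 1 :=
  (congrArg (fun u : Hˣ => ((u⁻¹ : Hˣ) : H)) h).trans (by simp)

/-- Apply `ε` to `∑ X¹ β S(X²) α X³ = 1`; what remains of `Φ` has a counit in an outer slot and is
trivial. -/
theorem ε_β_mul_ε_α : Q.ε Q.β * Q.ε Q.α = 1 := by
  have e : ∀ T, Q.ε (Q.zag T) = Q.ε Q.β * Q.ε Q.α *
      Q.ε (Q.S (pairHom (Q.eps H) (pairHom (AlgHom.id k H) (Q.eps H)) T)) := by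
    intro T
    induction T using tensor3_induction with
    | zero => simp
    | add x y hx hy => simp only [map_add, mul_add, hx, hy]
    | pure x y w =>
      simp only [zag_tmul, map_mul, pairHom_tmul, AlgHom.id_apply, Q.eps_apply, Q.S_mul]
      simp only [Algebra.algebraMap_eq_smul_one, map_smul, Q.S_one, map_one, smul_eq_mul, mul_one]
      ring
  have h := e Q.phi
  rw [Q.pairHom_phi _ _ _ (Q.ass_eps₃ _ _), zag_phi, Q.S_one, map_one, mul_one] at h
  exact h.symm

theorem ε_α_ne_zero : Q.ε Q.α ≠ 0 := right_ne_zero_of_mul_eq_one Q.ε_β_mul_ε_α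

-- Apply `ε` to `∑ S(h₁) α h₂ = ε(h) α` and cancel `ε(α)`.
@[simp] theorem ε_S (h : H) : Q.ε (Q.S h) = Q.ε h := by
  have e : ∀ T, Q.ε (Q.evα T) = Q.ε Q.α *
      Q.ε (Q.S (pairHom (AlgHom.id k H) (Q.eps H) T)) := by
    intro T
    induction T with
    | zero => simp
    | add x y hx hy => simp only [map_add, mul_add, hx, hy]
    | tmul x y =>
      simp only [evα_tmul, map_mul, pairHom_tmul, AlgHom.id_apply, Q.eps_apply, Q.S_mul]
      simp only [Algebra.algebraMap_eq_smul_one, map_smul, Q.S_one, map_one, smul_eq_mul, mul_one]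
      ring
  have h1 := e (Q.Δ h)
  rw [evα_Δ, ← Q.cp_apply, Q.cp_eps_right, map_smul, smul_eq_mul, mul_comm] at h1
  exact (mul_left_cancel₀ Q.ε_α_ne_zero h1).symm

/-- `ε ⊗ id`. -/
def εid : H ⊗[k] H →ₐ[k] H := pairHom (Q.eps H) (AlgHom.id k H)

/-- `id ⊗ ε`. -/
def idε : H ⊗[k] H →ₐ[k] H := pairHom (AlgHom.id k H) (Q.eps H)

@[simp] theorem εid_tmul (x y : H) : Q.εid (x ⊗ₜ[k] y) = Q.ε x • y := by
  simp [εid, Q.eps_apply, Algebra.smul_def]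

@[simp] theorem idε_tmul (x y : H) : Q.idε (x ⊗ₜ[k] y) = Q.ε y • x := by
  rw [idε, pairHom_tmul, Q.eps_apply, ← Algebra.commutes, ← Algebra.smul_def, AlgHom.id_apply]

@[simp] theorem εid_Δ (h : H) : Q.εid (Q.Δ h) = h := by
  rw [εid, ← Q.cp_apply, Q.cp_eps_left, AlgHom.id_apply]

@[simp] theorem idε_Δ (h : H) : Q.idε (Q.Δ h) = h := by
  rw [idε, ← Q.cp_apply, Q.cp_eps_right, AlgHom.id_apply]

theorem εid_flipS (t : H ⊗[k] H) : Q.εid (Q.flipS t) = Q.S (Q.idε t) := by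
  induction t with
  | zero => simp
  | add x y hx hy => simp only [map_add, hx, hy]
  | tmul x y => simp

theorem idε_flipS (t : H ⊗[k] H) : Q.idε (Q.flipS t) = Q.S (Q.εid t) := by
  induction t with
  | zero => simp
  | add x y hx hy => simp only [map_add, hx, hy]
  | tmul x y => simp

theorem εid_γ : Q.εid Q.γ = Q.ε Q.α • Q.α := by
  let a := onL H (legL k H)
  let b := onR H (legL k H)
  let z := matCoeff Q.evα (1 ⊗ₜ[k] 1)
  have e : ∀ T, Q.εid (Q.rowTwo T) =
      Q.ε Q.α • z (pairHom a (pairHom (Q.eps _) (pairHom (Q.eps _) b)) T) := by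
    intro T
    induction T using tensor4_induction with
    | zero => simp
    | add x y hx hy => simp only [map_add, smul_add, hx, hy]
    | pure x y u w =>
      simp only [rowTwo_tmul, εid_tmul, map_mul, ε_S, pairHom_tmul, Q.eps_apply,
        Algebra.algebraMap_eq_smul_one, smul_mul_assoc, mul_smul_comm, one_mul, map_smul]
      simp [a, b, z, evα_tmul, smul_smul]
      ring_nf
  rw [γ_eq, e, quad_A, QuasiBialgebra.nestA, Q.ass_eps₂, Q.ass_eps₂]
  simp [z, evα_tmul, Q.S_one]

theorem idε_γ : Q.idε Q.γ = Q.ε Q.α • Q.α := by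
  let a := onL H (legL k H)
  let b := onR H (legL k H)
  let z := matCoeff Q.evα (1 ⊗ₜ[k] 1)
  have e : ∀ T, Q.idε (Q.rowTwo T) =
      Q.ε Q.α • z (pairHom (Q.eps _) (pairHom a (pairHom b (Q.eps _))) T) := by
    intro T
    induction T using tensor4_induction with
    | zero => simp
    | add x y hx hy => simp only [map_add, smul_add, hx, hy]
    | pure x y u w =>
      simp only [rowTwo_tmul, idε_tmul, map_mul, ε_S, pairHom_tmul, Q.eps_apply,
        Algebra.algebraMap_eq_smul_one, smul_mul_assoc, mul_smul_comm, one_mul, mul_one, map_smul]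
      simp [a, b, z, evα_tmul, smul_smul]
      ring_nf
  rw [γ_eq, e, quad_A, QuasiBialgebra.nestA, Q.ass_eps₁, Q.ass_eps₃]
  simp [z, evα_tmul, Q.S_one]

theorem εid_f : Q.εid Q.f = Q.ε Q.α • 1 := by
  have e : ∀ T, Q.εid (Q.evF T) = Q.ε Q.α • Q.zagInv T := by
    intro T
    induction T using tensor3_induction with
    | zero => simp
    | add x y hx hy => simp only [map_add, smul_add, hx, hy]
    | pure x y w =>
      simp only [evF_tmul, map_mul, SSop_apply, εid_flipS, idε_Δ, εid_Δ, εid_γ, zagInv_tmul]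
      simp [mul_assoc]
  rw [f_eq, e, zagInv_phiInv]

theorem idε_f : Q.idε Q.f = Q.ε Q.α • 1 := by
  have e : ∀ T, Q.idε (Q.evF T) = Q.ε Q.α • Q.zagInv T := by
    intro T
    induction T using tensor3_induction with
    | zero => simp
    | add x y hx hy => simp only [map_add, smul_add, hx, hy]
    | pure x y w =>
      simp only [evF_tmul, map_mul, SSop_apply, idε_flipS, idε_Δ, εid_Δ, idε_γ, zagInv_tmul]
      simp [mul_assoc]
  rw [f_eq, e, zagInv_phiInv]

theorem idε_pR : Q.idε Q.pR = Q.ε Q.β • 1 := by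
  have e : ∀ T, Q.idε (Q.evβ.lTensor H T) =
      Q.ε Q.β • pairHom (AlgHom.id k H) (pairHom (Q.eps H) (Q.eps H)) T := by
    intro T
    induction T using tensor3_induction with
    | zero => simp
    | add x y hx hy => simp only [map_add, smul_add, hx, hy]
    | pure x y w =>
      simp only [LinearMap.lTensor_tmul, evβ_tmul, idε_tmul, map_mul, ε_S, pairHom_tmul,
        Q.eps_apply, Algebra.algebraMap_eq_smul_one, mul_smul_comm, mul_one, AlgHom.id_apply, smul_smul]
      ring_nf
  rw [pR, e, Q.pairHom_phiInv _ _ _ (Q.ass_eps₃ _ _)]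

theorem idε_qR (hS : Function.Bijective Q.S) : Q.idε (Q.qR hS) = Q.ε Q.α • 1 := by
  have e : ∀ T, Q.idε ((Q.evq hS).lTensor H T) =
      Q.ε Q.α • pairHom (AlgHom.id k H) (pairHom (Q.eps H) (Q.eps H)) T := by
    intro T
    induction T using tensor3_induction with
    | zero => simp
    | add x y hx hy => simp only [map_add, smul_add, hx, hy]
    | pure x y w =>
      have : Q.ε (Q.Sinv hS (Q.α * w)) = Q.ε Q.α * Q.ε w := by
        rw [← ε_S, S_Sinv, map_mul]
      simp only [LinearMap.lTensor_tmul, evq_tmul, idε_tmul, map_mul, this, pairHom_tmul,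
        Q.eps_apply, Algebra.algebraMap_eq_smul_one, mul_smul_comm, mul_one, AlgHom.id_apply, smul_smul]
      ring_nf
  rw [qR, e, Q.pairHom_phi _ _ _ (Q.ass_eps₃ _ _)]

/-- The counit contributes `ε(α)` from `f`, `ε(β)` from `p_R`, `ε(α)` from `q_R` and the inverse of
`ε(α)` from `f⁻¹`. With `ε(β) ε(α) = 1` everything cancels; this is counitality of the coaction on
`H*`. -/
theorem εid_U_V [FiniteDimensional k H] (hS : Function.Bijective Q.S) :
    Q.εid (Q.V hS) = 1 ∧ Q.εid (Q.U hS) = 1 := by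
  constructor
  · apply hS.1
    rw [← idε_flipS, flipS_V, map_mul, idε_f, idε_pR, Q.S_one, smul_mul_smul_comm, mul_comm,
      ε_β_mul_ε_α, one_smul, mul_one]
  · have h := congrArg Q.εid Q.fInv_mul_f
    rw [map_mul, εid_f, map_one, mul_smul_comm, mul_one, ← map_smul] at h
    rw [U_eq, map_mul, εid_flipS, idε_qR, map_smul, Q.S_one, mul_smul_comm, mul_one, ← map_smul, h]

theorem evβ_mul_Δ (P : H ⊗[k] H) (h : H) : Q.evβ (P * Q.Δ h) = Q.ε h • Q.evβ P := by
  have e : ∀ x y T, Q.evβ (x ⊗ₜ[k] y * T) = x * Q.evβ T * Q.S y := by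
    intro x y T
    induction T with
    | zero => simp
    | add x y hx hy => simp only [map_add, mul_add, add_mul, hx, hy]
    | tmul p q => simp [evβ_tmul, Q.S_mul, mul_assoc]
  induction P with
  | zero => simp
  | add x y hx hy => simp only [map_add, smul_add, add_mul, hx, hy]
  | tmul x y => rw [e, evβ_Δ, evβ_tmul, mul_smul_comm, smul_mul_assoc]

/-- The inserted `β` coevaluates the strands `c, d` while `α` evaluates `b, c`. The zigzag
straightens, and only `S(α)` from the second factor of `γ` survives. -/
theorem evβ_γ : Q.evβ Q.γ = Q.S Q.α := by
  let φ : H ⊗[k] (H ⊗[k] H) →ₗ[k] H := LinearMap.mul' k H ∘ₗ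
    (TensorProduct.comm k H H).toLinearMap ∘ₗ
      TensorProduct.map (LinearMap.mulLeft k (Q.S Q.α) ∘ₗ Q.S ∘ₗ Q.S) Q.evα
  let a := onL (H ⊗[k] H) (legL k H)
  let b := onR H (onL H (legL k H))
  let c := onR H (onR H (legL k H))
  let d := onR H (onR H Q.legS)
  let z := matCoeff φ (1 ⊗ₜ[k] (1 ⊗ₜ[k] Q.β))
  have hl : Q.RowInv φ b c :=
    (Q.rowInv_evα.map_right (LinearMap.mulLeft k (Q.S Q.α) ∘ₗ Q.S ∘ₗ Q.S)).comp
      (LinearMap.mul' k H ∘ₗ (TensorProduct.comm k H H).toLinearMap)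
  have key := Q.apply_nestA_zigzag (z := z) (a := a) (b := b) (c := c) (d := d) hl.leq
    ((Q.colInv_β.tmul_right 1).tmul_right 1).req
  have e1 : ∀ T, Q.evβ (Q.rowTwo T) = z (pairHom a (pairHom b (pairHom c d)) T) := by
    intro T
    induction T using tensor4_induction with
    | zero => simp
    | add x y hx hy => simp only [map_add, hx, hy]
    | pure x y u w => simp [a, b, c, d, z, φ, evα_tmul, evβ_tmul, Q.S_mul, mul_assoc]
  have e2 : ∀ T, z (pairHom b (pairHom c d) T) = Q.zagInv T * Q.S Q.α := by
    intro T
    induction T using tensor3_induction with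
    | zero => simp
    | add x y hx hy => simp only [map_add, add_mul, hx, hy]
    | pure x y w => simp [b, c, d, z, φ, evα_tmul, Q.S_one, mul_assoc]
  have h2 := e2 Q.phiInv
  rw [zagInv_phiInv, one_mul] at h2
  rw [γ_eq, e1, quad_A, ← h2]
  exact key

theorem evβ_f : Q.evβ Q.f = Q.ε Q.β • Q.S Q.α := by
  have e : ∀ T, Q.evβ (Q.evF T) = Q.ε Q.β •
      Q.evβ (Q.SSop (pairHom (AlgHom.id k H) (pairHom (Q.eps H) (Q.eps H)) T) * Q.γ) := by
    intro T
    induction T using tensor3_induction with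
    | zero => simp
    | add x y hx hy => simp only [map_add, add_mul, smul_add, hx, hy]
    | pure x y w =>
      rw [evF_tmul, evβ_mul_Δ]
      simp only [map_mul, ε_S, pairHom_tmul, AlgHom.id_apply, Q.eps_apply]
      simp only [Algebra.algebraMap_eq_smul_one, smul_mul_assoc, mul_smul_comm, mul_one,
        smul_smul, map_smul]
      ring_nf
  rw [f_eq, e, Q.pairHom_phiInv _ _ _ (Q.ass_eps₃ _ _), SSop_one, one_mul, evβ_γ]

end Counit

end QuasiHopfAlgebra
end

/-! ### Quasi-Hopf bimodules and the projection `m ↦ m₀ · β S(m₁)` -/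

noncomputable section

namespace BimoduleWithCoaction

variable {k : Type u} {H : Type v} {M : Type w} [Field k] [Ring H] [Algebra k H]
  [AddCommGroup M] [Module k M] (C : BimoduleWithCoaction k H M)

section Actions

variable {R : Type v} [Ring R] [Algebra k R]

theorem ract_mul (a b : H) (m : M) : C.ract (MulOpposite.op (a * b)) m =
    C.ract (MulOpposite.op b) (C.ract (MulOpposite.op a) m) := by
  rw [MulOpposite.op_mul, map_mul, Module.End.mul_apply]

/-- The right action as a linear map. -/
def rmul : H →ₗ[k] Module.End k M :=
  C.ract.toLinearMap ∘ₗ (MulOpposite.opLinearEquiv k).toLinearMap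

theorem rmul_apply (a : H) : C.rmul a = C.ract (MulOpposite.op a) := rfl

@[simp] theorem rmul_mul (a b : H) (m : M) : C.rmul (a * b) m = C.rmul b (C.rmul a m) :=
  C.ract_mul a b m

@[simp] theorem rmul_one (m : M) : C.rmul 1 m = m := by
  rw [rmul_apply, MulOpposite.op_one, map_one, Module.End.one_apply]

theorem lact_rmul (a b : H) (m : M) : C.lact a (C.rmul b m) = C.rmul b (C.lact a m) :=
  C.lact_ract a b m

theorem rightBy_tmul' (b : H) (s r : R) (m : M) :
    C.rightBy R (b ⊗ₜ[k] s) (m ⊗ₜ[k] r) = C.rmul b m ⊗ₜ[k] (r * s) := C.rightBy_tmul R b s r m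

theorem leftBy_mul (s t : H ⊗[k] R) (x : M ⊗[k] R) :
    C.leftBy R (s * t) x = C.leftBy R s (C.leftBy R t x) := by
  induction s with
  | zero => simp
  | add x y hx hy => simp only [map_add, add_mul, LinearMap.add_apply, hx, hy]
  | tmul a b =>
    induction t with
    | zero => simp
    | add x y hx hy => simp only [map_add, mul_add, LinearMap.add_apply, hx, hy]
    | tmul c d =>
      induction x with
      | zero => simp
      | add x y hx hy => simp only [map_add, hx, hy]
      | tmul m r => simp [leftBy_tmul, mul_assoc]

theorem leftBy_one (x : M ⊗[k] R) : C.leftBy R 1 x = x := by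
  induction x with
  | zero => simp
  | add x y hx hy => simp only [map_add, hx, hy]
  | tmul m r => simp [Algebra.TensorProduct.one_def, leftBy_tmul]

theorem rightBy_mul (s t : H ⊗[k] R) (x : M ⊗[k] R) :
    C.rightBy R (s * t) x = C.rightBy R t (C.rightBy R s x) := by
  induction s with
  | zero => simp
  | add x y hx hy => simp only [map_add, add_mul, LinearMap.add_apply, hx, hy]
  | tmul a b =>
    induction t with
    | zero => simp
    | add x y hx hy => simp only [map_add, mul_add, LinearMap.add_apply, hx, hy]
    | tmul c d =>
      induction x with
      | zero => simp
      | add x y hx hy => simp only [map_add, hx, hy]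
      | tmul m r => simp [rightBy_tmul', mul_assoc]

end Actions

variable (Q : QuasiHopfAlgebra k H)

/-- `m ⊗ h ↦ m · β S(h)`. -/
def contract : M ⊗[k] H →ₗ[k] M :=
  TensorProduct.lift (C.rmul ∘ₗ LinearMap.mulLeft k Q.β ∘ₗ Q.S).flip

@[simp] theorem contract_tmul (m : M) (h : H) :
    C.contract Q (m ⊗ₜ[k] h) = C.rmul (Q.S h) (C.rmul Q.β m) := by
  simp [contract]

/-- The projection `m ↦ m₀ · β S(m₁)` onto the alternative coinvariants (up to a scalar). -/
def proj : M →ₗ[k] M := C.contract Q ∘ₗ C.ρ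

/-- The action `h ▷ m = m · S(h)`. -/
def ractS : H →ₐ[k] Module.End k M := AlgHom.ofLinearMap (C.rmul ∘ₗ Q.S)
  (by ext m; simp [Q.S_one]) (by intro x y; ext m; simp [Q.S_mul])

@[simp] theorem ractS_apply (h : H) (m : M) : C.ractS Q h m = C.rmul (Q.S h) m := rfl

instance : CommHom C.lact (C.ractS Q) :=
  ⟨fun x y => LinearMap.ext fun m => C.lact_rmul x (Q.S y) m⟩

theorem contract_rightBy (t : H ⊗[k] H) (m : M) (h : H) :
    C.contract Q (C.rightBy H t (m ⊗ₜ[k] h)) = C.rmul (Q.S h) (C.rmul (Q.evβ t) m) := by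
  induction t with
  | zero => simp
  | add x y hx hy => simp only [map_add, LinearMap.add_apply, hx, hy]
  | tmul x y => simp [rightBy_tmul', QuasiHopfAlgebra.evβ_tmul, Q.S_mul]

theorem contract_leftBy (t : H ⊗[k] H) (x : M ⊗[k] H) :
    C.contract Q (C.leftBy H t x) = pairHom C.lact (C.ractS Q) t (C.contract Q x) := by
  induction x with
  | zero => simp
  | add x y hx hy => simp only [map_add, hx, hy]
  | tmul m h =>
    induction t with
    | zero => simp
    | add x y hx hy => simp only [map_add, LinearMap.add_apply, hx, hy]
    | tmul x y => simp [leftBy_tmul, Q.S_mul, lact_rmul]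

namespace IsRightQuasiHopfBimodule

variable {C Q} (hC : C.IsRightQuasiHopfBimodule Q.toQuasiBialgebra)
include hC

/-- `ρ(m · b) = ρ(m) · Δ(b)`, and the factor `Δ(b)` surrounds `β` as `∑ b₁ β S(b₂)`. -/
theorem proj_ract (m : M) (b : H) : C.proj Q (C.rmul b m) = Q.ε b • C.proj Q m := by
  have : ∀ x, C.contract Q (C.rightBy H (Q.Δ b) x) = Q.ε b • C.contract Q x := by
    intro x
    induction x with
    | zero => simp
    | add x y hx hy => simp only [map_add, smul_add, hx, hy]
    | tmul m h => rw [contract_rightBy, Q.evβ_Δ, map_smul, LinearMap.smul_apply, map_smul,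
        contract_tmul]
  rw [proj, LinearMap.comp_apply, rmul_apply, hC.ρ_ract, this]
  rfl

theorem proj_lact (m : M) (a : H) :
    C.proj Q (C.lact a m) = Q.cp C.lact (C.ractS Q) a (C.proj Q m) := by
  rw [proj, LinearMap.comp_apply, hC.ρ_lact, contract_leftBy]
  rfl

theorem coassoc' (m : M) : TensorProduct.assoc k M H H (C.ρ.rTensor H (C.ρ m)) =
    C.leftBy (H ⊗[k] H) Q.phiInv (C.rightBy (H ⊗[k] H) Q.phi
      (Q.Δ.toLinearMap.lTensor M (C.ρ m))) := by
  have h := hC.quasi_coassoc m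
  have := congrArg (C.leftBy (H ⊗[k] H) Q.phiInv) h
  rw [← leftBy_mul, QuasiHopfAlgebra.phiInv, Units.inv_mul, leftBy_one] at this
  exact this

end IsRightQuasiHopfBimodule

end BimoduleWithCoaction

namespace QuasiHopfAlgebra

variable {k : Type*} {H : Type*} [Field k] [Ring H] [Algebra k H] (Q : QuasiHopfAlgebra k H)

/-- `x ⊗ y ⊗ z ↦ S(z) ⊗ x β S(y)`. -/
def tail : H ⊗[k] (H ⊗[k] H) →ₗ[k] H ⊗[k] H :=
  (TensorProduct.comm k H H).toLinearMap ∘ₗ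
      TensorProduct.map Q.evβ Q.S ∘ₗ (TensorProduct.assoc k H H H).symm.toLinearMap

@[simp] theorem tail_tmul (x y z : H) : Q.tail (x ⊗ₜ[k] (y ⊗ₜ[k] z)) =
    Q.S z ⊗ₜ[k] (x * Q.β * Q.S y) := by
  simp [tail, evβ_tmul]

theorem altTail_apply (T : H ⊗[k] (H ⊗[k] H)) : Q.altTail T = Q.tail T * Q.f := rfl

/-- `x ⊗ y ⊗ z ↦ (x ⊗ y) δ (S ⊗ S)(Δᵒᵖ(z))`. -/
def δTail : H ⊗[k] (H ⊗[k] H) →ₗ[k] H ⊗[k] H :=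
  LinearMap.mul' k (H ⊗[k] H) ∘ₗ
    TensorProduct.map (LinearMap.mulRight k Q.δ) Q.SSop ∘ₗ
      (TensorProduct.assoc k H H H).symm.toLinearMap

@[simp] theorem δTail_tmul (x y z : H) : Q.δTail (x ⊗ₜ[k] (y ⊗ₜ[k] z)) =
    (x ⊗ₜ[k] y) * Q.δ * Q.SSop z := by
  simp [δTail]

/-- Removes `δ` from the coaction of a projected element: with the `Φ` in front, the two bracketing
factors of `B` reduce to a single associator on `b, c, d`. -/
theorem δTail_phi : Q.δTail Q.phi = Q.β ⊗ₜ[k] 1 * Q.tail Q.phi := by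
  let a := onL H (legL k H)
  let b := onR H (legL k H)
  let c := onR H Q.legS
  let d := onL H Q.legS
  let z := matCoeff (LinearMap.id : H ⊗[k] H →ₗ[k] _) (Q.β ⊗ₜ[k] Q.β)
  -- Prefixing this associator cancels the inverse one left by `apply_nestA_inv`.
  let z' := z ∘ₗ LinearMap.mulLeft k (Q.ass a b (Q.cp c d) : Module.End k (H ⊗[k] H))
  have hr : REq z' (Q.cp b c) (Q.eps _) := by
    intro x E
    have := (Q.colInv_β.tmul_right Q.β).req (φ := (LinearMap.id : H ⊗[k] H →ₗ[k] _)) x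
      ((Q.ass a b (Q.cp c d) : Module.End k (H ⊗[k] H)) * E)
    rw [mul_assoc, mul_assoc] at this
    exact this
  have key := Q.apply_nestA_inv (z := z') (a := a) (b := b) (c := c) (d := d) hr
  have e1 : ∀ x y P T, z (a x * (b y * pairHom c d P) * pairHom a (pairHom b (pairHom c d)) T) =
      (x ⊗ₜ[k] y) * Q.colTwo T * Q.flipS P := by
    intro x y P T
    induction T using tensor4_induction with
    | zero => simp
    | add x y hx hy => simp only [map_add, mul_add, add_mul, hx, hy]
    | pure p q r s =>
      induction P with
      | zero => simp
      | add x y hx hy => simp only [map_add, mul_add, add_mul, hx, hy]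
      | tmul m n => simp [a, b, c, d, z, mul_assoc]
  have e1' : ∀ T, z (pairHom a (pairHom b (Q.cp c d)) T *
      pairHom a (pairHom b (pairHom c d)) Q.B) = Q.δTail T := by
    intro T
    induction T using tensor3_induction with
    | zero => simp
    | add x y hx hy => simp only [map_add, add_mul, hx, hy]
    | pure x y w =>
      rw [pairHom_tmul, pairHom_tmul, Q.cp_apply, e1]
      rfl
  have e2 : ∀ T, z (pairHom b (pairHom c d) T) = Q.β ⊗ₜ[k] 1 * Q.tail T := by
    intro T
    induction T using tensor3_induction with
    | zero => simp
    | add x y hx hy => simp only [map_add, mul_add, hx, hy]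
    | pure p q r => simp [b, c, d, z, mul_assoc]
  rw [← e1', quad_B, ← e2]
  refine Eq.trans key ?_
  simp only [z', LinearMap.comp_apply, LinearMap.mulLeft_apply, Units.val_mul, Units.mul_inv_cancel_left]
  rfl

/-- Past `Φ`, the iterated coproduct becomes `(Δ ⊗ id)(Δ h)`; its first two components surround `β`
and collapse to a counit, leaving `S(h)`. -/
theorem tail_idΔ_mul_phi (h : H) : Q.tail (Q.idΔ (Q.Δ h) * Q.phi) =
    Q.S h ⊗ₜ[k] 1 * Q.tail Q.phi := by
  have e1 : ∀ P y T, Q.tail (T * (legs₁₂ k H P * leg₃ k H y)) = Q.S y ⊗ₜ[k] 1 *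
      (pairHom (onR H (legL k H)) (pairHom (onR H Q.legS) (onL H Q.legS)) T
        (1 ⊗ₜ[k] Q.evβ P)) := by
    intro P y T
    induction T using tensor3_induction with
    | zero => simp
    | add x y hx hy => simp only [map_add, mul_add, add_mul, LinearMap.add_apply, hx, hy]
    | pure p q r =>
      induction P with
      | zero => simp
      | add x y hx hy =>
        simp only [map_add, mul_add, add_mul, TensorProduct.tmul_add, hx, hy]
      | tmul m n => simp [legs₁₂_tmul, evβ_tmul, Q.S_mul, mul_assoc]
  have e2 : ∀ T, Q.tail T = pairHom (onR H (legL k H)) (pairHom (onR H Q.legS) (onL H Q.legS)) T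
      (1 ⊗ₜ[k] Q.β) := by
    intro T
    induction T using tensor3_induction with
    | zero => simp
    | add x y hx hy => simp only [map_add, LinearMap.add_apply, hx, hy]
    | pure p q r => simp [mul_assoc]
  have e3 : ∀ P, Q.tail (Q.phi * Q.Δid P) = Q.S (Q.εid P) ⊗ₜ[k] 1 * Q.tail Q.phi := by
    intro P
    induction P with
    | zero => simp
    | add x y hx hy =>
      simp only [map_add, mul_add, add_mul, TensorProduct.add_tmul, hx, hy]
    | tmul x y =>
      rw [Δid_tmul, e1, evβ_Δ, e2, εid_tmul, TensorProduct.tmul_smul, map_smul, map_smul,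
        ← TensorProduct.smul_tmul', mul_smul_comm, smul_mul_assoc]
  rw [← Φ_mul_Δid_Δ, e3, εid_Δ]

end QuasiHopfAlgebra

end

/-! ### The structure theorem for quasi-Hopf bimodules -/

noncomputable section

namespace QuasiHopfAlgebra

variable {k : Type*} {H : Type*} [Field k] [Ring H] [Algebra k H] (Q : QuasiHopfAlgebra k H)

theorem tail_idΔ_mul (p q : H) (Y : H ⊗[k] (H ⊗[k] H)) :
    Q.tail (Q.idΔ (p ⊗ₜ[k] q) * Y) = 1 ⊗ₜ[k] p * Q.tail Y * Q.SSop q := by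
  have : ∀ P, Q.tail (p ⊗ₜ[k] P * Y) = 1 ⊗ₜ[k] p * Q.tail Y * Q.flipS P := by
    intro P
    induction Y using tensor3_induction with
    | zero => simp
    | add x y hx hy => simp only [map_add, mul_add, add_mul, hx, hy]
    | pure a b c =>
      induction P with
      | zero => simp
      | add x y hx hy => simp only [map_add, mul_add, add_mul, TensorProduct.tmul_add, hx, hy]
      | tmul m n => simp [Q.S_mul, mul_assoc]
  rw [idΔ_tmul, this, SSop_apply]

theorem zag_idΔ_mul (p q : H) (Y : H ⊗[k] (H ⊗[k] H)) :
    Q.zag (Q.idΔ (p ⊗ₜ[k] q) * Y) = Q.ε q • (p * Q.zag Y) := by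
  induction Y using tensor3_induction with
  | zero => simp
  | add x y hx hy => simp only [map_add, mul_add, smul_add, hx, hy]
  | pure a b c =>
    have : ∀ P, Q.zag (p ⊗ₜ[k] P * a ⊗ₜ[k] (b ⊗ₜ[k] c)) =
        p * a * Q.β * Q.S b * Q.evα P * c := by
      intro P
      induction P with
      | zero => simp
      | add x y hx hy => simp only [map_add, mul_add, add_mul, TensorProduct.tmul_add, hx, hy]
      | tmul m n => simp [Q.S_mul, evα_tmul, mul_assoc]
    rw [idΔ_tmul, this, evα_Δ]
    simp [mul_assoc]

theorem evβ_altTail (Y : H ⊗[k] (H ⊗[k] H)) :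
    Q.evβ (Q.altTail Y) = Q.ε Q.β • Q.S (Q.zag Y) := by
  have e : ∀ x y T, Q.evβ (x ⊗ₜ[k] y * T) = x * Q.evβ T * Q.S y := by
    intro x y T
    induction T with
    | zero => simp
    | add x y hx hy => simp only [map_add, mul_add, add_mul, hx, hy]
    | tmul p q => simp [evβ_tmul, Q.S_mul, mul_assoc]
  induction Y using tensor3_induction with
  | zero => simp
  | add x y hx hy => simp only [map_add, smul_add, hx, hy]
  | pure a b c =>
    rw [altTail_tmul, e, evβ_f, zag_tmul]
    simp [Q.S_mul, mul_assoc]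

theorem εid_tail_phi : Q.εid (Q.tail Q.phi) = Q.β := by
  let z := matCoeff (LinearMap.id : H →ₗ[k] H) Q.β
  have e : ∀ T, Q.εid (Q.tail T) =
      z (pairHom (legL k H) (pairHom Q.legS (Q.eps _)) T) := by
    intro T
    induction T using tensor3_induction with
    | zero => simp
    | add x y hx hy => simp only [map_add, hx, hy]
    | pure p q r => simp [z, Q.eps_apply, mul_assoc]
  have key : pairHom (legL k H) (pairHom Q.legS (Q.eps _)) Q.phi = 1 :=
    congrArg Units.val (Q.ass_eps₃ (legL k H) Q.legS)
  rw [e, key]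
  simp [z]

/-- `x ⊗ y ⊗ z ↦ x ⊗ S(z₂ X³) f¹ ⊗ y X¹ β S(z₁ X²) f²`. -/
def altMap : H ⊗[k] (H ⊗[k] H) →ₗ[k] H ⊗[k] (H ⊗[k] H) :=
  Q.altTail.lTensor H ∘ₗ LinearMap.mulRight k ((1 : H) ⊗ₜ[k] Q.phi) ∘ₗ Q.Δ₃

theorem altMap_tmul (a b c : H) :
    Q.altMap (a ⊗ₜ[k] (b ⊗ₜ[k] c)) = a ⊗ₜ[k] Q.altTail (Q.idΔ (b ⊗ₜ[k] c) * Q.phi) := by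
  simp [altMap, Δ₃, idΔ_tmul]

end QuasiHopfAlgebra

namespace BimoduleWithCoaction

variable {k : Type u} {H : Type v} {M : Type w} [Field k] [Ring H] [Algebra k H]
  [AddCommGroup M] [Module k M] (C : BimoduleWithCoaction k H M)

theorem leftBy_rightBy {R : Type v} [Ring R] [Algebra k R] (s t : H ⊗[k] R) (x : M ⊗[k] R) :
    C.leftBy R s (C.rightBy R t x) = C.rightBy R t (C.leftBy R s x) := by
  induction s with
  | zero => simp
  | add x y hx hy => simp only [map_add, LinearMap.add_apply, hx, hy]
  | tmul a b =>
    induction t with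
    | zero => simp
    | add x y hx hy => simp only [map_add, LinearMap.add_apply, hx, hy]
    | tmul c d =>
      induction x with
      | zero => simp
      | add x y hx hy => simp only [map_add, hx, hy]
      | tmul m r => simp [leftBy_tmul, rightBy_tmul', lact_rmul, mul_assoc]

theorem sandwich_apply (a : H) (t : H ⊗[k] H) (n : M) :
    C.sandwich (a ⊗ₜ[k] t) n = C.leftBy H (a ⊗ₜ[k] 1) (C.rightBy H t (n ⊗ₜ[k] 1)) := by
  induction t with
  | zero => simp
  | add x y hx hy =>
    simp only [TensorProduct.tmul_add, map_add, LinearMap.add_apply, hx, hy]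
  | tmul r s => simp [sandwich_tmul, rightBy_tmul', leftBy_tmul, rmul_apply]

variable (Q : QuasiHopfAlgebra k H)

theorem sandwich_altTail (a b c : H) (n : M) :
    C.sandwich (Q.altMap (a ⊗ₜ[k] (b ⊗ₜ[k] c))) n =
      C.leftBy H (a ⊗ₜ[k] b)
        (C.rightBy H (Q.tail Q.phi * Q.SSop c * Q.f) (n ⊗ₜ[k] 1)) := by
  rw [Q.altMap_tmul, sandwich_apply, Q.altTail_apply, Q.tail_idΔ_mul,
    mul_assoc, mul_assoc, rightBy_mul, rightBy_tmul', ← mul_assoc (Q.tail _),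
    show a ⊗ₜ[k] b = a ⊗ₜ[k] (1 : H) * (1 : H) ⊗ₜ[k] b by simp, leftBy_mul _ (a ⊗ₜ[k] 1),
    leftBy_rightBy _ (1 ⊗ₜ[k] b), leftBy_tmul]
  simp

/-- `m ⊗ h ⊗ g ↦ (m ⊗ h) · δ (S ⊗ S)(Δᵒᵖ(g)) f`. -/
def contractΔ : M ⊗[k] (H ⊗[k] H) →ₗ[k] M ⊗[k] H :=
  TensorProduct.lift (C.rightBy H ∘ₗ LinearMap.mulRight k Q.f ∘ₗ
    LinearMap.mulLeft k Q.δ ∘ₗ Q.SSop).flip ∘ₗ (TensorProduct.assoc k M H H).symm.toLinearMap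

theorem contractΔ_assoc (x : M ⊗[k] H) (g : H) :
    C.contractΔ Q (TensorProduct.assoc k M H H (x ⊗ₜ[k] g)) =
      C.rightBy H (Q.δ * Q.SSop g * Q.f) x := by
  simp [contractΔ]

theorem contractΔ_leftBy_rightBy (a b c p q : H) (m : M) (Y : H ⊗[k] (H ⊗[k] H)) :
    C.contractΔ Q (C.leftBy (H ⊗[k] H) (a ⊗ₜ[k] (b ⊗ₜ[k] c))
      (C.rightBy (H ⊗[k] H) Y (m ⊗ₜ[k] (p ⊗ₜ[k] q)))) =
    C.leftBy H (a ⊗ₜ[k] b)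
      (C.rightBy H (Q.δTail Y * (Q.SSop q * (Q.SSop c * Q.f))) (m ⊗ₜ[k] p)) := by
  induction Y using tensor3_induction with
  | zero => simp
  | add x y hx hy => simp only [map_add, add_mul, LinearMap.add_apply, hx, hy]
  | pure x y w =>
    have := C.contractΔ_assoc Q (C.lact a (C.rmul x m) ⊗ₜ[k] (b * (p * y))) (c * (q * w))
    rw [TensorProduct.assoc_tmul] at this
    rw [rightBy_tmul', leftBy_tmul, Algebra.TensorProduct.tmul_mul_tmul,
      Algebra.TensorProduct.tmul_mul_tmul, this, Q.δTail_tmul, mul_assoc Q.δ,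
      mul_assoc (x ⊗ₜ[k] y * Q.δ), mul_assoc (x ⊗ₜ[k] y), rightBy_mul _ (x ⊗ₜ[k] y),
      rightBy_tmul', leftBy_rightBy, leftBy_tmul]
    simp [mul_assoc]

/-- Here the coaction of `m · β S(h)` takes the shape required of an alternative coinvariant: the
right-hand `Φ` converts `δ` into `tail`, and `Δ(h)` collapses to the single factor `S(h)`. -/
theorem contractΔ_leftBy_rightBy_Δ (T : H ⊗[k] (H ⊗[k] H)) (m : M) (h : H) :
    C.contractΔ Q (C.leftBy (H ⊗[k] H) T
      (C.rightBy (H ⊗[k] H) Q.phi (m ⊗ₜ[k] Q.Δ h))) =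
    C.sandwich (Q.altMap T)
      (C.rmul (Q.S h) (C.rmul Q.β m)) := by
  induction T using tensor3_induction with
  | zero => simp
  | add x y hx hy => simp only [map_add, LinearMap.add_apply, hx, hy]
  | pure a b c =>
    have : ∀ P, C.contractΔ Q (C.leftBy (H ⊗[k] H) (a ⊗ₜ[k] (b ⊗ₜ[k] c))
        (C.rightBy (H ⊗[k] H) Q.phi (m ⊗ₜ[k] P))) =
        C.leftBy H (a ⊗ₜ[k] b) (C.rightBy H (Q.tail (Q.idΔ P * Q.phi) * (Q.SSop c * Q.f))
          (C.rmul Q.β m ⊗ₜ[k] 1)) := by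
      intro P
      induction P with
      | zero => simp
      | add x y hx hy =>
        simp only [map_add, add_mul, LinearMap.add_apply, TensorProduct.tmul_add, hx, hy]
      | tmul p q =>
        rw [contractΔ_leftBy_rightBy, Q.δTail_phi, Q.tail_idΔ_mul]
        simp only [rightBy_mul, rightBy_tmul', rmul_one, mul_one, one_mul]
    rw [this, Q.tail_idΔ_mul_phi, sandwich_altTail, mul_assoc, rightBy_mul, rightBy_tmul', mul_one,
      mul_assoc]

/-- `x ⊗ y ⊗ z ↦ (m ↦ x · m · S(y) α z)`. -/
def twist : H ⊗[k] (H ⊗[k] H) →ₗ[k] Module.End k M :=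
  LinearMap.mul' k _ ∘ₗ TensorProduct.map C.lact.toLinearMap (C.rmul ∘ₗ Q.evα)

@[simp] theorem twist_tmul (x y z : H) (m : M) : C.twist Q (x ⊗ₜ[k] (y ⊗ₜ[k] z)) m =
    C.lact x (C.rmul z (C.rmul Q.α (C.rmul (Q.S y) m))) := by
  simp [twist, QuasiHopfAlgebra.evα_tmul]

/-- `m ⊗ h ↦ ∑ X¹ · m · S(X²) α X³ h`. -/
def untwist : M ⊗[k] H →ₗ[k] M :=
  TensorProduct.lift (C.rmul.flip ∘ₗ C.twist Q Q.phi)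

@[simp] theorem untwist_tmul (m : M) (h : H) :
    C.untwist Q (m ⊗ₜ[k] h) = C.rmul h (C.twist Q Q.phi m) := by
  simp [untwist]

/-- `m ⊗ p ⊗ q ↦ m · β S(p) α q`. -/
def contract₂ : M ⊗[k] (H ⊗[k] H) →ₗ[k] M :=
  TensorProduct.lift (C.rmul ∘ₗ LinearMap.mulLeft k Q.β ∘ₗ Q.evα).flip

@[simp] theorem contract₂_tmul (m : M) (t : H ⊗[k] H) :
    C.contract₂ Q (m ⊗ₜ[k] t) = C.rmul (Q.evα t) (C.rmul Q.β m) := by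
  simp [contract₂]

theorem untwist_contract (y : (M ⊗[k] H) ⊗[k] H) :
    C.untwist Q ((C.contract Q).rTensor H y) =
      C.contract₂ Q (C.leftBy (H ⊗[k] H) Q.phi (TensorProduct.assoc k M H H y)) := by
  have : ∀ T m p q, C.rmul q (C.twist Q T (C.contract Q (m ⊗ₜ[k] p))) =
      C.contract₂ Q (C.leftBy (H ⊗[k] H) T (m ⊗ₜ[k] (p ⊗ₜ[k] q))) := by
    intro T m p q
    induction T using tensor3_induction with
    | zero => simp
    | add x y hx hy => simp only [map_add, LinearMap.add_apply, hx, hy]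
    | pure a b c =>
      rw [leftBy_tmul]
      simp [Q.S_mul, QuasiHopfAlgebra.evα_tmul, lact_rmul]
  induction y with
  | zero => simp
  | add x y hx hy => simp only [map_add, hx, hy]
  | tmul x q =>
    induction x with
    | zero => simp
    | add x y hx hy => simp only [map_add, TensorProduct.add_tmul, hx, hy]
    | tmul m p => rw [LinearMap.rTensor_tmul, untwist_tmul, this, TensorProduct.assoc_tmul]

theorem contract₂_rightBy_Δ (T : H ⊗[k] (H ⊗[k] H)) (m : M) (h : H) :
    C.contract₂ Q (C.rightBy (H ⊗[k] H) T (m ⊗ₜ[k] Q.Δ h)) = Q.ε h • C.rmul (Q.zag T) m := by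
  induction T using tensor3_induction with
  | zero => simp
  | add x y hx hy => simp only [map_add, LinearMap.add_apply, smul_add, hx, hy]
  | pure a b c =>
    have : ∀ P, C.contract₂ Q (C.rightBy (H ⊗[k] H) (a ⊗ₜ[k] (b ⊗ₜ[k] c)) (m ⊗ₜ[k] P)) =
        C.rmul c (C.rmul (Q.evα P) (C.rmul (a * Q.β * Q.S b) m)) := by
      intro P
      induction P with
      | zero => simp
      | add x y hx hy =>
        simp only [map_add, LinearMap.add_apply, TensorProduct.tmul_add, hx, hy]
      | tmul p q => simp [rightBy_tmul', QuasiHopfAlgebra.evα_tmul, Q.S_mul]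
    rw [this, Q.evα_Δ]
    simp

namespace IsRightQuasiHopfBimodule

variable {C Q} (hC : C.IsRightQuasiHopfBimodule Q.toQuasiBialgebra)
include hC

/-- `ρ(m₀ · β S(m₁))` contains `Δ(β) Δ(S(m₁)) = δ (S ⊗ S)(Δᵒᵖ(m₁)) f`. Quasi-coassociativity
replaces the iterated coaction by `Δ(m₁)`, conjugated by `Φ`. -/
theorem proj_mem [FiniteDimensional k H] (m : M) : C.proj Q m ∈ C.altCoinvariants Q := by
  have h1 : ∀ x, C.ρ (C.contract Q x) =
      C.contractΔ Q (TensorProduct.assoc k M H H (C.ρ.rTensor H x)) := by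
    intro x
    induction x with
    | zero => simp
    | add x y hx hy => simp only [map_add, hx, hy]
    | tmul m h =>
      rw [contract_tmul, LinearMap.rTensor_tmul, contractΔ_assoc, rmul_apply, rmul_apply,
        hC.ρ_ract, hC.ρ_ract, ← rightBy_mul, Q.Δ_β, mul_assoc, Q.f_mul_Δ_S, mul_assoc]
  have h2 : ∀ x, C.contractΔ Q (C.leftBy (H ⊗[k] H) Q.phiInv (C.rightBy (H ⊗[k] H) Q.phi
      (Q.Δ.toLinearMap.lTensor M x))) = C.sandwich Q.altElement (C.contract Q x) := by
    intro x
    induction x with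
    | zero => simp
    | add x y hx hy => simp only [map_add, hx, hy]
    | tmul m h =>
      rw [contract_tmul]
      exact C.contractΔ_leftBy_rightBy_Δ Q Q.phiInv m h
  change C.ρ (C.proj Q m) = C.sandwich Q.altElement (C.proj Q m)
  rw [proj, LinearMap.comp_apply, h1, hC.coassoc', h2]

-- Inserting the defining formula for `ρ(n)`, the inner `Φ` contracts to `∑ X¹ β S(X²) α X³ = 1`
-- because `∑ f¹ β S(f²) = ε(β) S(α)`; the outer `Φ⁻¹` is left with a counit in its last slot.
omit hC in
theorem _root_.BimoduleWithCoaction.proj_of_mem {n : M} (hn : n ∈ C.altCoinvariants Q) :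
    C.proj Q n = Q.ε Q.β • n := by
  have e : ∀ T, C.contract Q (C.sandwich (Q.altMap T) n) =
      Q.ε Q.β • pairHom C.lact (pairHom (C.ractS Q) (Q.eps _)) T n := by
    intro T
    induction T using tensor3_induction with
    | zero => simp
    | add x y hx hy => simp only [map_add, LinearMap.add_apply, smul_add, hx, hy]
    | pure a b c =>
      rw [Q.altMap_tmul, sandwich_apply, contract_leftBy,
        contract_rightBy, Q.evβ_altTail, Q.zag_idΔ_mul, Q.zag_phi]
      simp [Q.S_one, Q.eps_apply]
  have key : pairHom C.lact (pairHom (C.ractS Q) (Q.eps _)) Q.phiInv = 1 :=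
    (congrArg (fun u : (Module.End k M)ˣ => ((u⁻¹ : (Module.End k M)ˣ) : Module.End k M))
      (Q.ass_eps₃ C.lact (C.ractS Q))).trans (by simp)
  have hn' : C.ρ n = C.sandwich Q.altElement n := hn
  rw [proj, LinearMap.comp_apply, hn']
  exact (e Q.phiInv).trans (by rw [key]; rfl)

/-- Quasi-coassociativity moves `Φ` to the right, where `α` absorbs `Δ(m₁)`; what is left is `∑ X¹ β
S(X²) α X³ = 1` and the counit axiom of `ρ`. -/
theorem untwist_proj (m : M) : C.untwist Q ((C.proj Q).rTensor H (C.ρ m)) = m := by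
  have h : ∀ x, C.contract₂ Q (C.rightBy (H ⊗[k] H) Q.phi (Q.Δ.toLinearMap.lTensor M x)) =
      TensorProduct.rid k M (Q.ε.toLinearMap.lTensor M x) := by
    intro x
    induction x with
    | zero => simp
    | add x y hx hy => simp only [map_add, hx, hy]
    | tmul m h =>
      rw [LinearMap.lTensor_tmul, AlgHom.toLinearMap_apply, contract₂_rightBy_Δ, Q.zag_phi]
      simp
  rw [proj, LinearMap.rTensor_comp, LinearMap.comp_apply, untwist_contract]
  have := hC.quasi_coassoc m
  refine (congrArg (C.contract₂ Q) this).trans ?_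
  refine (h _).trans ?_
  rw [hC.counit, TensorProduct.rid_tmul, one_smul]

theorem rTensor_proj_rightBy (b : H) (w : M ⊗[k] H) :
    (C.proj Q).rTensor H (C.rightBy H (Q.Δ b) w) =
      (LinearMap.mulRight k b).lTensor M ((C.proj Q).rTensor H w) := by
  induction w with
  | zero => simp
  | add x y hx hy => simp only [map_add, hx, hy]
  | tmul m g =>
    have : ∀ t, (C.proj Q).rTensor H (C.rightBy H t (m ⊗ₜ[k] g)) =
        C.proj Q m ⊗ₜ[k] (g * Q.εid t) := by
      intro t
      induction t with
      | zero => simp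
      | add x y hx hy =>
        simp only [map_add, LinearMap.add_apply, mul_add, TensorProduct.tmul_add, hx, hy]
      | tmul x y =>
        rw [rightBy_tmul', LinearMap.rTensor_tmul, hC.proj_ract, Q.εid_tmul, mul_smul_comm,
          TensorProduct.smul_tmul]
    rw [this, Q.εid_Δ]
    simp

theorem rTensor_proj_sandwich (a b x : H) (t : H ⊗[k] H) (n : M) :
    (C.proj Q).rTensor H (C.leftBy H (a ⊗ₜ[k] b) (C.sandwich (x ⊗ₜ[k] t) n)) =
      Q.cp C.lact (C.ractS Q) (a * x) (C.proj Q n) ⊗ₜ[k] (b * Q.εid t) := by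
  induction t with
  | zero => simp
  | add x y hx hy =>
    simp only [map_add, LinearMap.add_apply, mul_add, TensorProduct.tmul_add, hx, hy]
  | tmul r s =>
    rw [sandwich_tmul, leftBy_tmul, LinearMap.rTensor_tmul, ← Module.End.mul_apply (C.lact a),
      ← map_mul, hC.proj_lact, ← rmul_apply, hC.proj_ract, Q.εid_tmul, mul_smul_comm, map_smul,
      TensorProduct.smul_tmul]

/-- The projection turns right multiplications into counits and left multiplication by `a` into `a₁
· _ · S(a₂)`. The remaining factors of `Φ` and `Φ⁻¹` form a zigzag on `b, c, d`, with `β` coming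
from the formula for `ρ(n)` and `α` from `untwist`. -/
theorem rTensor_proj_untwist {n : M} (hn : n ∈ C.altCoinvariants Q) (h : H) :
    (C.proj Q).rTensor H (C.ρ (C.untwist Q (n ⊗ₜ[k] h))) = n ⊗ₜ[k] h := by
  let φ : M ⊗[k] (H ⊗[k] H) →ₗ[k] M ⊗[k] H := TensorProduct.map LinearMap.id Q.mulα
  let a := onL (H ⊗[k] H) (Q.cp C.lact (C.ractS Q))
  let b := onR M (onL H (legL k H))
  let c := onR M (onL H Q.legS)
  let d := onR M (onR H (legL k H))
  let z := matCoeff φ (n ⊗ₜ[k] (Q.β ⊗ₜ[k] h))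
  have key := Q.apply_nestA_inv_zigzag (z := z) (a := a) (b := b) (c := c) (d := d)
    ((Q.colInv_β.tmul_left h).tmul_right n).req (Q.rowInv_mulα.map_right LinearMap.id).leq
  have e1 : ∀ P u v T, z (pairHom a b P * (c u * d v) * pairHom a (pairHom b c) T) =
      (LinearMap.mulRight k (Q.S u * Q.α * v * h)).lTensor M ((C.proj Q).rTensor H
        (C.leftBy H P (C.sandwich
          (Q.altMap T) n))) := by
    intro P u v T
    induction T using tensor3_induction with
    | zero => simp
    | add x y hx hy => simp only [map_add, mul_add, LinearMap.add_apply, hx, hy]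
    | pure x y w =>
      induction P with
      | zero => simp
      | add x y hx hy => simp only [map_add, add_mul, LinearMap.add_apply, hx, hy]
      | tmul p q =>
        -- The scalar `ε(β)` comes from projecting `n`, the scalar `ε(α)` from the counit of `f`.
        have hβα := Q.ε_β_mul_ε_α
        rw [Q.altMap_tmul, hC.rTensor_proj_sandwich, C.proj_of_mem hn,
          Q.altTail_apply, Q.tail_idΔ_mul, map_mul Q.εid, map_mul Q.εid, map_mul Q.εid,
          Q.SSop_apply, Q.εid_flipS,
          Q.idε_Δ, Q.εid_f, Q.εid_tail_phi]
        simp only [Q.εid_tmul, map_one, one_smul, mul_smul_comm, mul_one, map_smul,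
          TensorProduct.tmul_smul, ← TensorProduct.smul_tmul', smul_smul]
        rw [mul_comm, hβα, one_smul]
        simp [a, b, c, d, z, φ, mul_assoc]
  have e1' : ∀ T, z (pairHom (Q.cp a b) (pairHom c d) T * pairHom a (pairHom b c) Q.phiInv) =
      (C.proj Q).rTensor H (C.ρ (C.rmul h (C.twist Q T n))) := by
    intro T
    induction T using tensor3_induction with
    | zero => simp
    | add x y hx hy => simp only [map_add, add_mul, LinearMap.add_apply, hx, hy]
    | pure x y w =>
      have hn' : C.ρ n = C.sandwich Q.altElement n := hn
      rw [pairHom_tmul, pairHom_tmul, Q.cp_apply, e1]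
      rw [twist_tmul, ← rmul_mul, ← rmul_mul, lact_rmul, ← rmul_mul, rmul_apply, hC.ρ_ract,
        hC.rTensor_proj_rightBy, hC.ρ_lact, hn', ← mul_assoc]
      rfl
  have e2 : ∀ T, z (pairHom b (pairHom c d) T) = n ⊗ₜ[k] (Q.zag T * h) := by
    intro T
    induction T using tensor3_induction with
    | zero => simp
    | add x y hx hy => simp only [map_add, add_mul, TensorProduct.tmul_add, hx, hy]
    | pure x y w => simp [b, c, d, z, φ, mul_assoc]
  have h1 := e1' Q.phi
  have h2 := e2 Q.phi
  rw [Q.zag_phi, one_mul] at h2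
  rw [untwist_tmul, ← h1, ← h2]
  refine Eq.trans ?_ key
  rw [QuasiBialgebra.nestA, mul_inv_rev, inv_inv]
  rfl

/-- The structure theorem `M ≅ M^{co H} ⊗ H`. -/
def structureEquiv [FiniteDimensional k H] : M ≃ₗ[k] C.altCoinvariants Q ⊗[k] H :=
  LinearEquiv.ofLinearMap
    (((C.proj Q).codRestrict _ hC.proj_mem).rTensor H ∘ₗ C.ρ)
    (C.untwist Q ∘ₗ (C.altCoinvariants Q).subtype.rTensor H)
    (by
      refine TensorProduct.ext' fun n h => ?_
      -- `H` is flat over `k`, so the identity may be checked in `M ⊗ H`.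
      apply Module.Flat.rTensor_preserves_injective_linearMap (M := H) _
        (C.altCoinvariants Q).injective_subtype
      have := hC.rTensor_proj_untwist n.2 h
      simp only [LinearMap.comp_apply, LinearMap.rTensor_tmul, LinearMap.id_apply,
        Submodule.subtype_apply]
      rw [← LinearMap.comp_apply (LinearMap.rTensor H _), ← LinearMap.rTensor_comp,
        LinearMap.subtype_comp_codRestrict, this])
    (by
      ext m
      simp only [LinearMap.comp_apply, LinearMap.id_apply]
      rw [← LinearMap.comp_apply (LinearMap.rTensor H _), ← LinearMap.rTensor_comp,
        LinearMap.subtype_comp_codRestrict, hC.untwist_proj])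

theorem finrank_altCoinvariants_mul [FiniteDimensional k H] :
    Module.finrank k (C.altCoinvariants Q) * Module.finrank k H = Module.finrank k M := by
  rw [hC.structureEquiv.finrank_eq, Module.finrank_tensorProduct]

end IsRightQuasiHopfBimodule

end BimoduleWithCoaction
end

/-! ### Conjugation rules for `p_R`, `q_R`, `U`, `V`, and slices by a functional -/

noncomputable section

namespace QuasiHopfAlgebra

variable {k : Type u} {H : Type v} [Field k] [Ring H] [Algebra k H] (Q : QuasiHopfAlgebra k H)

/-- `x ⊗ y ↦ Δ(x) p_R (1 ⊗ S(y))`. -/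
def pConj : H ⊗[k] H →ₗ[k] H ⊗[k] H :=
  LinearMap.mul' k _ ∘ₗ TensorProduct.map (LinearMap.mulRight k Q.pR ∘ₗ Q.Δ.toLinearMap)
    ((TensorProduct.mk k H H 1) ∘ₗ Q.S)

@[simp] theorem pConj_tmul (x y : H) :
    Q.pConj (x ⊗ₜ[k] y) = Q.Δ x * Q.pR * 1 ⊗ₜ[k] Q.S y := by simp [pConj]

/-- Moving `Φ⁻¹` past the iterated coproduct leaves `∑ h₂ β S(h₃)`, which collapses and puts `h` on
the right of the first factor. -/
theorem pConj_Δ (h : H) : Q.pConj (Q.Δ h) = Q.pR * h ⊗ₜ[k] 1 := by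
  let a := onL H (legL k H)
  let b := onR H (legL k H)
  let c := onR H Q.legS
  let z := matCoeff (LinearMap.id : H ⊗[k] H →ₗ[k] _) (1 ⊗ₜ[k] Q.β)
  have hr : REq z (Q.cp b c) (Q.eps _) := (Q.colInv_β.tmul_right 1).req
  have key : z (Q.cp (Q.cp a b) c h * (((Q.ass a b c)⁻¹ : _) : Module.End k (H ⊗[k] H))) =
      z ((((Q.ass a b c)⁻¹ : _) : Module.End k (H ⊗[k] H)) * a h) := by
    rw [← hr.cp_eps_right Q.toQuasiBialgebra a]
    congr 1
    rw [Units.eq_inv_mul_iff_mul_eq, ← mul_assoc, Q.ass_intw a b c h, mul_assoc, Units.mul_inv,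
      mul_one]
  have e1 : ∀ P y T, z (pairHom a b P * c y * pairHom a (pairHom b c) T) =
      P * Q.evβ.lTensor H T * 1 ⊗ₜ[k] Q.S y := by
    intro P y T
    induction T using tensor3_induction with
    | zero => simp
    | add x y hx hy => simp only [map_add, mul_add, add_mul, hx, hy]
    | pure p q r =>
      induction P with
      | zero => simp
      | add x y hx hy => simp only [map_add, add_mul, hx, hy]
      | tmul m n => simp [a, b, c, z, evβ_tmul, mul_assoc]
  have e1' : ∀ P, z (pairHom (Q.cp a b) c P * pairHom a (pairHom b c) Q.phiInv) = Q.pConj P := by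
    intro P
    induction P with
    | zero => simp
    | add x y hx hy => simp only [map_add, add_mul, hx, hy]
    | tmul x y => rw [pairHom_tmul, Q.cp_apply, e1, pConj_tmul]; rfl
  have e2 : ∀ T, z (pairHom a (pairHom b c) T * a h) = Q.evβ.lTensor H T * h ⊗ₜ[k] 1 := by
    intro T
    induction T using tensor3_induction with
    | zero => simp
    | add x y hx hy => simp only [map_add, add_mul, hx, hy]
    | pure p q r => simp [a, b, c, z, evβ_tmul, mul_assoc]
  rw [← e1', pR, ← e2]
  exact key

section BijectiveAntipode

variable (hS : Function.Bijective Q.S)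

/-- `x ⊗ y ↦ (S ⊗ S)(Δᵒᵖ(x)) (S ⊗ S)(q_R²¹) (y ⊗ 1)`. -/
def qConj : H ⊗[k] H →ₗ[k] H ⊗[k] H :=
  LinearMap.mul' k _ ∘ₗ TensorProduct.map (LinearMap.mulRight k (Q.flipS (Q.qR hS)) ∘ₗ Q.SSop)
    ((TensorProduct.mk k H H).flip 1)

@[simp] theorem qConj_tmul (x y : H) :
    Q.qConj hS (x ⊗ₜ[k] y) = Q.SSop x * Q.flipS (Q.qR hS) * y ⊗ₜ[k] 1 := by simp [qConj]

theorem qConj_Δ (h : H) : Q.qConj hS (Q.Δ h) = Q.flipS (Q.qR hS) * 1 ⊗ₜ[k] Q.S h := by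
  let φ : (H ⊗[k] H) ⊗[k] H →ₗ[k] H ⊗[k] H := TensorProduct.map Q.evα Q.S
  let a := onR (H ⊗[k] H) (legL k H)
  let b := onL H (onL H (legL k H))
  let c := onL H (onR H (legL k H))
  let z := matCoeff φ ((1 ⊗ₜ[k] 1) ⊗ₜ[k] 1)
  have hl : LEq z (Q.cp b c) (Q.eps _) := (Q.rowInv_evα.map_left _).leq
  have key : z ((Q.ass a b c : Module.End k ((H ⊗[k] H) ⊗[k] H)) * Q.cp (Q.cp a b) c h) =
      z (a h * (Q.ass a b c : Module.End k ((H ⊗[k] H) ⊗[k] H))) := by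
    rw [← hl.cp_eps_right Q.toQuasiBialgebra a, Q.ass_intw a b c h]
  have e1 : ∀ P y T, z (pairHom a (pairHom b c) T * (pairHom a b P * c y)) =
      Q.flipS P * Q.flipS ((Q.evq hS).lTensor H T) * y ⊗ₜ[k] 1 := by
    intro P y T
    induction T using tensor3_induction with
    | zero => simp
    | add x y hx hy => simp only [map_add, mul_add, add_mul, hx, hy]
    | pure p q r =>
      induction P with
      | zero => simp
      | add x y hx hy => simp only [map_add, mul_add, add_mul, hx, hy]
      | tmul m n => simp [a, b, c, z, φ, evα_tmul, evq_tmul, Q.S_mul, S_Sinv, mul_assoc]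
  have e1' : ∀ P, z (pairHom a (pairHom b c) Q.phi * pairHom (Q.cp a b) c P) = Q.qConj hS P := by
    intro P
    induction P with
    | zero => simp
    | add x y hx hy => simp only [map_add, mul_add, hx, hy]
    | tmul x y => rw [pairHom_tmul, Q.cp_apply, e1, qConj_tmul]; rfl
  have e2 : ∀ T, z (a h * pairHom a (pairHom b c) T) =
      Q.flipS ((Q.evq hS).lTensor H T) * 1 ⊗ₜ[k] Q.S h := by
    intro T
    induction T using tensor3_induction with
    | zero => simp
    | add x y hx hy => simp only [map_add, mul_add, add_mul, hx, hy]
    | pure p q r => simp [a, b, c, z, φ, evα_tmul, evq_tmul, Q.S_mul, S_Sinv, mul_assoc]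
  rw [← e1', qR, ← e2]
  exact key

/-- `x ⊗ y ↦ (y ⊗ 1) V Δ(S⁻¹(x))`. -/
def VConj : H ⊗[k] H →ₗ[k] H ⊗[k] H :=
  LinearMap.mul' k _ ∘ₗ (TensorProduct.comm k _ _).toLinearMap ∘ₗ TensorProduct.map
    (LinearMap.mulLeft k (Q.V hS) ∘ₗ Q.Δ.toLinearMap ∘ₗ Q.Sinv hS)
    ((TensorProduct.mk k H H).flip 1)

@[simp] theorem VConj_tmul (x y : H) :
    Q.VConj hS (x ⊗ₜ[k] y) = y ⊗ₜ[k] 1 * (Q.V hS * Q.Δ (Q.Sinv hS x)) := by simp [VConj]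

/-- After `flipS` this is `pConj_Δ` multiplied by `f`. It is the source of left linearity of the
coaction on `H*`. -/
theorem VConj_Δ (h : H) : Q.VConj hS (Q.Δ h) = 1 ⊗ₜ[k] Q.Sinv hS h * Q.V hS := by
  apply Q.flipS_injective hS
  have : ∀ P, Q.flipS (Q.VConj hS P) = Q.f * Q.pConj P := by
    intro P
    induction P with
    | zero => simp
    | add x y hx hy => simp only [map_add, mul_add, hx, hy]
    | tmul x y =>
      rw [VConj_tmul, flipS_mul, flipS_mul, flipS_V, ← SSop_apply, ← mul_assoc (Q.SSop _),
        SSop_Sinv, pConj_tmul, flipS_tmul, Q.S_one]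
      simp only [mul_assoc]
  rw [this, pConj_Δ, flipS_mul, flipS_V, flipS_tmul, S_Sinv, Q.S_one, mul_assoc]

/-- `x ⊗ y ↦ Δ(S(x)) U (y ⊗ 1)`. -/
def UConj : H ⊗[k] H →ₗ[k] H ⊗[k] H :=
  LinearMap.mul' k _ ∘ₗ TensorProduct.map
    (LinearMap.mulRight k (Q.U hS) ∘ₗ Q.Δ.toLinearMap ∘ₗ Q.S)
    ((TensorProduct.mk k H H).flip 1)

@[simp] theorem UConj_tmul (x y : H) :
    Q.UConj hS (x ⊗ₜ[k] y) = Q.Δ (Q.S x) * Q.U hS * y ⊗ₜ[k] 1 := by simp [UConj]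

/-- `f⁻¹` is moved out to the left, which reduces this to `qConj_Δ`; it is the source of right
linearity of the coaction on `H*`. -/
theorem UConj_Δ [FiniteDimensional k H] (h : H) :
    Q.UConj hS (Q.Δ h) = Q.U hS * 1 ⊗ₜ[k] Q.S h := by
  have : ∀ P, Q.UConj hS P = Q.fInv * Q.qConj hS P := by
    intro P
    induction P with
    | zero => simp
    | add x y hx hy => simp only [map_add, mul_add, hx, hy]
    | tmul x y =>
      rw [UConj_tmul, U_eq, ← mul_assoc, Δ_S_mul_fInv, qConj_tmul]
      simp only [mul_assoc]
  rw [this, qConj_Δ, U_eq, mul_assoc]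

theorem Δbar_apply (x : H) : Q.Δbar hS x = Q.V hS * Q.Δ x * Q.U hS := rfl

end BijectiveAntipode

/-- `r ⊗ h ↦ l(h) r`. -/
def slice (l : Module.Dual k H) : H ⊗[k] H →ₗ[k] H :=
  (TensorProduct.rid k H).toLinearMap ∘ₗ l.lTensor H

@[simp] theorem slice_tmul (l : Module.Dual k H) (x y : H) : slice l (x ⊗ₜ[k] y) = l y • x := by
  simp [slice]

theorem slice_mulLeft (l : Module.Dual k H) (a : H) (t : H ⊗[k] H) :
    slice (l ∘ₗ LinearMap.mulLeft k a) t = slice l (1 ⊗ₜ[k] a * t) := by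
  induction t with
  | zero => simp
  | add x y hx hy => simp only [map_add, mul_add, hx, hy]
  | tmul x y => simp

theorem slice_mulRight (l : Module.Dual k H) (a : H) (t : H ⊗[k] H) :
    slice (l ∘ₗ LinearMap.mulRight k a) t = slice l (t * 1 ⊗ₜ[k] a) := by
  induction t with
  | zero => simp
  | add x y hx hy => simp only [map_add, add_mul, hx, hy]
  | tmul x y => simp

theorem slice_left (l : Module.Dual k H) (a : H) (t : H ⊗[k] H) :
    slice l (a ⊗ₜ[k] 1 * t) = a * slice l t := by
  induction t with
  | zero => simp
  | add x y hx hy => simp only [map_add, mul_add, hx, hy]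
  | tmul x y => simp

theorem slice_right (l : Module.Dual k H) (a : H) (t : H ⊗[k] H) :
    slice l (t * a ⊗ₜ[k] 1) = slice l t * a := by
  induction t with
  | zero => simp
  | add x y hx hy => simp only [map_add, add_mul, hx, hy]
  | tmul x y => simp

theorem ε_slice (l : Module.Dual k H) (t : H ⊗[k] H) : Q.ε (slice l t) = l (Q.εid t) := by
  induction t with
  | zero => simp
  | add x y hx hy => simp only [map_add, hx, hy]
  | tmul x y => simp [mul_comm]

theorem slice₃_left (l : Module.Dual k H) (s : H ⊗[k] H) (t : H ⊗[k] (H ⊗[k] H)) :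
    (slice l).lTensor H (legs₁₂ k H s * t) = s * (slice l).lTensor H t := by
  induction t using tensor3_induction with
  | zero => simp
  | add x y hx hy => simp only [map_add, mul_add, hx, hy]
  | pure p q r =>
    induction s with
    | zero => simp
    | add x y hx hy => simp only [map_add, add_mul, hx, hy]
    | tmul x y => simp [legs₁₂_tmul]

theorem slice₃_right (l : Module.Dual k H) (s : H ⊗[k] H) (t : H ⊗[k] (H ⊗[k] H)) :
    (slice l).lTensor H (t * legs₁₂ k H s) = (slice l).lTensor H t * s := by
  induction t using tensor3_induction with
  | zero => simp
  | add x y hx hy => simp only [map_add, add_mul, hx, hy]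
  | pure p q r =>
    induction s with
    | zero => simp
    | add x y hx hy => simp only [map_add, mul_add, hx, hy]
    | tmul x y => simp [legs₁₂_tmul]

theorem slice₃_Δid (l : Module.Dual k H) (t : H ⊗[k] H) :
    (slice l).lTensor H (Q.Δid t) = Q.Δ (slice l t) := by
  induction t with
  | zero => simp
  | add x y hx hy => simp only [map_add, hx, hy]
  | tmul x y =>
    rw [Δid_tmul, slice₃_left, slice_tmul, map_smul, leg₃_apply, LinearMap.lTensor_tmul,
      slice_tmul, TensorProduct.tmul_smul, ← Algebra.TensorProduct.one_def, mul_smul_comm, mul_one]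

theorem lTensor_Δbar (hS : Function.Bijective Q.S) (t : H ⊗[k] H) :
    (Q.Δbar hS).lTensor H t =
      legs₂₃ k H (Q.V hS) * Q.idΔ t * legs₂₃ k H (Q.U hS) := by
  induction t with
  | zero => simp
  | add x y hx hy => simp only [map_add, mul_add, add_mul, hx, hy]
  | tmul x y => simp [legs₂₃_apply, idΔ_tmul, Δbar_apply]

/-! ### The bimodule `H*` and the dimension of its coinvariants -/

section DualBimodule

theorem dualTensorHom_lTensor {R R' : Type*} [AddCommGroup R] [Module k R] [AddCommGroup R']
    [Module k R'] (g : R →ₗ[k] R') (t : Module.Dual k H ⊗[k] R) (x : H) :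
    dualTensorHom k H R' (g.lTensor _ t) x = g (dualTensorHom k H R t x) := by
  induction t with
  | zero => simp
  | add x y hx hy => simp only [map_add, LinearMap.add_apply, hx, hy]
  | tmul l r => simp

variable [FiniteDimensional k H] (hS : Function.Bijective Q.S)

theorem dualTensorHom_injective (R : Type*) [AddCommGroup R] [Module k R] :
    Function.Injective (dualTensorHom k H R) :=
  (dualTensorHomEquiv k H R).injective

/-- Viewing `H* ⊗ R` as `Hom(H, R)` removes the basis from the coaction: `ρ(l)` is `x ↦ (id ⊗ l)(V
Δ(x) U)`. Each bimodule axiom becomes an identity in tensor powers of `H`, checked at one `x`. -/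
theorem dualTensorHom_ρ (l : Module.Dual k H) (x : H) :
    dualTensorHom k H H ((Q.dualBimodule hS).ρ l) x = slice l (Q.Δbar hS x) := by
  have h : ∀ t : H ⊗[k] H, ∑ i, (TensorProduct.dualDistrib k H H
      (((Module.finBasis k H).coord i) ⊗ₜ[k] l) t) • Module.finBasis k H i = slice l t := by
    intro t
    induction t with
    | zero => simp
    | add x y hx hy => simp only [map_add, add_smul, Finset.sum_add_distrib, hx, hy]
    | tmul x y =>
      simp only [TensorProduct.dualDistrib_apply, slice_tmul, mul_comm _ (l y), mul_smul,
        ← Finset.smul_sum, Module.Basis.coord_apply]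
      rw [(Module.finBasis k H).sum_repr]
  rw [← h]
  simp only [dualBimodule, LinearMap.sum_apply, map_sum, LinearMap.comp_apply,
    LinearMap.flip_apply, TensorProduct.mk_apply, dualTensorHom_apply]
  rfl

theorem dualTensorHom_leftBy {R : Type v} [Ring R] [Algebra k R] (a : H) (s : R)
    (t : Module.Dual k H ⊗[k] R) (x : H) :
    dualTensorHom k H R ((Q.dualBimodule hS).leftBy R (a ⊗ₜ[k] s) t) x =
      s * dualTensorHom k H R t (Q.Sinv hS a * x) := by
  induction t with
  | zero => simp
  | add x y hx hy => simp only [map_add, LinearMap.add_apply, mul_add, hx, hy]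
  | tmul l r => simp [BimoduleWithCoaction.leftBy_tmul, dualBimodule]

theorem dualTensorHom_rightBy {R : Type v} [Ring R] [Algebra k R] (a : H) (s : R)
    (t : Module.Dual k H ⊗[k] R) (x : H) :
    dualTensorHom k H R ((Q.dualBimodule hS).rightBy R (a ⊗ₜ[k] s) t) x =
      dualTensorHom k H R t (x * Q.S a) * s := by
  induction t with
  | zero => simp
  | add x y hx hy => simp only [map_add, LinearMap.add_apply, add_mul, hx, hy]
  | tmul l r => simp [BimoduleWithCoaction.rightBy_tmul, dualBimodule]

theorem dualTensorHom_assoc_ρ (w : Module.Dual k H ⊗[k] H) (x : H) :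
    dualTensorHom k H (H ⊗[k] H) (TensorProduct.assoc k _ H H
      ((Q.dualBimodule hS).ρ.rTensor H w)) x =
      (dualTensorHom k H H w).lTensor H (Q.Δbar hS x) := by
  have h : ∀ (y : Module.Dual k H ⊗[k] H) (h : H), dualTensorHom k H (H ⊗[k] H)
      (TensorProduct.assoc k _ H H (y ⊗ₜ[k] h)) x = dualTensorHom k H H y x ⊗ₜ[k] h := by
    intro y h
    induction y with
    | zero => simp
    | add x y hx hy =>
      simp only [map_add, LinearMap.add_apply, TensorProduct.add_tmul, hx, hy]
    | tmul l r => simp [TensorProduct.smul_tmul']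
  have h' : ∀ (l : Module.Dual k H) (h : H) (t : H ⊗[k] H), slice l t ⊗ₜ[k] h =
      (dualTensorHom k H H (l ⊗ₜ[k] h)).lTensor H t := by
    intro l h t
    induction t with
    | zero => simp
    | add x y hx hy => simp only [map_add, TensorProduct.add_tmul, hx, hy]
    | tmul x y => simp [TensorProduct.smul_tmul]
  induction w with
  | zero => simp
  | add x y hx hy =>
    simp only [map_add, LinearMap.add_apply, LinearMap.lTensor_add, hx, hy]
  | tmul l r => rw [LinearMap.rTensor_tmul, h, dualTensorHom_ρ, h']

theorem dualBimodule_isRightQuasiHopfBimodule :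
    (Q.dualBimodule hS).IsRightQuasiHopfBimodule Q.toQuasiBialgebra where
  ρ_lact a l := by
    apply dualTensorHom_injective
    ext x
    have h : ∀ P, dualTensorHom k H H ((Q.dualBimodule hS).leftBy H P
        ((Q.dualBimodule hS).ρ l)) x = slice l (Q.VConj hS P * Q.Δ x * Q.U hS) := by
      intro P
      induction P with
      | zero => simp
      | add x y hx hy => simp only [map_add, LinearMap.add_apply, add_mul, hx, hy]
      | tmul a b =>
        rw [dualTensorHom_leftBy, dualTensorHom_ρ, VConj_tmul, mul_assoc, mul_assoc, slice_left,
          Δbar_apply, map_mul Q.Δ]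
        simp only [mul_assoc]
    rw [dualTensorHom_ρ, h, VConj_Δ, mul_assoc, mul_assoc, ← mul_assoc (Q.V hS),
      ← slice_mulLeft]
    rfl
  ρ_ract a l := by
    apply dualTensorHom_injective
    ext x
    have h : ∀ P, dualTensorHom k H H ((Q.dualBimodule hS).rightBy H P
        ((Q.dualBimodule hS).ρ l)) x = slice l (Q.V hS * Q.Δ x * Q.UConj hS P) := by
      intro P
      induction P with
      | zero => simp
      | add x y hx hy => simp only [map_add, LinearMap.add_apply, mul_add, hx, hy]
      | tmul a b =>
        rw [dualTensorHom_rightBy, dualTensorHom_ρ, UConj_tmul, ← mul_assoc, slice_right,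
          Δbar_apply, map_mul Q.Δ]
        simp only [mul_assoc]
    rw [dualTensorHom_ρ, h, UConj_Δ, ← mul_assoc, ← slice_mulRight]
    rfl
  counit l := by
    apply dualTensorHom_injective
    ext x
    rw [dualTensorHom_lTensor, dualTensorHom_ρ, dualTensorHom_apply]
    have := Q.εid_U_V hS
    rw [AlgHom.toLinearMap_apply, ε_slice, Δbar_apply, map_mul Q.εid, map_mul Q.εid, this.1, this.2, εid_Δ]
    simp
  quasi_coassoc l := by
    apply dualTensorHom_injective
    ext x
    have h1 : ∀ T, dualTensorHom k H (H ⊗[k] H) ((Q.dualBimodule hS).leftBy (H ⊗[k] H) T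
        (TensorProduct.assoc k _ H H ((Q.dualBimodule hS).ρ.rTensor H
          ((Q.dualBimodule hS).ρ l)))) x = (slice l).lTensor H (Q.VCol hS T *
            (Q.idΔ (Q.Δ x) * (Q.idΔ (Q.U hS) * legs₂₃ k H (Q.U hS)))) := by
      intro T
      induction T with
      | zero => simp
      | add x y hx hy => simp only [map_add, LinearMap.add_apply, add_mul, hx, hy]
      | tmul a t =>
        have hρ : dualTensorHom k H H ((Q.dualBimodule hS).ρ l) = slice l ∘ₗ Q.Δbar hS :=
          LinearMap.ext fun x => Q.dualTensorHom_ρ hS l x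
        rw [dualTensorHom_leftBy, dualTensorHom_assoc_ρ, hρ, LinearMap.lTensor_comp,
          LinearMap.comp_apply, lTensor_Δbar, ← slice₃_left, VCol_tmul, Δbar_apply]
        simp only [map_mul, mul_assoc]
    have h2 : ∀ T, dualTensorHom k H (H ⊗[k] H) ((Q.dualBimodule hS).rightBy (H ⊗[k] H) T
        (Q.Δ.toLinearMap.lTensor _ ((Q.dualBimodule hS).ρ l))) x =
        (slice l).lTensor H (Q.Δid (Q.V hS * Q.Δ x) * Q.UCol hS T) := by
      intro T
      induction T with
      | zero => simp
      | add x y hx hy => simp only [map_add, LinearMap.add_apply, mul_add, hx, hy]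
      | tmul a t =>
        rw [dualTensorHom_rightBy, dualTensorHom_lTensor, dualTensorHom_ρ, UCol_tmul,
          ← mul_assoc, slice₃_right, ← map_mul, slice₃_Δid, Δbar_apply, AlgHom.toLinearMap_apply,
          map_mul Q.Δ x]
        simp only [mul_assoc]
    refine (h1 Q.phi).trans (Eq.trans ?_ (h2 Q.phi).symm)
    -- The `Φ` produced by `U` moves through the iterated coproduct of `x` and is absorbed by `V`.
    rw [idΔ_U_mul, ← mul_assoc (Q.idΔ _), ← Φ_mul_Δid_Δ, map_mul Q.Δid, ← VCol_phi_mul_phi]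
    simp only [mul_assoc]

theorem finrank_leftAltCointegrals : Module.finrank k (Q.leftAltCointegrals hS) = 1 := by
  have e := (Q.dualBimodule_isRightQuasiHopfBimodule hS).finrank_altCoinvariants_mul
  rw [Subspace.dual_finrank_eq] at e
  -- The counit maps to a field, so `H` is nonzero and `dim H` may be cancelled.
  have : Nontrivial H := Q.ε.toRingHom.domain_nontrivial
  have hpos : 0 < Module.finrank k H := Module.finrank_pos
  exact (Nat.eq_of_mul_eq_mul_right hpos (by rw [one_mul]; exact e))

end DualBimodule

end QuasiHopfAlgebra

end

theorem theorem3p7 {k : Type u} {H : Type v} [Field k] [Ring H] [Algebra k H]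
    [FiniteDimensional k H] (Q : QuasiHopfAlgebra k H) :
    ∃ hS : Function.Bijective Q.S,
      (Q.dualBimodule hS).IsRightQuasiHopfBimodule Q.toQuasiBialgebra ∧
        Module.finrank k (Q.leftAltCointegrals hS) = 1 :=
  ⟨Q.antipode_bijective, Q.dualBimodule_isRightQuasiHopfBimodule _,
    Q.finrank_leftAltCointegrals _⟩
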